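/- Let $G$ be a real reductive linear group, that is, a reductive Lie group $(G,K,\theta,B)$ in Harish-Chandra's class (each $\mathrm{Ad}(g)$ is an inner automorphism of $\mathfrak g=\mathfrak g_0\otimes_{\mathbb R}\mathbb C$, and $G=K\exp(\mathfrak p_0)$ with $K$ compact) which has a faithful finite-dimensional representation and abelian Cartan subgroups. Assume $G$ is simply laced: all roots in each simple factor of the root system have the same length. Let $p:\widetilde G\to G$ be a two-fold cover, i.e. a central extension by a group $\{1,-1\}$ of order two. For a real or imaginary root $\alpha$ of a $\theta$-stable Cartan subgroup let $M_\alpha\subset G$ be the analytic subgroup with Lie algebra $\mathfrak m_\alpha\cap\mathfrak g_0$, where $\mathfrak m_\alpha\subset\mathfrak g$ is generated by the root vectors for $\pm\alpha$; a real or noncompact imaginary root $\alpha$ is metaplectic if $p^{-1}(M_\alpha)$ has no faithful finite-dimensional representation. Assume $\widetilde G$ is admissible: for every $\theta$-stable Cartan subgroup, every long real or long noncompact imaginary root is metaplectic (in the simply laced case all roots are long). Let $H$ be a $\theta$-stable Cartan subgroup of $G$ with Lie algebra $\mathfrak h_0$ and complexification $\mathfrak h$, let $\widetilde H=p^{-1}(H)$,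 $\Delta=\Delta(\mathfrak g,\mathfrak h)$, let $\Delta^r$ and $\Delta^i$ be the sets of real and of imaginary roots, and let $\widetilde{\exp}:\mathfrak h_0\to\widetilde H$ be the exponential map. For $\lambda\in\mathfrak h^*$ put $\Delta(\lambda)=\{\alpha\in\Delta : \langle\lambda,\alpha^\vee\rangle\in\mathbb Z\}$ (integral roots) and $\Delta_{1/2}(\lambda)=\{\alpha\in\Delta : \langle\lambda,m(\alpha)\alpha^\vee\rangle\in\mathbb Z\}$ (half-integral roots), where $m(\alpha)=2$ if $\alpha$ is metaplectic and $m(\alpha)=1$ otherwise. A genuine regular character $\gamma=(\widetilde H,\Gamma,\lambda)$ consists of an irreducible finite-dimensional continuous representation $\Gamma$ of $\widetilde H$ that does not factor through $H$ and of $\lambda\in\mathfrak h^*$, such that $\langle\lambda,\alpha^\vee\rangle\in\mathbb R^\times$ for $\alpha\in\Delta^i$, $\langle\lambda,\alpha^\vee\rangle\ne0$ for $\alpha\in\Delta$, and $d\Gamma=\lambda+\rho_i(\lambda)-2\rho_{i,c}(\lambda)$; here $\rho_i(\lambda)$ and $\rho_{i,c}(\lambda)$ are half the sums of the imaginary, respectively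 compact imaginary, roots $\alpha$ with $\langle\lambda,\alpha^\vee\rangle>0$. For $\alpha\in\Delta^r$ choose $E_\alpha\in\mathfrak g_0$ in the root space of $\alpha$ with $[E_\alpha,-\theta E_\alpha]=\alpha^\vee$, and let $m_\alpha\in\widetilde H$ be the exponential in $\widetilde G$ of $\pi(E_\alpha+\theta E_\alpha)$ (well defined up to inverse). Let $\epsilon_\alpha=\prod_{\beta\in S}(-1)^{\langle\beta,\alpha^\vee\rangle}$, where $S$ is a set of representatives of the sets $\{\pm\beta,\pm\theta\beta\}$ of complex roots. The root $\alpha$ satisfies the parity condition (for $\gamma$) if every eigenvalue of $\Gamma(m_\alpha)$ is one of $-\epsilon_\alpha e^{\pm\pi i\langle\lambda,\alpha^\vee\rangle}$. Then the following hold. 1. Let $\gamma=(\widetilde H,\Gamma,\lambda)$ be a genuine regular character. (a) $\{\alpha\in\Delta^r\cap\Delta_{1/2}(\lambda) : \alpha \text{ does not satisfy the parity condition}\}=\Delta^r\cap\Delta(\lambda)$; that is, a half-integral real root fails the parity condition if and only if it is integral. The same is true for every other choice of the signs $\epsilon_\alpha\in\{\pm1\}$. (b) $\{\alpha\in\Delta^i\cap\Delta_{1/2}(\lambda)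 : \alpha\text{ is compact}\}=\Delta^i\cap\Delta(\lambda)$; every imaginary root is half-integral, and an imaginary root is compact if and only if it is integral. 2. If $\alpha$ is an imaginary root, then $\widetilde{\exp}(2\pi i\alpha^\vee)=1$ if $\alpha$ is compact, and $\widetilde{\exp}(2\pi i\alpha^\vee)=-1$ if $\alpha$ is noncompact. 3. If $\alpha$ is a complex root (neither real nor imaginary), then $\widetilde{\exp}(2\pi i(\alpha^\vee+\theta\alpha^\vee))=1$ if $\langle\alpha,\theta\alpha^\vee\rangle=0$, and $\widetilde{\exp}(2\pi i(\alpha^\vee+\theta\alpha^\vee))=-1$ if $\langle\alpha,\theta\alpha^\vee\rangle\neq0$. -/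

import Mathlib

open scoped TensorProduct

noncomputable section

attribute [local instance 100] LieRing.ofAssociativeRing

/-- `φ` is the one-parameter subgroup of the topological group `S` with infinitesimal generator `X`;
here the Lie algebra of `S` is realized by real matrices through the map `π : S → GL(n, ℝ)`, which
is a faithful representation, or the composition of a covering with a faithful representation. -/
def IsOneParam {n : ℕ} {S : Type*} [Group S] [TopologicalSpace S] (π : S →* GL (Fin n) ℝ)
    (X : Matrix (Fin n) (Fin n) ℝ) (φ : ℝ → S) : Prop :=
  Continuous φ ∧ (∀ s t, φ (s + t) = φ s * φ t) ∧
    ∀ t : ℝ, (π (φ t) : Matrix (Fin n) (Fin n) ℝ) = NormedSpace.exp (t • X)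

/-- `x` is the value at `X` of the exponential map of `S`. -/
def IsExp {n : ℕ} {S : Type*} [Group S] [TopologicalSpace S] (π : S →* GL (Fin n) ℝ)
    (X : Matrix (Fin n) (Fin n) ℝ) (x : S) : Prop :=
  ∃ φ : ℝ → S, IsOneParam π X φ ∧ φ 1 = x

/-- `S` does not admit a faithful finite-dimensional representation. -/
def IsNonlinearGroup (S : Type*) [Group S] [TopologicalSpace S] : Prop :=
  ¬ ∃ (m : ℕ) (f : S →* GL (Fin m) ℂ), Continuous f ∧ Function.Injective f

/-- The complexification `ℂ ⊗ L` of a real Lie algebra. -/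
abbrev Complexification (L : Type*) [LieRing L] [LieAlgebra ℝ L] :=
  letI : Module ℝ ℂ := Algebra.toModule
  ℂ ⊗[ℝ] L

/-- The inclusion `X ↦ 1 ⊗ X` of a real Lie algebra in its complexification. -/
def toComplexification {L : Type*} [LieRing L] [LieAlgebra ℝ L] (X : L) : Complexification L :=
  (1 : ℂ) ⊗ₜ[ℝ] X

/-- The complex linear extension of a real linear map. -/
def complexifyMap {L L' : Type*} [LieRing L] [LieAlgebra ℝ L] [LieRing L'] [LieAlgebra ℝ L']
    (f : L →ₗ[ℝ] L') : Complexification L →ₗ[ℂ] Complexification L' :=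
  f.baseChange ℂ

/-- Inclusion of real matrices in complex matrices. -/
def realToComplexMatrix (n : ℕ) :
    Matrix (Fin n) (Fin n) ℝ →ₗ[ℝ] Matrix (Fin n) (Fin n) ℂ :=
  (Algebra.linearMap ℝ ℂ).mapMatrix

/-- The complexification of a real Lie algebra of matrices, mapped to complex matrices. -/
def complexMatrix {n : ℕ} (L : LieSubalgebra ℝ (Matrix (Fin n) (Fin n) ℝ)) :
    Complexification L →ₗ[ℂ] Matrix (Fin n) (Fin n) ℂ :=
  (realToComplexMatrix n ∘ₗ (L.incl : L →ₗ[ℝ] Matrix (Fin n) (Fin n) ℝ)).liftBaseChange ℂ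

/-- A real reductive linear group `(G, K, θ, B)`: a reductive group in Harish-Chandra's class
with a faithful finite-dimensional representation and abelian Cartan subgroups.  A faithful
complex representation may be viewed as a real one, so the representation `ρ` is taken real, and the
Lie algebra of `G` is realized by real matrices through the differential of `ρ`.  The Lie group
structure of `G` is determined by its topology: `K` is isomorphic to a compact, hence closed,
subgroup of `GL(n, ℝ)`, and `G` is homeomorphic to `K × 𝔭₀`. -/
structure RealReductiveLinear (G : Type*) [Group G] [TopologicalSpace G] [IsTopologicalGroup G]
    (n : ℕ) where
  /-- a faithful finite-dimensional representation -/
  ρ : G →* GL (Fin n) ℝ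
  ρ_continuous : Continuous ρ
  ρ_injective : Function.Injective ρ
  /-- the Lie algebra of `G`: its elements are the generators of the one-parameter subgroups -/
  g₀ : LieSubalgebra ℝ (Matrix (Fin n) (Fin n) ℝ)
  mem_g₀ : ∀ X, X ∈ g₀ ↔ ∃ φ : ℝ → G, IsOneParam ρ X φ
  reductive : LieAlgebra.radical ℝ g₀ = LieAlgebra.center ℝ g₀
  /-- the maximal compact subgroup -/
  K : Subgroup G
  K_compact : IsCompact (K : Set G)
  /-- the Cartan involution of the Lie algebra -/
  θ : g₀ →ₗ⁅ℝ⁆ g₀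
  θ_invol : ∀ X, θ (θ X) = X
  /-- the fixed points of `θ` are the Lie algebra of `K` -/
  θ_fixed : ∀ X : g₀, θ X = X ↔ ∃ φ : ℝ → G, IsOneParam ρ X φ ∧ ∀ t, φ t ∈ K
  /-- the invariant bilinear form -/
  B : LinearMap.BilinForm ℝ g₀
  B_symm : ∀ X Y, B X Y = B Y X
  B_Ad : ∀ (g : G) (X Y X' Y' : g₀),
    (X' : Matrix (Fin n) (Fin n) ℝ) = (ρ g).val * X * (ρ g⁻¹).val →
    (Y' : Matrix (Fin n) (Fin n) ℝ) = (ρ g).val * Y * (ρ g⁻¹).val → B X' Y' = B X Y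
  B_θ : ∀ X Y, B (θ X) (θ Y) = B X Y
  B_pos : ∀ X : g₀, θ X = -X → X ≠ 0 → 0 < B X X
  B_neg : ∀ X : g₀, θ X = X → X ≠ 0 → B X X < 0
  /-- the polar decomposition `K × 𝔭₀ ≃ G`, `(k, X) ↦ k exp X` -/
  polar : ∃ e : (K × {X : g₀ // θ X = -X}) ≃ₜ G,
    ∀ (k : K) (X : {X : g₀ // θ X = -X}), IsExp ρ (X : g₀) ((k : G)⁻¹ * e (k, X))
  /-- Harish-Chandra's condition: `Ad g` is an inner automorphism of the complexification, that is,
  it is in the group generated by all `exp (ad Z) = Ad (exp Z)` -/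
  inner : ∀ g : G, ∃ u ∈ Subgroup.closure {u : GL (Fin n) ℂ |
      ∃ Z : Complexification g₀, u.val = NormedSpace.exp (complexMatrix g₀ Z)},
    ∀ X : g₀, realToComplexMatrix n ((ρ g).val * X * (ρ g⁻¹).val) =
      u.val * realToComplexMatrix n X * (u⁻¹).val
  /-- Cartan subgroups are abelian -/
  abelian_cartan : ∀ h₀ : LieSubalgebra ℝ g₀, h₀.IsCartanSubalgebra →
    ∀ a b : G, (∀ X ∈ h₀, Commute (ρ a).val (X : Matrix (Fin n) (Fin n) ℝ)) →
      (∀ X ∈ h₀, Commute (ρ b).val (X : Matrix (Fin n) (Fin n) ℝ)) → a * b = b * a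

variable {G : Type*} [Group G] [TopologicalSpace G] [IsTopologicalGroup G] {n : ℕ}

namespace RealReductiveLinear

/-- A `θ`-stable Cartan subalgebra of the Lie algebra of `G`; it determines a `θ`-stable Cartan
subgroup. -/
structure Cartan (R : RealReductiveLinear G n) where
  h₀ : LieSubalgebra ℝ R.g₀
  isCartan : h₀.IsCartanSubalgebra
  θ_stable : ∀ X ∈ h₀, R.θ X ∈ h₀

/-- The complexified Lie algebra. -/
abbrev g (R : RealReductiveLinear G n) := Complexification R.g₀

/-- The complexified Cartan involution. -/
def θg (R : RealReductiveLinear G n) : R.g →ₗ[ℂ] R.g :=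
  complexifyMap (R.θ : R.g₀ →ₗ[ℝ] R.g₀)

namespace Cartan

variable {R : RealReductiveLinear G n} (H : R.Cartan)

/-- The Cartan subgroup: the centralizer of the Cartan subalgebra in `G`. -/
def group : Subgroup G where
  carrier := {a | ∀ X ∈ H.h₀, Commute (R.ρ a).val (X : Matrix (Fin n) (Fin n) ℝ)}
  one_mem' := fun X _ => by simp
  mul_mem' := fun {a b} ha hb X hX => by
    simpa using (ha X hX).mul_left (hb X hX)
  inv_mem' := fun {a} ha X hX => by
    simpa only [map_inv] using (ha X hX).units_inv_left

/-- The complexified Cartan subalgebra. -/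
abbrev h := Complexification H.h₀

/-- Its complex dual. -/
abbrev hDual := Module.Dual ℂ H.h

/-- The inclusion of the complexified Cartan subalgebra in the complexified Lie algebra. -/
def incl : H.h →ₗ[ℂ] R.g := complexifyMap (H.h₀.incl : H.h₀ →ₗ[ℝ] R.g₀)

/-- The real Cartan subalgebra in its complexification. -/
def ofReal (X : H.h₀) : H.h := toComplexification X

/-- The Cartan involution on the real Cartan subalgebra. -/
def θh₀ : H.h₀ →ₗ[ℝ] H.h₀ where
  toFun X := ⟨R.θ X, H.θ_stable X X.2⟩
  map_add' X Y := by ext1; simp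
  map_smul' c X := by ext1; simp

/-- The Cartan involution on the complexified Cartan subalgebra. -/
def θh : H.h →ₗ[ℂ] H.h := complexifyMap H.θh₀

/-- The `α`-eigenspace of the Cartan subalgebra in the complexified Lie algebra. -/
def rootSpace (α : H.hDual) : Submodule ℂ R.g where
  carrier := {Z | ∀ X : H.h₀, ⁅H.incl (H.ofReal X), Z⁆ = α (H.ofReal X) • Z}
  zero_mem' := fun X => by rw [lie_zero, smul_zero]
  add_mem' := fun {Z W} hZ hW X => by rw [lie_add, hZ X, hW X, smul_add]
  smul_mem' := fun c Z hZ X => by rw [lie_smul, hZ X, smul_comm]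

/-- The set `Δ` of roots. -/
def roots : Set H.hDual := {α | α ≠ 0 ∧ H.rootSpace α ≠ ⊥}

/-- `c` is the coroot of `α`: it lies in `[𝔤_α, 𝔤_{-α}]` and `α(c) = 2`.  (The root spaces are
one-dimensional.) -/
def IsCoroot (α : H.hDual) (c : H.h) : Prop :=
  (∃ E ∈ H.rootSpace α, ∃ F ∈ H.rootSpace (-α), ⁅E, F⁆ = H.incl c) ∧ α c = 2

/-- The coroot of `α` (of interest only for roots). -/
def coroot (α : H.hDual) : H.h := Classical.epsilon (H.IsCoroot α)

/-- The pairing `⟨μ, α^∨⟩`. -/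
def pairing (μ α : H.hDual) : ℂ := μ (H.coroot α)

/-- The real roots: `θ α = -α`. -/
def realRoots : Set H.hDual := {α ∈ H.roots | α ∘ₗ H.θh = -α}

/-- The imaginary roots: `θ α = α`. -/
def imagRoots : Set H.hDual := {α ∈ H.roots | α ∘ₗ H.θh = α}

/-- The complex roots: those neither real nor imaginary. -/
def complexRoots : Set H.hDual := {α ∈ H.roots | α ∘ₗ H.θh ≠ -α ∧ α ∘ₗ H.θh ≠ α}

/-- The compact imaginary roots: the root space is contained in `𝔨`. -/
def compactRoots : Set H.hDual := {α ∈ H.imagRoots | ∀ Z ∈ H.rootSpace α, R.θg Z = Z}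

/-- The noncompact imaginary roots: the root space is contained in `𝔭`. -/
def noncompactRoots : Set H.hDual := {α ∈ H.imagRoots | ∀ Z ∈ H.rootSpace α, R.θg Z = -Z}

/-- Two roots are in the same simple factor of the root system: they are connected by a chain of
roots whose consecutive members are not orthogonal. -/
def SameFactor : H.hDual → H.hDual → Prop :=
  Relation.EqvGen fun α β => α ∈ H.roots ∧ β ∈ H.roots ∧ H.pairing α β ≠ 0

/-- The squared length of a root for the Weyl group invariant inner product
`(x, y) = ∑_{β ∈ Δ} ⟨x, β^∨⟩ ⟨y, β^∨⟩`. -/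
def lengthSq (α : H.hDual) : ℝ := (∑ᶠ (β) (_ : β ∈ H.roots), (H.pairing α β) ^ 2).re

/-- A root is long if no root in its simple factor has greater length. -/
def longRoots : Set H.hDual :=
  {α ∈ H.roots | ∀ β ∈ H.roots, H.SameFactor α β → H.lengthSq β ≤ H.lengthSq α}

/-- The subalgebra `𝔪_α` of the complexified Lie algebra generated by the root vectors for `±α`. -/
def mAlg (α : H.hDual) : LieSubalgebra ℂ R.g :=
  LieSubalgebra.lieSpan ℂ R.g ((H.rootSpace α : Set R.g) ∪ (H.rootSpace (-α) : Set R.g))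

/-- The analytic subgroup `M_α` of `G` with Lie algebra `𝔪_α ∩ 𝔤₀`. -/
def mGroup (α : H.hDual) : Subgroup G :=
  Subgroup.closure {x | ∃ X : R.g₀, toComplexification X ∈ H.mAlg α ∧ IsExp R.ρ X x}

end Cartan

/-- `G` is simply laced: all roots in each simple factor have the same length.  (This does not
depend on the Cartan subalgebra.) -/
def SimplyLaced (R : RealReductiveLinear G n) : Prop :=
  ∀ H : R.Cartan, ∀ α ∈ H.roots, ∀ β ∈ H.roots, H.SameFactor α β → H.lengthSq α = H.lengthSq β

end RealReductiveLinear

/-- A two-fold cover `Gt` of `G`: a central extension of `G` by the group `{1, neg}` of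
order two. -/
structure TwoFoldCover (G Gt : Type*) [Group G] [TopologicalSpace G] [Group Gt]
    [TopologicalSpace Gt] where
  p : Gt →* G
  continuous_p : Continuous p
  isOpenMap_p : IsOpenMap p
  surjective_p : Function.Surjective p
  /-- the nontrivial element of the kernel, denoted `-1` -/
  neg : Gt
  neg_ne_one : neg ≠ 1
  neg_central : ∀ x, neg * x = x * neg
  ker_p : ∀ x, p x = 1 ↔ x = 1 ∨ x = neg

variable {Gt : Type*} [Group Gt] [TopologicalSpace Gt] [IsTopologicalGroup Gt] [T2Space Gt]

namespace TwoFoldCover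

variable (R : RealReductiveLinear G n) (C : TwoFoldCover G Gt)

/-- The covering group acting on `ℝⁿ` through `G`; this identifies its Lie algebra with that
of `G`. -/
def toGL : Gt →* GL (Fin n) ℝ := R.ρ.comp C.p

variable {R} (H : R.Cartan)

/-- The real or noncompact imaginary root `α` is metaplectic: the inverse image of `M_α` in the
covering group is nonlinear. -/
def IsMetaplectic (α : H.hDual) : Prop :=
  (α ∈ H.realRoots ∨ α ∈ H.noncompactRoots) ∧ IsNonlinearGroup ((H.mGroup α).comap C.p)

variable (R) in
/-- The cover is admissible: for every `θ`-stable Cartan subgroup, every long real or long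
noncompact imaginary root is metaplectic. -/
def Admissible : Prop :=
  ∀ H : R.Cartan, ∀ α ∈ H.longRoots, (α ∈ H.realRoots ∨ α ∈ H.noncompactRoots) →
    C.IsMetaplectic H α

/-- The Cartan subgroup of the covering group: the inverse image of that of `G`. -/
def cartan : Subgroup Gt := H.group.comap C.p

/-- The Cartan subgroup of the covering group acting on `ℝⁿ`. -/
def cartanToGL : C.cartan H →* GL (Fin n) ℝ := (C.toGL R).comp (C.cartan H).subtype

/-- `x` is the exponential, in the covering group, of the element `Z` of the complexified Cartan
subalgebra; in particular `Z` is real. -/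
def IsExpH (Z : H.h) (x : Gt) : Prop :=
  ∃ X : H.h₀, H.ofReal X = Z ∧ IsExp (C.toGL R) (X : R.g₀) x

open Classical in
/-- `m(α)` is 2 for metaplectic roots and 1 for all others. -/
def mult (α : H.hDual) : ℂ := if C.IsMetaplectic H α then 2 else 1

/-- The half-integral roots `Δ_{1/2}(μ)`. -/
def halfIntegralRoots (μ : H.hDual) : Set H.hDual :=
  {α ∈ H.roots | ∃ k : ℤ, μ (C.mult H α • H.coroot α) = k}

/-- `m` is an element `m_α = exp(π Z_α)` of the covering group for the real root `α`: here
`Z_α = E + θ E` with `E` a real root vector for `α` such that `[E, -θ E] = α^∨`, that is, `Z_α` is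
the image of the matrix with rows `(0, 1)` and `(-1, 0)` under the embedding of `𝔰𝔩(2, ℝ)`
corresponding to `α`.  (It is unique up to inverse.) -/
def IsMElement (α : H.hDual) (m : Gt) : Prop :=
  ∃ E : R.g₀, toComplexification E ∈ H.rootSpace α ∧
    toComplexification ⁅E, -R.θ E⁆ = H.incl (H.coroot α) ∧
    IsExp (C.toGL R) (Real.pi • (E + R.θ E) : R.g₀) m

end TwoFoldCover

namespace RealReductiveLinear.Cartan

variable {R : RealReductiveLinear G n} (H : R.Cartan)

/-- The integral roots `Δ(μ)`. -/
def integralRoots (μ : H.hDual) : Set H.hDual := {α ∈ H.roots | ∃ k : ℤ, H.pairing μ α = k}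

/-- Half the sum of the imaginary roots that are positive on `μ`. -/
def rhoImag (μ : H.hDual) : H.hDual :=
  (1 / 2 : ℂ) • ∑ᶠ (α) (_ : α ∈ H.imagRoots ∧ 0 < (H.pairing μ α).re), α

/-- Half the sum of the compact imaginary roots that are positive on `μ`. -/
def rhoCompact (μ : H.hDual) : H.hDual :=
  (1 / 2 : ℂ) • ∑ᶠ (α) (_ : α ∈ H.compactRoots ∧ 0 < (H.pairing μ α).re), α

/-- The sign `ε_α` in the parity condition for the real root `α`: the product of the values
`β(m_α) = (-1)^⟨β, α^∨⟩`, where `β` runs over representatives of the four-element sets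
`{±β, ±θβ}` of complex roots. -/
def paritySign (α : H.hDual) : ℤˣ :=
  (-1) ^ ({β ∈ H.complexRoots | ∃ k : ℤ, Odd k ∧ H.pairing β α = k}.ncard / 4)

end RealReductiveLinear.Cartan

/-- A regular character `(H, Γ, λ)` of the covering group, for a given Cartan subgroup `H`. -/
structure RegularCharacter {R : RealReductiveLinear G n} (C : TwoFoldCover G Gt) (H : R.Cartan)
    where
  /-- the dimension of `Γ` -/
  dim : ℕ
  /-- an irreducible representation of the Cartan subgroup of the covering group -/
  Γ : Representation ℂ (C.cartan H) (Fin dim → ℂ)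
  Γ_continuous : ∀ v, Continuous fun x => Γ x v
  Γ_irreducible : Γ.IsIrreducible
  /-- the parameter `λ` -/
  lam : H.hDual
  lam_real : ∀ α ∈ H.imagRoots, (H.pairing lam α).im = 0
  lam_regular : ∀ α ∈ H.roots, H.pairing lam α ≠ 0
  /-- `dΓ = λ + ρ_i(λ) - 2ρ_{i,c}(λ)` -/
  dΓ : ∀ (X : H.h₀) (φ : ℝ → C.cartan H), IsOneParam (C.cartanToGL H) (X : R.g₀) φ → ∀ v,
    HasDerivAt (fun t => Γ (φ t) v)
      ((lam + H.rhoImag lam - (2 : ℂ) • H.rhoCompact lam) (H.ofReal X) • v) 0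

namespace RegularCharacter

variable {R : RealReductiveLinear G n} {C : TwoFoldCover G Gt} {H : R.Cartan}
  (γ : RegularCharacter C H)

/-- `γ` is genuine: `Γ` does not factor through the projection to `G`. -/
def Genuine : Prop := ∃ z : C.cartan H, C.p z = 1 ∧ γ.Γ z ≠ 1

/-- The real root `α` satisfies the parity condition, with the sign `ε`: the eigenvalues of
`Γ(m_α)` are of the form `-ε exp(±πi⟨λ, α^∨⟩)`. -/
def SatisfiesParity (ε : ℤˣ) (α : H.hDual) : Prop :=
  ∃ m : C.cartan H, C.IsMElement H α m ∧ ∀ c : ℂ, Module.End.HasEigenvalue (γ.Γ m) c →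
    c = -((ε : ℤ) : ℂ) * Complex.exp (Real.pi * Complex.I * H.pairing γ.lam α) ∨
    c = -((ε : ℤ) : ℂ) * Complex.exp (-(Real.pi * Complex.I * H.pairing γ.lam α))

/-- The half-integral real roots not satisfying the parity condition, for signs `ε`. -/
def realPlus (ε : H.hDual → ℤˣ) : Set H.hDual :=
  {α ∈ H.realRoots ∩ C.halfIntegralRoots H γ.lam | ¬ γ.SatisfiesParity (ε α) α}

/-- The half-integral compact imaginary roots. -/
def imagPlus : Set H.hDual :=
  {α ∈ H.imagRoots ∩ C.halfIntegralRoots H γ.lam | α ∈ H.compactRoots}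

end RegularCharacter

end

/-! Everything rests on the values of `exp(2πi α^∨)` and its relatives in the cover. In a linear
group `exp(2πi α^∨) = 1`, because the coroot is the semisimple member of an 𝔰𝔩₂-triple of matrices
(`Matrix.exp_two_pi_I_smul_eq_one`). The corresponding exponential upstairs is therefore 1 or -1,
and the task is to find the sign.

A compact imaginary root spans a copy of 𝔰𝔲(2), whose group is simply connected, so the sign is +
(`expT_eq_one_of_su2`). A real or noncompact imaginary root gives a real triple with elliptic
element `e - f`, and all such roots are metaplectic, since in the simply laced case every root is
long. Suppose `exp(2π(e - f)) = 1`. Then the fourth power of the Weyl element `w` is 1, and the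
Bruhat decomposition shows that an element of the group generated by the two root subgroups is
determined by the element of SL(2, ℝ) with the same coordinates. If that group contains -1, it
embeds in SL(2, ℝ). If not, the sign relative to it is a continuous character, and adding this
character to the given representation of `G` separates 1 from -1. In both cases the preimage of
`M_α` is linear, a contradiction. So the sign is -, and in particular `m_α² = -1` for real roots
(`expT_two_pi_eq_neg_of_isMetaplectic`).

For a complex root, positivity of the hermitian form leaves `⟨α, θα^∨⟩ ∈ {0, 1, -1}`. For 0, simple
lacing excludes the root `α - θα`, so the triples of `α` and `θα` add up to a triple of 𝔰𝔲(2) type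
and the value is 1. For -1, the sum `α + θα` is a noncompact imaginary root with coroot `α^∨ +
θα^∨`. For 1, `β = α - θα` is real and `α^∨ + θα^∨ = 2θα^∨ + β^∨`, so the exponential is the square
of `±m_β`, which is -1.

For a genuine regular character, -1 acts by the scalar -1 by Schur's lemma. The shift `ρ_i -
2ρ_{i,c}` takes integral values on imaginary coroots, so `exp(2πi α^∨)` acts by `exp(2πi⟨λ, α^∨⟩)`;
hence compact means integral, and noncompact means half-integral but not integral. For a real root,
`Γ(m_α)` has square -1, so its eigenvalues are `±i`. The candidates `-ε exp(±πi⟨λ, α^∨⟩)` are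
exactly `±i` when `⟨λ, α^∨⟩` lies in `1/2 + ℤ`, and are `±1` when it is an integer, whatever the
sign `ε`. -/

set_option linter.unusedSectionVars false

/-! ### Adjoint action of one-parameter groups in an 𝔰𝔩₂-triple. -/

section ExpConj

open NormedSpace

variable {A : Type*} [NormedRing A] [NormedAlgebra ℝ A] [CompleteSpace A]

theorem exp_neg_smul_mul_exp_smul (X : A) (t : ℝ) : exp ((-t) • X) * exp (t • X) = 1 := by
  let _ : NormedAlgebra ℚ A := NormedAlgebra.restrictScalars ℚ ℝ A
  rw [← exp_add_of_commute (((Commute.refl X).smul_left _).smul_right _), ← add_smul]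
  simp

theorem exp_smul_mul_exp_neg_smul (X : A) (t : ℝ) : exp (t • X) * exp ((-t) • X) = 1 := by
  simpa using exp_neg_smul_mul_exp_smul X (-t)

/-- A curve solving `Y' = [X, Y]` is `t ↦ exp (t X) Y(0) exp (-t X)`. -/
theorem exp_smul_mul_eq_of_hasDerivAt {X : A} {Y : ℝ → A}
    (hY : ∀ t, HasDerivAt Y (X * Y t - Y t * X) t) (t : ℝ) :
    exp (t • X) * Y 0 = Y t * exp (t • X) := by
  have hd (t : ℝ) : HasDerivAt (fun s : ℝ => exp ((-s) • X) * Y s * exp (s • X)) 0 t := by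
    have h1 : HasDerivAt (fun s : ℝ => exp ((-s) • X)) (-(exp ((-t) • X) * X)) t := by
      simpa [Function.comp_def] using
        (hasDerivAt_exp_smul_const (𝕂 := ℝ) X (-t)).scomp t (hasDerivAt_neg t)
    have h2 := hasDerivAt_exp_smul_const' (𝕂 := ℝ) X t
    refine ((h1.mul (hY t)).mul h2).congr_deriv ?_
    simp only [Pi.mul_apply]
    noncomm_ring
  have hc := is_const_of_deriv_eq_zero (fun s => (hd s).differentiableAt) (fun s => (hd s).deriv) t 0
  simp only [neg_zero, zero_smul, exp_zero, one_mul, mul_one] at hc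
  rw [← hc, ← mul_assoc, ← mul_assoc, exp_smul_mul_exp_neg_smul, one_mul]

/-- Uniqueness for a linear equation. It is kept local in time because Gauss coordinates exist only
on a short interval. -/
theorem eq_exp_smul_of_hasDerivAt {X : A} {Y : ℝ → A} {T : ℝ}
    (hY : ∀ t ∈ Set.Icc 0 T, HasDerivAt Y (X * Y t) t) (h0 : Y 0 = 1) {t : ℝ}
    (ht : t ∈ Set.Icc 0 T) : Y t = exp (t • X) := by
  have hd : ∀ t ∈ Set.Icc 0 T, HasDerivAt (fun s : ℝ => exp ((-s) • X) * Y s) 0 t := by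
    intro t ht
    have h1 : HasDerivAt (fun s : ℝ => exp ((-s) • X)) (-(exp ((-t) • X) * X)) t := by
      simpa [Function.comp_def] using
        (hasDerivAt_exp_smul_const (𝕂 := ℝ) X (-t)).scomp t (hasDerivAt_neg t)
    refine (h1.mul (hY t ht)).congr_deriv ?_
    noncomm_ring
  have hc := constant_of_has_deriv_right_zero
    (fun s hs => (hd s hs).continuousAt.continuousWithinAt)
    (fun s hs => (hd s (Set.Ico_subset_Icc_self hs)).hasDerivWithinAt) t ht
  simp only [neg_zero, zero_smul, exp_zero, one_mul, h0] at hc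
  have := congrArg (exp (t • X) * ·) hc
  simpa only [← mul_assoc, exp_smul_mul_exp_neg_smul, one_mul, mul_one] using this

variable {h e f : A}

/-- The polynomial curve solves `Y' = [e, Y]`, since `ad e` is nilpotent on the triple. This and the
following formulas are commutation rules, which avoids inverses. -/
theorem exp_smul_e_mul_h (he : h * e - e * h = 2 • e) (t : ℝ) :
    exp (t • e) * h = (h - (2 * t) • e) * exp (t • e) := by
  have := exp_smul_mul_eq_of_hasDerivAt (X := e) (Y := fun t => h - (2 * t) • e) (fun t => ?_) t
  · simpa using this
  · have h1 : HasDerivAt (fun t : ℝ => h - (2 * t) • e) (-((2 * 1 : ℝ) • e)) t :=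
      (((hasDerivAt_id t).const_mul 2).smul_const e).const_sub h
    convert h1 using 1
    simp only [mul_sub, sub_mul, mul_smul_comm, smul_mul_assoc]
    rw [sub_sub_sub_cancel_right, ← neg_sub, he]
    norm_num [two_smul, two_nsmul]

theorem exp_smul_f_mul_h (hf : h * f - f * h = -(2 • f)) (t : ℝ) :
    exp (t • f) * h = (h + (2 * t) • f) * exp (t • f) := by
  -- The symmetry of the triple: `(-h, f, e)` is again one.
  have := exp_smul_e_mul_h (h := -h) (e := f) (by rw [← neg_inj, ← hf]; noncomm_ring) t
  rw [mul_neg, neg_eq_iff_eq_neg, ← neg_mul] at this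
  rw [this]
  congr 1
  abel

theorem exp_smul_f_mul_e (hef : e * f - f * e = h) (hf : h * f - f * h = -(2 • f)) (t : ℝ) :
    exp (t • f) * e = (e - t • h - t ^ 2 • f) * exp (t • f) := by
  have := exp_smul_mul_eq_of_hasDerivAt (X := f) (Y := fun t => e - t • h - t ^ 2 • f)
    (fun t => ?_) t
  · simpa using this
  · have h1 : HasDerivAt (fun t : ℝ => e - t • h - t ^ 2 • f)
        (-((1 : ℝ) • h) - ((2 : ℕ) * t ^ (2 - 1) * 1 : ℝ) • f) t :=
      (((hasDerivAt_id t).smul_const h).const_sub e).sub (((hasDerivAt_id t).pow 2).smul_const f)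
    convert h1 using 1
    simp only [mul_sub, sub_mul, mul_smul_comm, smul_mul_assoc]
    have h2 : f * e - e * f = -h := by rw [← hef]; abel
    have h3 : f * h - h * f = 2 • f := by rw [← neg_sub, hf, neg_neg]
    calc _ = (f * e - e * f) - t • (f * h - h * f) := by rw [smul_sub]; abel
      _ = _ := by
        rw [h2, h3, ← Nat.cast_smul_eq_nsmul ℝ, smul_smul]
        norm_num
        rw [mul_comm]

theorem exp_smul_e_mul_f (hef : e * f - f * e = h) (he : h * e - e * h = 2 • e) (t : ℝ) :
    exp (t • e) * f = (f + t • h - t ^ 2 • e) * exp (t • e) := by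
  have := exp_smul_f_mul_e (h := -h) (e := f) (f := e) (by rw [← hef]; abel)
    (by rw [← he]; noncomm_ring) t
  rw [this]
  simp

theorem exp_smul_h_mul_e (he : h * e - e * h = 2 • e) (t : ℝ) :
    exp (t • h) * e = (Real.exp (2 * t) • e) * exp (t • h) := by
  have := exp_smul_mul_eq_of_hasDerivAt (X := h) (Y := fun t => Real.exp (2 * t) • e)
    (fun t => ?_) t
  · simpa using this
  · have h1 : HasDerivAt (fun t : ℝ => Real.exp (2 * t) • e) ((Real.exp (2 * t) * (2 * 1)) • e) t :=
      (((hasDerivAt_id t).const_mul 2).exp).smul_const e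
    convert h1 using 1
    rw [mul_smul_comm, smul_mul_assoc, ← smul_sub, he, mul_smul, ← Nat.cast_smul_eq_nsmul ℝ]
    norm_num

theorem exp_smul_h_mul_f (hf : h * f - f * h = -(2 • f)) (t : ℝ) :
    exp (t • h) * f = (Real.exp (-(2 * t)) • f) * exp (t • h) := by
  have := exp_smul_h_mul_e (h := -h) (e := f) (by rw [← neg_inj, ← hf]; noncomm_ring) (-t)
  simpa using this

/-- The Weyl group element `exp e exp (-f) exp e` maps `h` to `-h`. -/
theorem exp_mul_exp_mul_exp_mul_h (hef : e * f - f * e = h) (he : h * e - e * h = 2 • e)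
    (hf : h * f - f * h = -(2 • f)) :
    exp e * exp (-f) * exp e * h = -h * (exp e * exp (-f) * exp e) := by
  have h1 := exp_smul_e_mul_h he 1
  have h2 := exp_smul_f_mul_h hf (-1)
  have h3 := exp_smul_f_mul_e hef hf (-1)
  simp only [one_smul, mul_one, mul_neg, neg_smul, sub_neg_eq_add, even_two, Even.neg_pow,
    one_pow] at h1 h2 h3
  rw [mul_assoc, mul_assoc, h1, ← mul_assoc _ _ (exp e), mul_sub, h2, mul_smul_comm, h3,
    ← smul_mul_assoc, ← sub_mul, ← mul_assoc, ← mul_assoc]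
  have h4 : h + -((2 : ℝ) • f) - (2 : ℝ) • (e + h - f) = -h - (2 : ℝ) • e := by
    simp only [two_smul]; abel
  rw [h4, mul_sub, mul_neg, h1, mul_smul_comm, ← ((Commute.refl e).exp_right).eq]
  simp only [two_smul]
  noncomm_ring

end ExpConj

/-! ### Gauss coordinates for exponentials. -/

section GaussCell

open NormedSpace

/-- The equations for `exp (t (x₁ h + x₂ e + x₃ f)) = exp (u f) exp (v h) exp (z e)` in coordinates. -/
structure IsGaussCurve (x₁ x₂ x₃ T : ℝ) (u v z : ℝ → ℝ) : Prop where
  u_zero : u 0 = 0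
  v_zero : v 0 = 0
  z_zero : z 0 = 0
  hasDerivAt : ∀ t ∈ Set.Icc 0 T, ∃ u' v' z' : ℝ, HasDerivAt u u' t ∧ HasDerivAt v v' t ∧
    HasDerivAt z z' t ∧ z' * Real.exp (2 * v t) = x₂ ∧ v' - u t * x₂ = x₁ ∧
    u' + 2 * u t * v' - u t ^ 2 * x₂ = x₃

variable {A : Type*} [NormedRing A] [NormedAlgebra ℝ A] [CompleteSpace A] {h e f : A}

/-- The logarithmic derivative of the product is `u' f + v' (h + 2u f) + z' e^{2v} (e - u h - u²
f)`. Its coefficients at `e`, `h`, `f` are the three equations of a Gauss curve. -/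
theorem IsGaussCurve.exp_eq {x₁ x₂ x₃ T : ℝ} {u v z : ℝ → ℝ} (H : IsGaussCurve x₁ x₂ x₃ T u v z)
    (hef : e * f - f * e = h) (he : h * e - e * h = 2 • e)
    (hf : h * f - f * h = -(2 • f)) {t : ℝ} (ht : t ∈ Set.Icc 0 T) :
    exp (u t • f) * exp (v t • h) * exp (z t • e) = exp (t • (x₁ • h + x₂ • e + x₃ • f)) := by
  refine eq_exp_smul_of_hasDerivAt (Y := fun t => exp (u t • f) * exp (v t • h) * exp (z t • e))
    (fun t ht => ?_) ?_ ht
  · obtain ⟨u', v', z', hu, hv, hz, h2, h1, h3⟩ := H.hasDerivAt t ht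
    have du := (hasDerivAt_exp_smul_const' (𝕂 := ℝ) f (u t)).scomp t hu
    have dv := (hasDerivAt_exp_smul_const' (𝕂 := ℝ) h (v t)).scomp t hv
    have dz := (hasDerivAt_exp_smul_const' (𝕂 := ℝ) e (z t)).scomp t hz
    refine ((du.mul dv).mul dz).congr_deriv ?_
    have c1 := exp_smul_f_mul_h hf (u t)
    have c2 := exp_smul_h_mul_e he (v t)
    have c3 := exp_smul_f_mul_e hef hf (u t)
    simp only [Pi.mul_apply, Function.comp_apply]
    set P := exp (u t • f)
    set Q := exp (v t • h)
    set S := exp (z t • e)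
    have e1 : P * (v' • (h * Q)) = v' • ((h + (2 * u t) • f) * (P * Q)) := by
      rw [mul_smul_comm, ← mul_assoc, c1, mul_assoc]
    have e2 : P * Q * (z' • (e * S)) = x₂ • ((e - u t • h - u t ^ 2 • f) * (P * Q * S)) := by
      rw [mul_smul_comm, ← mul_assoc, mul_assoc P, c2, smul_mul_assoc, mul_smul_comm,
        smul_mul_assoc, smul_smul, h2, ← mul_assoc P, c3]
      simp only [mul_assoc]
    rw [e1, e2, ← h3, ← h1]
    simp only [smul_mul_assoc, add_mul, sub_mul, smul_add, smul_sub, mul_assoc]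
    module
  · simp [H.u_zero, H.v_zero, H.z_zero]

/-- These are the lower, diagonal and upper factors of the rotation matrix, available as long as the
cosine is positive. -/
theorem isGaussCurve_rotation :
    IsGaussCurve 0 1 (-1) (Real.pi / 4) (fun t => -Real.tan t) (fun t => Real.log (Real.cos t))
      Real.tan where
  u_zero := by simp
  v_zero := by simp
  z_zero := by simp
  hasDerivAt t ht := by
    have hc : 0 < Real.cos t := Real.cos_pos_of_mem_Ioo
      ⟨by linarith [ht.1, Real.pi_pos], by linarith [ht.2, Real.pi_pos]⟩
    have hc2 : Real.cos t ^ 2 ≠ 0 := by positivity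
    refine ⟨_, _, _, (Real.hasDerivAt_tan hc.ne').neg, (Real.hasDerivAt_cos t).log hc.ne',
      Real.hasDerivAt_tan hc.ne', ?_, ?_, ?_⟩
    · rw [mul_comm, mul_comm 2, Real.exp_mul, Real.exp_log hc]
      norm_num
      exact mul_inv_cancel₀ hc2
    · rw [Real.tan_eq_sin_div_cos]; ring
    · rw [Real.tan_eq_sin_div_cos]
      field_simp
      linarith [Real.sin_sq_add_cos_sq t]

/-- The coordinates are read off from the exponential of a 2 × 2 matrix with entries `a, b, c, d`:
`u = c/a`, `v = log a`, `z = b/a`, as long as `a > 0`. The equations do not mention the ambient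
algebra, so this one curve serves every triple. -/
theorem exists_isGaussCurve (x₁ x₂ x₃ : ℝ) : ∃ T > 0, ∃ u v z, IsGaussCurve x₁ x₂ x₃ T u v z := by
  let _ : NormedRing (Matrix (Fin 2) (Fin 2) ℝ) := Matrix.linftyOpNormedRing
  let _ : NormedAlgebra ℝ (Matrix (Fin 2) (Fin 2) ℝ) := Matrix.linftyOpNormedAlgebra
  let X : Matrix (Fin 2) (Fin 2) ℝ := !![x₁, x₂; x₃, -x₁]
  let M : ℝ → Matrix (Fin 2) (Fin 2) ℝ := fun t => exp (t • X)
  have hM (t : ℝ) : HasDerivAt M (X * M t) t := hasDerivAt_exp_smul_const' (𝕂 := ℝ) X t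
  have hE (i j : Fin 2) (t : ℝ) : HasDerivAt (fun t => M t i j) ((X * M t) i j) t := by
    exact (Matrix.entryLinearMap ℝ ℝ i j :
      Matrix (Fin 2) (Fin 2) ℝ →ₗ[ℝ] ℝ).toContinuousLinearMap.hasFDerivAt.comp_hasDerivAt t (hM t)
  have ha (t) : HasDerivAt (fun t => M t 0 0) (x₁ * M t 0 0 + x₂ * M t 1 0) t := by
    simpa [X, Matrix.mul_apply, Fin.sum_univ_two] using hE 0 0 t
  have hb (t) : HasDerivAt (fun t => M t 0 1) (x₁ * M t 0 1 + x₂ * M t 1 1) t := by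
    simpa [X, Matrix.mul_apply, Fin.sum_univ_two] using hE 0 1 t
  have hc (t) : HasDerivAt (fun t => M t 1 0) (x₃ * M t 0 0 + -x₁ * M t 1 0) t := by
    simpa [X, Matrix.mul_apply, Fin.sum_univ_two] using hE 1 0 t
  have hd (t) : HasDerivAt (fun t => M t 1 1) (x₃ * M t 0 1 + -x₁ * M t 1 1) t := by
    simpa [X, Matrix.mul_apply, Fin.sum_univ_two] using hE 1 1 t
  have hM0 : M 0 = 1 := by simp [M]
  -- The determinant is constant because `X` has trace zero.
  have hdet (t) : M t 0 0 * M t 1 1 - M t 0 1 * M t 1 0 = 1 := by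
    have hdd (t) : HasDerivAt (fun t => M t 0 0 * M t 1 1 - M t 0 1 * M t 1 0) 0 t := by
      refine (((ha t).mul (hd t)).sub ((hb t).mul (hc t))).congr_deriv ?_
      ring
    have := is_const_of_deriv_eq_zero (fun s => (hdd s).differentiableAt)
      (fun s => (hdd s).deriv) t 0
    simpa [hM0] using this
  have hpos : ∀ᶠ t in nhds (0 : ℝ), 0 < M t 0 0 := by
    refine (ha 0).continuousAt.eventually (lt_mem_nhds ?_)
    simp [hM0]
  obtain ⟨ε, hε, hball⟩ := Metric.eventually_nhds_iff.1 hpos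
  refine ⟨ε / 2, by positivity, fun t => M t 1 0 / M t 0 0, fun t => Real.log (M t 0 0),
    fun t => M t 0 1 / M t 0 0, ⟨by simp [hM0], by simp [hM0], by simp [hM0], fun t ht => ?_⟩⟩
  have hp : 0 < M t 0 0 := hball (by
    rw [Real.dist_eq, sub_zero, abs_of_nonneg ht.1]; linarith [ht.2])
  refine ⟨_, _, _, (hc t).div (ha t) hp.ne', (ha t).log hp.ne', (hb t).div (ha t) hp.ne', ?_, ?_, ?_⟩
  · rw [mul_comm 2, Real.exp_mul, Real.exp_log hp]
    norm_num
    field_simp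
    linear_combination x₂ * hdet t
  · field_simp
    ring
  · field_simp
    ring

end GaussCell

/-! ### Finite-dimensional representations of 𝔰𝔩₂. -/

section Weights

variable {L M : Type*} [LieRing L] [LieAlgebra ℂ L] [AddCommGroup M] [Module ℂ M]
  [LieRingModule L M] [LieModule ℂ L M] [FiniteDimensional ℂ M] {h e f : L}

open LieModule

/-- Repeated raising would otherwise produce infinitely many eigenvalues of `h`. -/
theorem IsSl2Triple.exists_isPrimitive (t : IsSl2Triple h e f) {m : M} {μ : ℂ}
    (hm : ⁅h, m⁆ = μ • m) (h0 : m ≠ 0) :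
    ∃ k : ℕ, HasPrimitiveVectorWith t ((toEnd ℂ L M e ^ k) m) (μ + 2 * k) := by
  have hex : ∃ k, (toEnd ℂ L M e ^ k) m = 0 := by
    by_contra! hne
    have hsub : Set.range (fun k : ℕ => μ + 2 * k) ⊆ {ν | (toEnd ℂ L M h).HasEigenvalue ν} := by
      rintro _ ⟨k, rfl⟩
      exact Module.End.hasEigenvalue_of_hasEigenvector
        (Module.End.hasEigenvector_iff.2
          ⟨Module.End.mem_eigenspace_iff.2 (t.lie_h_pow_toEnd_e hm k), hne k⟩)
    exact Set.infinite_range_of_injective (fun a b hab => by simpa using hab)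
      ((toEnd ℂ L M h).finite_hasEigenvalue.subset hsub)
  obtain ⟨k, h1, h2⟩ := Nat.exists_not_and_succ_of_not_zero_of_exists
    (p := fun k => (toEnd ℂ L M e ^ k) m = 0) (by simpa using h0) hex
  refine ⟨k, h1, t.lie_h_pow_toEnd_e hm k, ?_⟩
  rw [pow_succ'] at h2
  exact h2

/-- The weights of a finite-dimensional representation of `𝔰𝔩₂` are integers. -/
theorem IsSl2Triple.exists_int (t : IsSl2Triple h e f) {m : M} {μ : ℂ}
    (hm : ⁅h, m⁆ = μ • m) (h0 : m ≠ 0) : ∃ k : ℤ, μ = k := by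
  obtain ⟨k, hk⟩ := t.exists_isPrimitive hm h0
  obtain ⟨N, hN⟩ := hk.exists_nat
  exact ⟨N - 2 * k, by push_cast; rw [← hN]; ring⟩

/-- A vector of negative weight is not annihilated by `e`. -/
theorem IsSl2Triple.lie_e_ne_zero (t : IsSl2Triple h e f) {m : M} {k : ℤ}
    (hm : ⁅h, m⁆ = (k : ℂ) • m) (h0 : m ≠ 0) (hk : k < 0) : ⁅e, m⁆ ≠ 0 := by
  intro he
  obtain ⟨N, hN⟩ := (HasPrimitiveVectorWith.mk (t := t) h0 hm he).exists_nat
  have : k = N := by exact_mod_cast hN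
  omega

theorem IsSl2Triple.lie_f_ne_zero (t : IsSl2Triple h e f) {m : M} {k : ℤ}
    (hm : ⁅h, m⁆ = (k : ℂ) • m) (h0 : m ≠ 0) (hk : 0 < k) : ⁅f, m⁆ ≠ 0 :=
  t.symm.lie_e_ne_zero (k := -k) (by rw [neg_lie, hm]; push_cast; rw [neg_smul]) h0 (by omega)

/-- A vector of weight `k ≥ 0` can be raised and then lowered to a nonzero vector of weight `-k`. -/
theorem IsSl2Triple.exists_pow_f_pow_e_ne_zero (t : IsSl2Triple h e f) {m : M} {k : ℕ}
    (hm : ⁅h, m⁆ = (k : ℂ) • m) (h0 : m ≠ 0) :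
    ∃ j : ℕ, (toEnd ℂ L M f ^ (k + j)) ((toEnd ℂ L M e ^ j) m) ≠ 0 := by
  obtain ⟨j, hj⟩ := t.exists_isPrimitive hm h0
  refine ⟨j, ?_⟩
  -- The highest weight is `k + 2j`, and `e` undoes the `(i+1)`-st lowering up to the scalar
  -- `(i+1)(k + 2j - i)`, which is nonzero for `i < k + 2j`.
  have key : ∀ i ≤ k + 2 * j, (toEnd ℂ L M f ^ i) ((toEnd ℂ L M e ^ j) m) ≠ 0 := by
    intro i
    induction i with
    | zero => intro _; simpa using hj.ne_zero
    | succ i ih =>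
      intro hi h1
      have h2 := hj.lie_e_pow_succ_toEnd_f i
      rw [h1, lie_zero, eq_comm, smul_eq_zero_iff_left (ih (by omega)), mul_eq_zero, sub_eq_zero]
        at h2
      rcases h2 with h2 | h2
      · exact Nat.cast_add_one_ne_zero i h2
      · have : k + 2 * j = i := by exact_mod_cast h2
        omega
  exact key _ (by omega)

end Weights

/-! ### Exponentials of imaginary multiples of `h`. -/

section Sl2Exp

open NormedSpace

variable {A : Type*} [NormedRing A] [NormedAlgebra ℂ A] [CompleteSpace A] {h e f : A}

theorem exp_algebraMap_complex (μ : ℂ) : exp (algebraMap ℂ A μ) = algebraMap ℂ A (Complex.exp μ) := by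
  rw [Complex.exp_eq_exp_ℂ, algebraMap_exp_comm]

/-- The hypothesis says that `V` intertwines the scalar `μ` with `X`, and intertwining passes to
exponentials. -/
theorem exp_mul_of_mul_eq_smul {X V : A} {μ : ℂ} (hV : X * V = μ • V) :
    exp X * V = Complex.exp μ • V := by
  let _ : NormedAlgebra ℚ A := NormedAlgebra.restrictScalars ℚ ℂ A
  have h1 : SemiconjBy V (algebraMap ℂ A μ) X := by
    rw [SemiconjBy, Algebra.algebraMap_eq_smul_one, mul_smul_comm, mul_one, hV]
  have h2 := h1.exp_right
  rw [SemiconjBy, exp_algebraMap_complex, Algebra.algebraMap_eq_smul_one, mul_smul_comm,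
    mul_one] at h2
  exact h2.symm

/-- `V` intertwines `c h + c μ` with `c h`; exponentiating, the scalar `exp(c μ)` drops out. -/
theorem commute_exp_smul_of_exp_eq_one {c μ : ℂ} {V : A}
    (hV : h * V - V * h = μ • V) (hc : Complex.exp (c * μ) = 1) :
    Commute (exp (c • h)) V := by
  let _ : NormedAlgebra ℚ A := NormedAlgebra.restrictScalars ℚ ℂ A
  have h1 : SemiconjBy V (c • h + algebraMap ℂ A (c * μ)) (c • h) := by
    rw [SemiconjBy, Algebra.algebraMap_eq_smul_one, mul_add, mul_smul_comm, mul_smul_comm,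
      smul_mul_assoc, mul_one, mul_smul, ← smul_add, ← hV]
    congr 1
    abel
  have h2 := h1.exp_right
  rw [exp_add_of_commute (Algebra.commutes _ _).symm, exp_algebraMap_complex, hc, map_one,
    mul_one] at h2
  exact h2.eq.symm

theorem exp_mul_exp_neg_self (X : A) : exp (-X) * exp X = 1 := by
  let _ : NormedAlgebra ℚ A := NormedAlgebra.restrictScalars ℚ ℂ A
  rw [← exp_add_of_commute (Commute.refl X).neg_left]
  simp

/-- The square of `exp (2πi h)` is `1` for an `𝔰𝔩₂`-triple. -/
theorem exp_two_pi_I_smul_mul_self (hef : e * f - f * e = h) (he : h * e - e * h = 2 • e)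
    (hf : h * f - f * h = -(2 • f)) :
    exp ((2 * Real.pi * Complex.I : ℂ) • h) * exp ((2 * Real.pi * Complex.I : ℂ) • h) = 1 := by
  let _ : NormedAlgebra ℚ A := NormedAlgebra.restrictScalars ℚ ℂ A
  set U := exp ((2 * Real.pi * Complex.I : ℂ) • h) with hU
  have hUe : Commute U e := commute_exp_smul_of_exp_eq_one (μ := 2)
    (by rw [he, ← Nat.cast_smul_eq_nsmul ℂ]; norm_num)
    (by rw [mul_comm, Complex.exp_eq_one_iff]; exact ⟨2, by norm_num⟩)
  have hUf : Commute U f := commute_exp_smul_of_exp_eq_one (μ := -2)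
    (by rw [hf, ← Nat.cast_smul_eq_nsmul ℂ]; norm_num)
    (by rw [mul_comm, Complex.exp_eq_one_iff]; exact ⟨-2, by norm_num⟩)
  -- The Weyl element sends `h` to `-h`, hence `U` to its inverse; but it is built from `e` and `f`,
  -- which commute with `U`.
  set w := exp e * exp (-f) * exp e with hw
  have hUw : Commute U w := (hUe.exp_right.mul_right hUf.neg_right.exp_right).mul_right hUe.exp_right
  have hwh : SemiconjBy w h (-h) := exp_mul_exp_mul_exp_mul_h hef he hf
  have hwU : SemiconjBy w U (exp (-((2 * Real.pi * Complex.I : ℂ) • h))) := by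
    refine SemiconjBy.exp_right ?_
    rw [← smul_neg, SemiconjBy, mul_smul_comm, hwh.eq, smul_mul_assoc]
  have hwu : IsUnit w := ((isUnit_exp e).mul (isUnit_exp (-f))).mul (isUnit_exp e)
  have h1 : exp (-((2 * Real.pi * Complex.I : ℂ) • h)) = U :=
    hwu.mul_right_cancel (hwU.eq.symm.trans hUw.symm.eq)
  nth_rewrite 1 [← h1]
  exact exp_mul_exp_neg_self _

/-- For an `𝔰𝔩₂`-triple, `exp (πi h)` equals `exp (π (e - f))`. -/
theorem exp_pi_smul_e_sub_f (hef : e * f - f * e = h) (he : h * e - e * h = 2 • e)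
    (hf : h * f - f * h = -(2 • f)) :
    exp ((Real.pi * Complex.I : ℂ) • h) = exp ((Real.pi : ℂ) • (e - f)) := by
  let _ : NormedAlgebra ℚ A := NormedAlgebra.restrictScalars ℚ ℂ A
  set U := exp ((Real.pi * Complex.I : ℂ) • h) with hU
  have hUe : Commute U e := commute_exp_smul_of_exp_eq_one (μ := 2)
    (by rw [he, ← Nat.cast_smul_eq_nsmul ℂ]; norm_num)
    (by rw [mul_comm, Complex.exp_eq_one_iff]; exact ⟨1, by ring⟩)
  have hUf : Commute U f := commute_exp_smul_of_exp_eq_one (μ := -2)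
    (by rw [hf, ← Nat.cast_smul_eq_nsmul ℂ]; norm_num)
    (by rw [mul_comm, Complex.exp_eq_one_iff]; exact ⟨-1, by push_cast; ring⟩)
  -- A Cayley transform: `exp(π/4 · X)` conjugates `πi h` to `π (e - f)`, and it commutes with `U`
  -- because `e` and `f` do.
  set X : A := Complex.I • (e + f) with hX
  have key := exp_smul_mul_eq_of_hasDerivAt (X := X)
    (Y := fun t : ℝ => Real.cos (2 * t) • h - Real.sin (2 * t) • Complex.I • (e - f))
    (fun t => ?_) (Real.pi / 4)
  · set c := exp ((Real.pi / 4) • X)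
    have hUc : Commute U c := (((hUe.add_right hUf).smul_right _).smul_right _).exp_right
    have h2 : 2 * (Real.pi / 4) = Real.pi / 2 := by ring
    have h3 : SemiconjBy c ((Real.pi * Complex.I : ℂ) • h) ((Real.pi : ℂ) • (e - f)) := by
      simp only [mul_zero, Real.cos_zero, one_smul, Real.sin_zero, zero_smul, sub_zero, h2,
        Real.cos_pi_div_two, Real.sin_pi_div_two, zero_sub] at key
      rw [SemiconjBy, mul_smul_comm, key, ← smul_mul_assoc, mul_smul, smul_neg, smul_smul _ Complex.I,
        Complex.I_mul_I, neg_one_smul, neg_neg]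
    have h4 := h3.exp_right
    exact (isUnit_exp ((Real.pi / 4) • X)).mul_right_cancel (hUc.eq.trans h4.eq)
  · have dc : HasDerivAt (fun t : ℝ => Real.cos (2 * t)) (-Real.sin (2 * t) * (2 * 1)) t :=
      ((hasDerivAt_id t).const_mul 2).cos
    have ds : HasDerivAt (fun t : ℝ => Real.sin (2 * t)) (Real.cos (2 * t) * (2 * 1)) t :=
      ((hasDerivAt_id t).const_mul 2).sin
    refine ((dc.smul_const h).sub (ds.smul_const (Complex.I • (e - f)))).congr_deriv ?_
    have h1 : X * h - h * X = -(2 : ℝ) • Complex.I • (e - f) := by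
      have : X * h - h * X = Complex.I • (-(h * e - e * h) - (h * f - f * h)) := by
        simp only [hX, smul_mul_assoc, mul_smul_comm, ← smul_sub]
        congr 1
        noncomm_ring
      rw [this, he, hf, smul_comm]
      congr 1
      simp only [neg_smul, two_smul]
      abel
    have h2 : X * (Complex.I • (e - f)) - (Complex.I • (e - f)) * X = (2 : ℝ) • h := by
      have : X * (Complex.I • (e - f)) - (Complex.I • (e - f)) * X =
          (Complex.I * Complex.I) • (-(2 • (e * f - f * e))) := by
        simp only [hX, smul_mul_assoc, mul_smul_comm, ← smul_sub, smul_smul]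
        congr 1
        noncomm_ring
      rw [this, hef, Complex.I_mul_I, neg_one_smul, neg_neg]
      simp only [two_smul]
    generalize Complex.I • (e - f) = D at h1 h2 ⊢
    clear_value X
    have h3 (a b : ℝ) : X * (a • h - b • D) - (a • h - b • D) * X =
        a • (X * h - h * X) - b • (X * D - D * X) := by
      simp only [mul_sub, sub_mul, mul_smul_comm, smul_mul_assoc, smul_sub]
      abel
    rw [h3, h1, h2]
    module

end Sl2Exp

section MatrixSl2

attribute [local instance 100] LieRing.ofAssociativeRing

open NormedSpace

variable {n : ℕ} {h e f : Matrix (Fin n) (Fin n) ℂ}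

/-- `exp (2πi h) = 1` for an `𝔰𝔩₂`-triple of complex matrices. -/
theorem Matrix.exp_two_pi_I_smul_eq_one (hef : e * f - f * e = h) (he : h * e - e * h = 2 • e)
    (hf : h * f - f * h = -(2 • f)) : exp ((2 * Real.pi * Complex.I : ℂ) • h) = 1 := by
  set U := exp ((2 * Real.pi * Complex.I : ℂ) • h) with hU
  -- Integral eigenvalues of `h` alone do not give `U = 1`, since `h` is not known to be
  -- diagonalizable. An involution is, so it remains to exclude the eigenvalue -1 of `U`, using an
  -- eigenvector of `h` in that eigenspace.
  have hUU : U * U = 1 := by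
    let _ : NormedRing (Matrix (Fin n) (Fin n) ℂ) := Matrix.linftyOpNormedRing
    let _ : NormedAlgebra ℂ (Matrix (Fin n) (Fin n) ℂ) := Matrix.linftyOpNormedAlgebra
    exact exp_two_pi_I_smul_mul_self hef he hf
  have hUh : Commute U h := ((Commute.refl h).smul_left _).exp_left
  by_contra hne
  have h0 : h ≠ 0 := by
    rintro rfl
    exact hne (by rw [hU, smul_zero, exp_zero])
  let φ : Matrix (Fin n) (Fin n) ℂ ≃ₐ[ℂ] Module.End ℂ (Fin n → ℂ) := Matrix.toLinAlgEquiv'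
  have ht : IsSl2Triple (φ h) (φ e) (φ f) :=
    ⟨by simpa using h0, by rw [Ring.lie_def, ← map_mul, ← map_mul, ← map_sub, hef],
      by rw [Ring.lie_def, ← map_mul, ← map_mul, ← map_sub, he, map_nsmul],
      by rw [Ring.lie_def, ← map_mul, ← map_mul, ← map_sub, hf, map_neg, map_nsmul]⟩
  set W := (φ U).eigenspace (-1) with hWdef
  have hφUU (x : Fin n → ℂ) : φ U (φ U x) = x := by
    rw [← Module.End.mul_apply, ← map_mul, hUU, map_one, Module.End.one_apply]
  have hW : Nontrivial W := by
    rw [Submodule.nontrivial_iff_ne_bot]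
    intro hbot
    apply hne
    apply φ.injective
    refine LinearMap.ext fun x => ?_
    have hx : x - φ U x ∈ W := by
      rw [hWdef, Module.End.mem_eigenspace_iff, map_sub, hφUU, neg_one_smul, neg_sub]
    rw [hbot, Submodule.mem_bot, sub_eq_zero] at hx
    rw [← hx, map_one, Module.End.one_apply]
  have hmaps : ∀ x ∈ W, φ h x ∈ W := by
    intro x hx
    rw [hWdef, Module.End.mem_eigenspace_iff] at hx ⊢
    rw [← Module.End.mul_apply, ← map_mul, hUh.eq, map_mul, Module.End.mul_apply, hx, map_smul]
  obtain ⟨μ, hμ⟩ := Module.End.exists_eigenvalue ((φ h).restrict hmaps)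
  obtain ⟨v, hv⟩ := hμ.exists_hasEigenvector
  have hv0 : (v : Fin n → ℂ) ≠ 0 := fun h0 => hv.2 (Subtype.ext h0)
  have hvμ : φ h v = μ • (v : Fin n → ℂ) := congrArg Subtype.val hv.apply_eq_smul
  obtain ⟨k, rfl⟩ := ht.exists_int (M := Fin n → ℂ) hvμ hv0
  have hUv : φ U v = -(v : Fin n → ℂ) := by
    have := Module.End.mem_eigenspace_iff.1 v.2
    rwa [neg_one_smul] at this
  have hφ (A : Matrix (Fin n) (Fin n) ℂ) (x) : φ A x = A.mulVec x := rfl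
  rw [hφ] at hvμ hUv
  -- All columns of `vecMulVec v v` are multiples of `v`, which turns the eigenvector equation into
  -- one between matrices.
  have hV : ((2 * Real.pi * Complex.I : ℂ) • h) * Matrix.vecMulVec v v =
      (2 * Real.pi * Complex.I * k : ℂ) • Matrix.vecMulVec v v := by
    rw [smul_mul_assoc, Matrix.mul_vecMulVec, hvμ, Matrix.smul_vecMulVec, smul_smul]
  have hexp : U * Matrix.vecMulVec v v =
      Complex.exp (2 * Real.pi * Complex.I * k) • Matrix.vecMulVec v v := by
    let _ : NormedRing (Matrix (Fin n) (Fin n) ℂ) := Matrix.linftyOpNormedRing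
    let _ : NormedAlgebra ℂ (Matrix (Fin n) (Fin n) ℂ) := Matrix.linftyOpNormedAlgebra
    exact exp_mul_of_mul_eq_smul hV
  rw [mul_comm _ (k : ℂ), Complex.exp_int_mul_two_pi_mul_I, one_smul, Matrix.mul_vecMulVec, hUv] at hexp
  obtain ⟨i, hi⟩ := Function.ne_iff.1 hv0
  have := congrFun (congrFun hexp i) i
  simp only [Matrix.vecMulVec_apply, Pi.neg_apply] at this
  have h2 : (v : Fin n → ℂ) i * (v : Fin n → ℂ) i = 0 := by linear_combination (-1 / 2) * this
  exact hi (mul_self_eq_zero.1 h2)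

theorem Matrix.exp_pi_smul_e_sub_f (hef : e * f - f * e = h) (he : h * e - e * h = 2 • e)
    (hf : h * f - f * h = -(2 • f)) :
    exp ((Real.pi * Complex.I : ℂ) • h) = exp ((Real.pi : ℂ) • (e - f)) := by
  let _ : NormedRing (Matrix (Fin n) (Fin n) ℂ) := Matrix.linftyOpNormedRing
  let _ : NormedAlgebra ℂ (Matrix (Fin n) (Fin n) ℂ) := Matrix.linftyOpNormedAlgebra
  exact _root_.exp_pi_smul_e_sub_f hef he hf

end MatrixSl2

/-! ### Differentiating invariance and one-parameter groups of operators. -/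

section InvariantForm

variable {A : Type*} [NormedRing A] [NormedAlgebra ℝ A] [CompleteSpace A] [FiniteDimensional ℝ A]

/-- A bilinear form invariant under conjugation by a one-parameter group is infinitesimally
invariant. -/
theorem bilin_lie_add_eq_zero_of_exp_invariant (β : A →ₗ[ℝ] A →ₗ[ℝ] ℝ) {X Y Z : A}
    (h : ∀ t : ℝ, β (NormedSpace.exp (t • X) * Y * NormedSpace.exp (t • -X))
      (NormedSpace.exp (t • X) * Z * NormedSpace.exp (t • -X)) = β Y Z) :
    β (X * Y - Y * X) Z + β Y (X * Z - Z * X) = 0 := by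
  have hd (W : A) : HasDerivAt (fun t : ℝ => NormedSpace.exp (t • X) * W *
      NormedSpace.exp (t • -X)) (X * W - W * X) 0 := by
    refine (((hasDerivAt_exp_smul_const (𝕂 := ℝ) X 0).mul_const W).mul
      (hasDerivAt_exp_smul_const (𝕂 := ℝ) (-X) 0)).congr_deriv ?_
    simp [sub_eq_add_neg]
  have h1 := (LinearMap.toContinuousBilinearMap β).hasDerivAt_of_bilinear
    (fun _ => hd Y) (fun _ => hd Z)
  have h2 : (fun t : ℝ => LinearMap.toContinuousBilinearMap β
      (NormedSpace.exp (t • X) * Y * NormedSpace.exp (t • -X))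
      (NormedSpace.exp (t • X) * Z * NormedSpace.exp (t • -X))) = fun _ => β Y Z := funext h
  rw [h2] at h1
  have h3 := h1.unique (hasDerivAt_const 0 (β Y Z))
  simp only [zero_smul, NormedSpace.exp_zero, one_mul, mul_one] at h3
  rw [add_comm]
  exact h3

end InvariantForm

theorem eq_exp_mul_of_hasDerivAt {f : ℝ → ℂ} {μ : ℂ} (h : ∀ t, HasDerivAt f (μ * f t) t) (t : ℝ) :
    f t = Complex.exp (t * μ) * f 0 := by
  have h1 (t : ℝ) : HasDerivAt (fun t : ℝ => Complex.exp (t * -μ) * f t) 0 t := by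
    have h2 : HasDerivAt (fun t : ℝ => Complex.exp (t * -μ)) (Complex.exp (t * -μ) * (1 * -μ)) t :=
      (((hasDerivAt_id t).ofReal_comp).mul_const (-μ)).cexp
    refine (h2.mul (h t)).congr_deriv ?_
    ring
  have h3 := is_const_of_deriv_eq_zero (fun t => (h1 t).differentiableAt)
    (fun t => (h1 t).deriv) t 0
  simp only [Complex.ofReal_zero, zero_mul, Complex.exp_zero, one_mul] at h3
  rw [← h3, ← mul_assoc, ← Complex.exp_add]
  simp

/-- A one-parameter group of operators is determined by its derivative at zero. -/
theorem oneParam_apply_eq_exp_smul {d : ℕ} {Γ : ℝ → Module.End ℂ (Fin d → ℂ)} {μ : ℂ}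
    (h0 : Γ 0 = 1) (hadd : ∀ s t, Γ (s + t) = Γ s * Γ t)
    (h : ∀ v, HasDerivAt (fun t => Γ t v) (μ • v) 0) (t : ℝ) (v : Fin d → ℂ) :
    Γ t v = Complex.exp (t * μ) • v := by
  have h1 (t : ℝ) : HasDerivAt (fun t => Γ t v) (μ • Γ t v) t := by
    have h2 := h (Γ t v)
    rw [← sub_self t] at h2
    have h3 := HasDerivAt.comp_sub_const (f := fun s => Γ s (Γ t v)) t t h2
    refine h3.congr_of_eventuallyEq (Filter.Eventually.of_forall fun s => ?_)
    simp only
    rw [← Module.End.mul_apply, ← hadd, sub_add_cancel]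
  ext i
  have h4 := eq_exp_mul_of_hasDerivAt (f := fun t => Γ t v i) (μ := μ)
    (fun t => (hasDerivAt_pi.1 (h1 t)) i) t
  rw [h4, h0]
  rfl

open scoped TensorProduct

noncomputable section

attribute [local instance 100] LieRing.ofAssociativeRing

variable {G : Type*} [Group G] [TopologicalSpace G] [IsTopologicalGroup G] {n : ℕ}
variable {Gt : Type*} [Group Gt] [TopologicalSpace Gt] [IsTopologicalGroup Gt] [T2Space Gt]

/-! ### The exponential map of the cover and unique lifting. -/

section OneParam

variable {S : Type*} [Group S] [TopologicalSpace S] {π : S →* GL (Fin n) ℝ}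
  {X : Matrix (Fin n) (Fin n) ℝ} {φ : ℝ → S}

theorem IsOneParam.zero (h : IsOneParam π X φ) : φ 0 = 1 := by
  have := h.2.1 0 0
  simpa using this

theorem IsOneParam.neg (h : IsOneParam π X φ) (t : ℝ) : φ (-t) = (φ t)⁻¹ := by
  rw [eq_inv_iff_mul_eq_one, ← h.2.1, neg_add_cancel, h.zero]

theorem IsOneParam.comp_mul (h : IsOneParam π X φ) (c : ℝ) :
    IsOneParam π (c • X) (fun t => φ (t * c)) := by
  refine ⟨h.1.comp (by fun_prop), fun s t => by simp only [add_mul, h.2.1], fun t => ?_⟩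
  rw [h.2.2, smul_smul]

end OneParam

namespace TwoFoldCover

variable (R : RealReductiveLinear G n) (C : TwoFoldCover G Gt)

theorem neg_mul_neg : C.neg * C.neg = 1 := by
  have h : C.p (C.neg * C.neg) = 1 := by
    rw [map_mul, (C.ker_p C.neg).2 (Or.inr rfl), one_mul]
  rcases (C.ker_p _).1 h with h | h
  · exact h
  · exact absurd (mul_eq_left.1 h) C.neg_ne_one

theorem p_neg : C.p C.neg = 1 := (C.ker_p C.neg).2 (Or.inr rfl)

theorem toGL_neg : C.toGL R C.neg = 1 := by
  simp [toGL, C.p_neg]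

theorem toGL_eq_one_iff {x : Gt} : C.toGL R x = 1 ↔ x = 1 ∨ x = C.neg := by
  rw [← C.ker_p, toGL, MonoidHom.comp_apply, ← R.ρ.map_one, R.ρ_injective.eq_iff]

theorem continuous_toGL : Continuous (C.toGL R) := R.ρ_continuous.comp C.continuous_p

/-- Two lifts of a map on a preconnected set are equal if they agree at one point. -/
theorem eqOn_of_toGL_eq {T : Type*} [TopologicalSpace T] {s : Set T} (hs : IsPreconnected s)
    {f g : T → Gt} (hf : ContinuousOn f s) (hg : ContinuousOn g s)
    (h : ∀ t ∈ s, C.toGL R (f t) = C.toGL R (g t)) {t₀ : T} (ht₀ : t₀ ∈ s) (h₀ : f t₀ = g t₀) :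
    Set.EqOn f g s := by
  intro t ht
  -- The quotient of the two lifts takes values in the two-element kernel, so its connected image is
  -- a point.
  have hcont : ContinuousOn (fun t => (g t)⁻¹ * f t) s := hg.inv.mul hf
  have hfin : ((fun t => (g t)⁻¹ * f t) '' s).Finite := by
    refine Set.Finite.subset (Set.toFinite {1, C.neg}) ?_
    rintro _ ⟨t, ht, rfl⟩
    have : C.toGL R ((g t)⁻¹ * f t) = 1 := by rw [map_mul, map_inv, h t ht, inv_mul_cancel]
    simpa using (C.toGL_eq_one_iff R).1 this
  have hsub : ((fun t => (g t)⁻¹ * f t) '' s).Subsingleton := by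
    by_contra hn
    exact (hs.image _ hcont).infinite_of_nontrivial (Set.not_subsingleton_iff.1 hn) hfin
  have := hsub (Set.mem_image_of_mem _ ht) (Set.mem_image_of_mem _ ht₀)
  simp only [h₀, inv_mul_cancel] at this
  exact (inv_mul_eq_one.1 this).symm

theorem eq_of_toGL_eq {T : Type*} [TopologicalSpace T] [PreconnectedSpace T]
    {f g : T → Gt} (hf : Continuous f) (hg : Continuous g)
    (h : ∀ t, C.toGL R (f t) = C.toGL R (g t)) {t₀ : T} (h₀ : f t₀ = g t₀) (t : T) :
    f t = g t :=
  C.eqOn_of_toGL_eq R isPreconnected_univ hf.continuousOn hg.continuousOn (fun t _ => h t)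
    (Set.mem_univ t₀) h₀ (Set.mem_univ t)

theorem isCoveringMap_p : IsCoveringMap C.p := by
  have hq : Topology.IsQuotientMap C.p :=
    (C.isOpenMap_p.isQuotientMap C.continuous_p C.surjective_p)
  refine (hq.isQuotientCoveringMap_of_isDiscrete_ker_monoidHom ?_).isCoveringMap
  have : (C.p.ker : Set Gt).Finite := by
    refine Set.Finite.subset (Set.toFinite {1, C.neg}) fun x hx => ?_
    simpa using (C.ker_p x).1 hx
  exact this.isDiscrete

/-- One-parameter subgroups of `G` lift to the covering group. -/
theorem exists_isOneParam_lift {X : Matrix (Fin n) (Fin n) ℝ} {φ : ℝ → G}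
    (h : IsOneParam R.ρ X φ) : ∃ ψ : ℝ → Gt, IsOneParam (C.toGL R) X ψ := by
  obtain ⟨F, ⟨hF0, hF⟩, -⟩ := C.isCoveringMap_p.existsUnique_continuousMap_lifts
    (⟨φ, h.1⟩ : C(ℝ, G)) 0 1 (by simp [h.zero])
  have hp (t : ℝ) : C.p (F t) = φ t := congrFun hF t
  refine ⟨F, F.continuous, fun s t => ?_, fun t => ?_⟩
  -- Both sides of the addition law lift the same map on `ℝ × ℝ` and agree at the origin.
  · refine C.eq_of_toGL_eq R (T := ℝ × ℝ) (f := fun q => F (q.1 + q.2))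
      (g := fun q => F q.1 * F q.2) (by fun_prop) (by fun_prop) (fun q => ?_) (t₀ := (0, 0))
      (by simp [hF0]) (s, t)
    simp [toGL, hp, h.2.1]
  · rw [← h.2.2, ← hp]
    rfl

theorem exists_isOneParam (X : R.g₀) : ∃ ψ : ℝ → Gt, IsOneParam (C.toGL R) (X : Matrix _ _ ℝ) ψ :=
  let ⟨_, h⟩ := (R.mem_g₀ X).1 X.2
  C.exists_isOneParam_lift R h

theorem IsOneParam_unique {X : Matrix (Fin n) (Fin n) ℝ} {φ ψ : ℝ → Gt}
    (hφ : IsOneParam (C.toGL R) X φ) (hψ : IsOneParam (C.toGL R) X ψ) (t : ℝ) : φ t = ψ t :=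
  C.eq_of_toGL_eq R hφ.1 hψ.1 (fun t => Units.ext ((hφ.2.2 t).trans (hψ.2.2 t).symm))
    (t₀ := 0) (hφ.zero.trans hψ.zero.symm) t

/-- The exponential map of the covering group. -/
def expT (X : R.g₀) : Gt := (C.exists_isOneParam R X).choose 1

theorem isOneParam_expT (X : R.g₀) :
    IsOneParam (C.toGL R) (X : Matrix _ _ ℝ) fun t => C.expT R (t • X) := by
  have h := (C.exists_isOneParam R X).choose_spec
  have (t : ℝ) : C.expT R (t • X) = (C.exists_isOneParam R X).choose t := by
    have h2 := C.IsOneParam_unique R (C.exists_isOneParam R (t • X)).choose_spec (h.comp_mul t) 1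
    rwa [one_mul] at h2
  simpa only [this] using h

theorem expT_eq_of_isOneParam {X : R.g₀} {φ : ℝ → Gt}
    (h : IsOneParam (C.toGL R) (X : Matrix _ _ ℝ) φ) (t : ℝ) : φ t = C.expT R (t • X) :=
  C.IsOneParam_unique R h (C.isOneParam_expT R X) t

theorem isExp_iff {X : R.g₀} {x : Gt} :
    IsExp (C.toGL R) (X : Matrix _ _ ℝ) x ↔ C.expT R X = x := by
  constructor
  · rintro ⟨φ, h, rfl⟩
    rw [C.expT_eq_of_isOneParam R h, one_smul]
  · rintro rfl
    exact ⟨_, C.isOneParam_expT R X, by simp⟩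

theorem toGL_expT (X : R.g₀) :
    (C.toGL R (C.expT R X)).val = NormedSpace.exp (X : Matrix (Fin n) (Fin n) ℝ) := by
  have := (C.isOneParam_expT R X).2.2 1
  simpa using this

theorem continuous_expT_smul (X : R.g₀) : Continuous fun t : ℝ => C.expT R (t • X) :=
  (C.isOneParam_expT R X).1

theorem expT_add_smul (X : R.g₀) (s t : ℝ) :
    C.expT R ((s + t) • X) = C.expT R (s • X) * C.expT R (t • X) :=
  (C.isOneParam_expT R X).2.1 s t

@[simp]
theorem expT_zero : C.expT R 0 = 1 := by
  simpa using (C.isOneParam_expT R 0).zero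

theorem expT_neg (X : R.g₀) : C.expT R (-X) = (C.expT R X)⁻¹ := by
  simpa using (C.isOneParam_expT R X).neg 1

theorem isExp_p {X : R.g₀} {x : G} (h : IsExp R.ρ (X : Matrix _ _ ℝ) x) :
    x = C.p (C.expT R X) := by
  obtain ⟨φ, h, rfl⟩ := h
  apply R.ρ_injective
  apply Units.ext
  rw [h.2.2, one_smul, ← C.toGL_expT]
  rfl

/-- One-parameter subgroups lift uniquely, so a conjugation rule verified on matrices holds in the
cover without any ambiguity of sign. -/
theorem conj_expT {g : Gt} {X Y : R.g₀}
    (h : (C.toGL R g).val * X = (Y : Matrix (Fin n) (Fin n) ℝ) * (C.toGL R g).val) :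
    g * C.expT R X * g⁻¹ = C.expT R Y := by
  have : IsOneParam (C.toGL R) (Y : Matrix _ _ ℝ) fun t => g * C.expT R (t • X) * g⁻¹ := by
    refine ⟨by have := C.continuous_expT_smul R X; fun_prop, fun s t => ?_, fun t => ?_⟩
    · simp only [C.expT_add_smul]; group
    · have hY : t • (Y : Matrix (Fin n) (Fin n) ℝ) = (C.toGL R g).val * (t • X : R.g₀) *
          ((C.toGL R g)⁻¹).val := by
        rw [Units.eq_mul_inv_iff_mul_eq, show ((t • X : R.g₀) : Matrix (Fin n) (Fin n) ℝ) = t • X from rfl,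
          mul_smul_comm, h, smul_mul_assoc]
      rw [map_mul, map_mul, Units.val_mul, Units.val_mul, C.toGL_expT, hY, map_inv,
        Matrix.exp_units_conj]
  simpa using C.expT_eq_of_isOneParam R this 1

theorem expT_add {X Y : R.g₀} (h : ⁅X, Y⁆ = 0) :
    C.expT R (X + Y) = C.expT R X * C.expT R Y := by
  have hc : Commute (X : Matrix (Fin n) (Fin n) ℝ) Y := by
    have := congrArg (Subtype.val) h
    rw [LieSubalgebra.coe_bracket, Ring.lie_def] at this
    exact sub_eq_zero.1 this
  have hcs (s t : ℝ) :
      C.expT R (s • X) * C.expT R (t • Y) = C.expT R (t • Y) * C.expT R (s • X) := by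
    rw [← mul_inv_eq_iff_eq_mul]
    apply C.conj_expT R
    rw [C.toGL_expT]
    exact ((hc.smul_left s).smul_right t).exp_left
  have : IsOneParam (C.toGL R) ((X + Y : R.g₀) : Matrix _ _ ℝ)
      fun t => C.expT R (t • X) * C.expT R (t • Y) := by
    refine ⟨(C.continuous_expT_smul R X).mul (C.continuous_expT_smul R Y), fun s t => ?_,
      fun t => ?_⟩
    · simp only [C.expT_add_smul]
      rw [mul_assoc, mul_assoc, ← mul_assoc _ (C.expT R (s • Y)), hcs t s, mul_assoc]
    · rw [map_mul, Units.val_mul, C.toGL_expT, C.toGL_expT, ← Matrix.exp_add_of_commute]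
      · simp
      · exact (hc.smul_left t).smul_right t
  simpa using (C.expT_eq_of_isOneParam R this 1).symm

end TwoFoldCover

/-! ### Copies of 𝔰𝔲(2) in the covering group. -/

section Rotation

variable {A : Type*} [NormedRing A] [NormedAlgebra ℝ A] [CompleteSpace A]

theorem exp_smul_mul_eq_rotation {X P Q : A} (hP : X * P - P * X = (2 : ℝ) • Q)
    (hQ : X * Q - Q * X = -((2 : ℝ) • P)) (t : ℝ) :
    NormedSpace.exp (t • X) * P =
      (Real.cos (2 * t) • P + Real.sin (2 * t) • Q) * NormedSpace.exp (t • X) := by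
  have key := exp_smul_mul_eq_of_hasDerivAt (X := X)
    (Y := fun t : ℝ => Real.cos (2 * t) • P + Real.sin (2 * t) • Q) (fun t => ?_) t
  · simpa using key
  · have dc : HasDerivAt (fun t : ℝ => Real.cos (2 * t)) (-Real.sin (2 * t) * (2 * 1)) t :=
      ((hasDerivAt_id t).const_mul 2).cos
    have ds : HasDerivAt (fun t : ℝ => Real.sin (2 * t)) (Real.cos (2 * t) * (2 * 1)) t :=
      ((hasDerivAt_id t).const_mul 2).sin
    refine ((dc.smul_const P).add (ds.smul_const Q)).congr_deriv ?_
    have h3 (a b : ℝ) : X * (a • P + b • Q) - (a • P + b • Q) * X =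
        a • (X * P - P * X) + b • (X * Q - Q * X) := by
      simp only [mul_add, add_mul, mul_smul_comm, smul_mul_assoc, smul_sub]
      abel
    rw [h3, hP, hQ]
    module

theorem Matrix.exp_smul_mul_eq_rotation {X P Q : Matrix (Fin n) (Fin n) ℝ}
    (hP : X * P - P * X = (2 : ℝ) • Q) (hQ : X * Q - Q * X = -((2 : ℝ) • P)) (t : ℝ) :
    NormedSpace.exp (t • X) * P =
      (Real.cos (2 * t) • P + Real.sin (2 * t) • Q) * NormedSpace.exp (t • X) := by
  let _ : NormedRing (Matrix (Fin n) (Fin n) ℝ) := Matrix.linftyOpNormedRing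
  let _ : NormedAlgebra ℝ (Matrix (Fin n) (Fin n) ℝ) := Matrix.linftyOpNormedAlgebra
  exact _root_.exp_smul_mul_eq_rotation hP hQ t

end Rotation

section RealToComplex

theorem map_exp_of_real {A B : Type*} [NormedRing A] [NormedAlgebra ℝ A] [CompleteSpace A]
    [NormedRing B] [NormedAlgebra ℝ B] (f : A →+* B) (hf : Continuous f) (x : A) :
    f (NormedSpace.exp x) = NormedSpace.exp (f x) := by
  let _ : NormedAlgebra ℚ A := NormedAlgebra.restrictScalars ℚ ℝ A
  let _ : NormedAlgebra ℚ B := NormedAlgebra.restrictScalars ℚ ℝ B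
  exact NormedSpace.map_exp f hf x

theorem realToComplexMatrix_injective : Function.Injective (realToComplexMatrix n) := by
  intro X Y h
  ext i j
  exact Complex.ofReal_injective (congrFun (congrFun h i) j)

theorem realToComplexMatrix_apply (X : Matrix (Fin n) (Fin n) ℝ) :
    realToComplexMatrix n X = X.map Complex.ofReal := rfl

theorem realToComplexMatrix_mul (X Y : Matrix (Fin n) (Fin n) ℝ) :
    realToComplexMatrix n (X * Y) = realToComplexMatrix n X * realToComplexMatrix n Y := by
  simp only [realToComplexMatrix_apply]
  exact Matrix.map_mul (f := Complex.ofRealHom)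

theorem realToComplexMatrix_one : realToComplexMatrix n 1 = 1 :=
  Matrix.map_one _ Complex.ofReal_zero Complex.ofReal_one

theorem realToComplexMatrix_exp (X : Matrix (Fin n) (Fin n) ℝ) :
    realToComplexMatrix n (NormedSpace.exp X) = NormedSpace.exp (realToComplexMatrix n X) := by
  let _ : NormedRing (Matrix (Fin n) (Fin n) ℝ) := Matrix.linftyOpNormedRing
  let _ : NormedAlgebra ℝ (Matrix (Fin n) (Fin n) ℝ) := Matrix.linftyOpNormedAlgebra
  let _ : NormedRing (Matrix (Fin n) (Fin n) ℂ) := Matrix.linftyOpNormedRing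
  let _ : NormedAlgebra ℝ (Matrix (Fin n) (Fin n) ℂ) := Matrix.linftyOpNormedAlgebra
  exact map_exp_of_real (Complex.ofRealHom.mapMatrix (m := Fin n))
    (continuous_id.matrix_map Complex.continuous_ofReal) X

end RealToComplex

namespace TwoFoldCover

variable (R : RealReductiveLinear G n) (C : TwoFoldCover G Gt)

theorem coe_lie (X Y : R.g₀) :
    ((⁅X, Y⁆ : R.g₀) : Matrix (Fin n) (Fin n) ℝ) = X.1 * Y.1 - Y.1 * X.1 := by
  rw [LieSubalgebra.coe_bracket, Ring.lie_def]

theorem expT_eq_one_or_neg {X : R.g₀}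
    (h : NormedSpace.exp (realToComplexMatrix n X.1) = 1) :
    C.expT R X = 1 ∨ C.expT R X = C.neg := by
  rw [← C.toGL_eq_one_iff R]
  apply Units.ext
  rw [C.toGL_expT]
  apply realToComplexMatrix_injective
  rw [realToComplexMatrix_exp, h]
  exact realToComplexMatrix_one.symm

/-- The exponential of `2πT` in the covering group is trivial if `T` belongs to a standard basis of
a copy of `𝔰𝔲(2)`, which is the Lie algebra of a simply connected group. -/
theorem expT_eq_one_of_su2 {T J J' : R.g₀} (h1 : ⁅T, J⁆ = (2 : ℝ) • J')
    (h2 : ⁅T, J'⁆ = -((2 : ℝ) • J)) (h3 : ⁅J, J'⁆ = (2 : ℝ) • T) :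
    C.expT R ((2 * Real.pi) • T) = 1 := by
  have hm : C.expT R (Real.pi • T) * C.expT R (Real.pi • T) = C.expT R ((2 * Real.pi) • T) := by
    rw [two_mul, C.expT_add_smul]
  replace h1 := congrArg Subtype.val h1
  replace h2 := congrArg Subtype.val h2
  replace h3 := congrArg Subtype.val h3
  rw [coe_lie] at h1 h2 h3
  set m := C.expT R (Real.pi • T) with hmdef
  -- `exp(πT)` turns the plane of `J, J'` through the angle `2π`.
  have hmJ : (C.toGL R m).val * J.1 = J.1 * (C.toGL R m).val := by
    have := Matrix.exp_smul_mul_eq_rotation h1 h2 Real.pi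
    rw [Real.cos_two_pi, Real.sin_two_pi, one_smul, zero_smul, add_zero] at this
    rw [hmdef, C.toGL_expT]
    exact this
  -- The two products have the same image in `G` for every `s` and agree at `s = 0`, so no sign can
  -- appear.
  have hcomm (s : ℝ) : C.expT R (s • J) * m = m * C.expT R (s • J) := by
    refine C.eq_of_toGL_eq R (f := fun s : ℝ => C.expT R (s • J) * m)
      (g := fun s : ℝ => m * C.expT R (s • J)) ?_ ?_ (fun s => ?_) (t₀ := 0) (by simp) s
    · exact (C.continuous_expT_smul R J).mul continuous_const
    · exact continuous_const.mul (C.continuous_expT_smul R J)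
    · apply Units.ext
      rw [map_mul, map_mul, Units.val_mul, Units.val_mul, C.toGL_expT R (s • J)]
      exact (Commute.exp_left (show Commute (s • J.1) _ from
        (show Commute J.1 _ from hmJ.symm).smul_left s)).eq
  -- `exp(πJ/2)` turns `T` through the angle `π`, that is, into `-T`. Since it also commutes with
  -- `m`, this forces `m = m⁻¹`.
  have hconj : C.expT R ((Real.pi / 2) • J) * m * (C.expT R ((Real.pi / 2) • J))⁻¹ = m⁻¹ := by
    rw [← C.expT_neg R (Real.pi • T)]
    apply C.conj_expT R
    have := Matrix.exp_smul_mul_eq_rotation (X := J.1) (P := T.1) (Q := -J'.1)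
      (by rw [← neg_sub, h1]; simp) (by
        rw [show (2 : ℝ) • T.1 = ((2 : ℝ) • T : R.g₀).1 from rfl, ← h3]; noncomm_ring) (Real.pi / 2)
    rw [show 2 * (Real.pi / 2) = Real.pi by ring, Real.cos_pi, Real.sin_pi, zero_smul, add_zero,
      neg_one_smul] at this
    rw [C.toGL_expT]
    show NormedSpace.exp ((Real.pi / 2) • J.1) * (Real.pi • T.1) =
      (-(Real.pi • T.1)) * NormedSpace.exp ((Real.pi / 2) • J.1)
    rw [mul_smul_comm, this, ← smul_neg, smul_mul_assoc]
  rw [hcomm, mul_inv_cancel_right] at hconj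
  rw [← hm]
  nth_rewrite 1 [hconj]
  exact inv_mul_cancel m

end TwoFoldCover

/-! ### Bruhat decomposition in groups locally isomorphic to SL(2, ℝ). -/

section Bruhat

/-- Relations among the root subgroups `x`, `y`, the torus `a` and the Weyl group element `w` of a
group that is locally isomorphic to `SL(2, ℝ)`. -/
structure Sl2Relations {Γ : Type*} [Group Γ] (x y a : ℝ → Γ) (w : Γ) : Prop where
  x_add : ∀ s t, x (s + t) = x s * x t
  y_add : ∀ s t, y (s + t) = y s * y t
  a_add : ∀ s t, a (s + t) = a s * a t
  w_eq : w = x 1 * y (-1) * x 1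
  a_x : ∀ u t, a u * x t = x (Real.exp (2 * u) * t) * a u
  a_y : ∀ u t, a u * y t = y (Real.exp (-(2 * u)) * t) * a u
  w_x : ∀ t, w * x t = y (-t) * w
  w_y : ∀ t, w * y t = x (-t) * w
  w_a : ∀ u, w * a u = a (-u) * w

namespace Sl2Relations

variable {Γ : Type*} [Group Γ] {x y a : ℝ → Γ} {w : Γ} (H : Sl2Relations x y a w)

include H

theorem x_zero : x 0 = 1 := by simpa using H.x_add 0 0
theorem y_zero : y 0 = 1 := by simpa using H.y_add 0 0
theorem a_zero : a 0 = 1 := by simpa using H.a_add 0 0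

theorem x_neg (t : ℝ) : x (-t) = (x t)⁻¹ := by
  rw [eq_inv_iff_mul_eq_one, ← H.x_add, neg_add_cancel, H.x_zero]

theorem y_neg (t : ℝ) : y (-t) = (y t)⁻¹ := by
  rw [eq_inv_iff_mul_eq_one, ← H.y_add, neg_add_cancel, H.y_zero]

theorem a_neg (t : ℝ) : a (-t) = (a t)⁻¹ := by
  rw [eq_inv_iff_mul_eq_one, ← H.a_add, neg_add_cancel, H.a_zero]

theorem commute_sq_x (t : ℝ) : Commute (w ^ 2) (x t) := by
  rw [pow_two, Commute, SemiconjBy, mul_assoc, H.w_x, ← mul_assoc, H.w_y, neg_neg, mul_assoc]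

theorem commute_sq_a (t : ℝ) : Commute (w ^ 2) (a t) := by
  rw [pow_two, Commute, SemiconjBy, mul_assoc, H.w_a, ← mul_assoc, H.w_a, neg_neg, mul_assoc]

theorem commute_zpow_x {i : ℤ} (hi : Even i) (t : ℝ) : Commute (w ^ i) (x t) := by
  obtain ⟨k, rfl⟩ := hi
  rw [← two_mul, zpow_mul]
  exact_mod_cast (H.commute_sq_x t).zpow_left k

theorem commute_zpow_a {i : ℤ} (hi : Even i) (t : ℝ) : Commute (w ^ i) (a t) := by
  obtain ⟨k, rfl⟩ := hi
  rw [← two_mul, zpow_mul]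
  exact_mod_cast (H.commute_sq_a t).zpow_left k

/-- `w(b) = a(log b) w` for `b > 0`. -/
theorem x_mul_y_mul_x {b : ℝ} (hb : 0 < b) :
    x b * y (-b⁻¹) * x b = a (Real.log b) * w := by
  have hl : Real.exp (2 * (Real.log b / 2)) = b := by
    rw [mul_div_cancel₀ _ two_ne_zero, Real.exp_log hb]
  -- Conjugating the defining product of `w` by `a(½ log b)` rescales its three factors to `b`,
  -- `-b⁻¹`, `b`.
  have h1 : a (Real.log b / 2) * w = x b * y (-b⁻¹) * x b * a (Real.log b / 2) := by
    rw [H.w_eq, ← mul_assoc, ← mul_assoc, H.a_x, hl, mul_one, mul_assoc (x b), H.a_y, Real.exp_neg,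
      hl, ← mul_assoc, mul_assoc _ _ (x 1), H.a_x, hl, mul_one, ← mul_assoc, mul_neg_one]
  rw [← mul_inv_eq_iff_eq_mul, ← H.a_neg, mul_assoc, H.w_a, neg_neg, ← mul_assoc, ← H.a_add,
    add_halves] at h1
  exact h1.symm

/-- Elements of the lower triangular root subgroup in the big cell. -/
theorem exists_y_eq {r : ℝ} (hr : r ≠ 0) :
    ∃ p q : ℝ, ∃ ε : ℤ, Odd ε ∧ y r = x p * w ^ ε * a q * x p := by
  rcases lt_or_gt_of_ne hr with h | h
  · have h1 := H.x_mul_y_mul_x (b := (-r)⁻¹) (by simpa using h)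
    rw [inv_inv, neg_neg] at h1
    refine ⟨-(-r)⁻¹, Real.log (-r)⁻¹ |> (- ·), 1, odd_one, ?_⟩
    rw [zpow_one, mul_assoc _ w, H.w_a, neg_neg, ← h1, H.x_neg]
    group
  · have h1 := H.x_mul_y_mul_x (b := r⁻¹) (by simpa using h)
    rw [inv_inv] at h1
    refine ⟨r⁻¹, -Real.log r⁻¹, -1, odd_neg_one, ?_⟩
    rw [mul_assoc (x _), H.a_neg, zpow_neg_one, ← mul_inv_rev, ← h1, H.y_neg]
    group

/-- The Bruhat decomposition of the group generated by the root subgroups. -/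
theorem exists_eq_of_mem_closure {g : Γ} (hg : g ∈ Subgroup.closure (Set.range x ∪ Set.range y)) :
    ∃ (s : ℝ) (i : ℤ) (u t : ℝ), g = x s * w ^ i * a u * x t := by
  have hx : ∀ r g, (∃ (s : ℝ) (i : ℤ) (u t : ℝ), g = x s * w ^ i * a u * x t) →
      ∃ (s : ℝ) (i : ℤ) (u t : ℝ), x r * g = x s * w ^ i * a u * x t := by
    rintro r _ ⟨s, i, u, t, rfl⟩
    exact ⟨r + s, i, u, t, by rw [H.x_add]; group⟩
  -- Even powers of `w` commute with `x` and `a`. For even `i` the factor `x s` can be moved to the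
  -- right past `w^i`. For odd `i` and `s ≠ 0`, `w^δ` turns `x s` into `y (-s)`, which lies in the
  -- big cell, and the remaining power `δ + i` of `w` is even.
  have hw : ∀ (δ : ℤ) (_ : δ = 1 ∨ δ = -1) (g : Γ),
      (∃ (s : ℝ) (i : ℤ) (u t : ℝ), g = x s * w ^ i * a u * x t) →
      ∃ (s : ℝ) (i : ℤ) (u t : ℝ), w ^ δ * g = x s * w ^ i * a u * x t := by
    rintro δ hδ _ ⟨s, i, u, t, rfl⟩
    have hδx (s : ℝ) : w ^ δ * x s = y (-s) * w ^ δ := by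
      rcases hδ with rfl | rfl
      · simpa using H.w_x s
      · have := H.w_y (-s)
        rw [neg_neg] at this
        rw [zpow_neg_one, inv_mul_eq_iff_eq_mul, ← mul_assoc, this, mul_inv_cancel_right]
    rcases Int.even_or_odd i with hi | hi
    · have h1 : a u * x (Real.exp (-(2 * u)) * s) = x s * a u := by
        rw [H.a_x, ← mul_assoc, ← Real.exp_add, add_neg_cancel, Real.exp_zero, one_mul]
      refine ⟨0, δ + i, u, Real.exp (-(2 * u)) * s + t, ?_⟩
      rw [H.x_zero, H.x_add, one_mul, ← (H.commute_zpow_x hi s).eq, zpow_add]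
      simp only [mul_assoc]
      rw [← mul_assoc (a u), h1, mul_assoc]
    · rcases eq_or_ne s 0 with rfl | hs
      · exact ⟨0, δ + i, u, t, by rw [H.x_zero, zpow_add]; group⟩
      · obtain ⟨p, q, ε, -, hy⟩ := H.exists_y_eq (neg_ne_zero.2 hs)
        have he : Even (δ + i) := by
          rcases hδ with rfl | rfl
          · exact Odd.add_odd odd_one hi
          · exact Odd.add_odd odd_neg_one hi
        have h1 : a u * x (Real.exp (-(2 * u)) * p) = x p * a u := by
          rw [H.a_x, ← mul_assoc, ← Real.exp_add, add_neg_cancel, Real.exp_zero, one_mul]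
        refine ⟨p, ε + (δ + i), q + u, Real.exp (-(2 * u)) * p + t, ?_⟩
        have h2 : a q * (x p * w ^ (δ + i)) = w ^ (δ + i) * (a q * x p) := by
          rw [← (H.commute_zpow_x he p).eq, ← mul_assoc, ← (H.commute_zpow_a he q).eq, mul_assoc]
        calc w ^ δ * (x s * w ^ i * a u * x t)
            = (w ^ δ * x s) * (w ^ i * a u * x t) := by group
          _ = x p * w ^ ε * (a q * (x p * w ^ (δ + i))) * (a u * x t) := by
              rw [hδx, hy, zpow_add]; group
          _ = x p * w ^ (ε + (δ + i)) * a q * (x p * a u) * x t := by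
              rw [h2, zpow_add w ε]; group
          _ = _ := by rw [← h1, H.a_add, H.x_add]; group
  -- The lower root subgroup is conjugate to the upper one, so stability under `x` and `w` is
  -- enough.
  have hyx (t : ℝ) : y t = w ^ (1 : ℤ) * (x (-t) * w ^ (-1 : ℤ)) := by
    rw [zpow_one, zpow_neg_one, ← mul_assoc, H.w_x, neg_neg, mul_inv_cancel_right]
  have hy : ∀ r g, (∃ (s : ℝ) (i : ℤ) (u t : ℝ), g = x s * w ^ i * a u * x t) →
      ∃ (s : ℝ) (i : ℤ) (u t : ℝ), y r * g = x s * w ^ i * a u * x t := by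
    intro r g hg
    rw [hyx, mul_assoc, mul_assoc]
    exact hw 1 (Or.inl rfl) _ (hx _ _ (hw (-1) (Or.inr rfl) _ hg))
  induction hg using Subgroup.closure_induction_left with
  | one => exact ⟨0, 0, 0, 0, by simp [H.x_zero, H.a_zero]⟩
  | mul_left g hg g' _ ih =>
    rcases hg with ⟨r, rfl⟩ | ⟨r, rfl⟩
    · exact hx r _ ih
    · exact hy r _ ih
  | inv_mul_cancel g hg g' _ ih =>
    rcases hg with ⟨r, rfl⟩ | ⟨r, rfl⟩
    · rw [← H.x_neg]; exact hx _ _ ih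
    · rw [← H.y_neg]; exact hy _ _ ih

/-- Applied to SL(2, ℝ) and the cover, this lets one Bruhat decomposition describe pairs, with the
same parameters in both components. -/
theorem prod {Γ' : Type*} [Group Γ'] {x' y' a' : ℝ → Γ'} {w' : Γ'}
    (H' : Sl2Relations x' y' a' w') :
    Sl2Relations (fun t => (x t, x' t)) (fun t => (y t, y' t)) (fun t => (a t, a' t)) (w, w') where
  x_add s t := Prod.ext (H.x_add s t) (H'.x_add s t)
  y_add s t := Prod.ext (H.y_add s t) (H'.y_add s t)
  a_add s t := Prod.ext (H.a_add s t) (H'.a_add s t)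
  w_eq := Prod.ext H.w_eq H'.w_eq
  a_x u t := Prod.ext (H.a_x u t) (H'.a_x u t)
  a_y u t := Prod.ext (H.a_y u t) (H'.a_y u t)
  w_x t := Prod.ext (H.w_x t) (H'.w_x t)
  w_y t := Prod.ext (H.w_y t) (H'.w_y t)
  w_a u := Prod.ext (H.w_a u) (H'.w_a u)

/-- The rotation by a quarter turn, from the Gauss decomposition of the rotation by an eighth
turn. -/
theorem y_mul_a_mul_x_sq (l : ℝ) (hl : Real.exp (2 * l) = 2) :
    (y (-1) * a (-l) * x 1) * (y (-1) * a (-l) * x 1) = w := by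
  have h1 : x 1 * y (-1) = w * x (-1) := by rw [H.w_eq, H.x_neg]; group
  have h2 : a l * x (-1) = x (-2) * a l := by rw [H.a_x, hl]; norm_num
  have h3 : y (-1) * w = w * x 1 := (H.w_x 1).symm
  calc (y (-1) * a (-l) * x 1) * (y (-1) * a (-l) * x 1)
      = y (-1) * a (-l) * (x 1 * y (-1)) * a (-l) * x 1 := by group
    _ = y (-1) * (a (-l) * w) * x (-1) * a (-l) * x 1 := by rw [h1]; group
    _ = y (-1) * w * (a l * x (-1)) * a (-l) * x 1 := by rw [← H.w_a]; group
    _ = w * x 1 * x (-2) * (a l * a (-l)) * x 1 := by rw [h2, h3]; group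
    _ = w := by
      rw [← H.a_add, add_neg_cancel, H.a_zero, mul_one, mul_assoc, mul_assoc, ← H.x_add, ← H.x_add]
      norm_num [H.x_zero]

end Sl2Relations

end Bruhat

section WeylElement

open NormedSpace

variable {A : Type*} [NormedRing A] [NormedAlgebra ℝ A] [CompleteSpace A] {h e f : A}

theorem exp_mul_exp_mul_exp_mul_e (hef : e * f - f * e = h) (he : h * e - e * h = 2 • e)
    (hf : h * f - f * h = -(2 • f)) :
    exp e * exp (-f) * exp e * e = -f * (exp e * exp (-f) * exp e) := by
  have h1 := exp_smul_e_mul_h he 1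
  have h3 := exp_smul_f_mul_e hef hf (-1)
  have h4 := exp_smul_e_mul_f hef he 1
  simp only [one_smul, mul_one, neg_smul, sub_neg_eq_add, even_two, Even.neg_pow, one_pow]
    at h1 h3 h4
  rw [mul_assoc _ (exp e) e, ← ((Commute.refl e).exp_right).eq, ← mul_assoc, mul_assoc (exp e), h3,
    ← mul_assoc, mul_sub, mul_add, h1, h4, ← ((Commute.refl e).exp_right).eq]
  simp only [two_smul]
  noncomm_ring

theorem exp_mul_exp_mul_exp_mul_f (hef : e * f - f * e = h) (he : h * e - e * h = 2 • e)
    (hf : h * f - f * h = -(2 • f)) :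
    exp e * exp (-f) * exp e * f = -e * (exp e * exp (-f) * exp e) := by
  have h1 := exp_smul_f_mul_h hf (-1)
  have h3 := exp_smul_f_mul_e hef hf (-1)
  have h4 := exp_smul_e_mul_f hef he 1
  simp only [one_smul, mul_one, mul_neg, neg_smul, sub_neg_eq_add, even_two, Even.neg_pow, one_pow]
    at h1 h3 h4
  have h5 : exp (-f) * f = f * exp (-f) := ((Commute.refl f).neg_left.exp_left).eq
  rw [mul_assoc _ (exp e) f, h4, ← mul_assoc, mul_assoc (exp e), mul_sub, mul_add, h1, h3, h5,
    ← add_mul, ← sub_mul]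
  have h6 : f + (h + -((2 : ℝ) • f)) - (e + h - f) = -e := by
    simp only [two_smul]; abel
  rw [h6, ← mul_assoc, ← mul_assoc, ← mul_assoc, mul_neg, ← ((Commute.refl e).exp_right).eq]
  noncomm_ring

end WeylElement

/-! ### The model group SL(2, ℝ). -/

section SL2

/-- The upper triangular unipotent subgroup of `SL(2, ℝ)`. -/
def sl2X (t : ℝ) : Matrix.SpecialLinearGroup (Fin 2) ℝ := ⟨!![1, t; 0, 1], by simp [Matrix.det_fin_two]⟩

/-- The lower triangular unipotent subgroup of `SL(2, ℝ)`. -/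
def sl2Y (t : ℝ) : Matrix.SpecialLinearGroup (Fin 2) ℝ := ⟨!![1, 0; t, 1], by simp [Matrix.det_fin_two]⟩

/-- The positive diagonal subgroup of `SL(2, ℝ)`. -/
def sl2A (t : ℝ) : Matrix.SpecialLinearGroup (Fin 2) ℝ :=
  ⟨!![Real.exp t, 0; 0, Real.exp (-t)], by simp [Matrix.det_fin_two, ← Real.exp_add]⟩

/-- The Weyl group element of `SL(2, ℝ)`. -/
def sl2W : Matrix.SpecialLinearGroup (Fin 2) ℝ := ⟨!![0, 1; -1, 0], by simp [Matrix.det_fin_two]⟩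

@[simp] theorem coe_sl2X (t : ℝ) : (sl2X t).1 = !![1, t; 0, 1] := rfl
@[simp] theorem coe_sl2Y (t : ℝ) : (sl2Y t).1 = !![1, 0; t, 1] := rfl
@[simp] theorem coe_sl2A (t : ℝ) : (sl2A t).1 = !![Real.exp t, 0; 0, Real.exp (-t)] := rfl
@[simp] theorem coe_sl2W : sl2W.1 = !![0, 1; -1, 0] := rfl

theorem sl2_ext {s t : Matrix.SpecialLinearGroup (Fin 2) ℝ} (h00 : s.1 0 0 = t.1 0 0)
    (h01 : s.1 0 1 = t.1 0 1) (h10 : s.1 1 0 = t.1 1 0) (h11 : s.1 1 1 = t.1 1 1) : s = t := by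
  refine Subtype.ext (Matrix.ext fun i j => ?_)
  fin_cases i <;> fin_cases j <;> assumption

theorem sl2Relations : Sl2Relations sl2X sl2Y sl2A sl2W where
  x_add s t := by
    apply sl2_ext <;> simp [add_comm]
  y_add s t := by
    apply sl2_ext <;> simp
  a_add s t := by
    apply sl2_ext <;> simp [Real.exp_add, mul_comm]
  w_eq := by
    apply sl2_ext <;> simp
  a_x u t := by
    apply sl2_ext <;> simp [two_mul]
    rw [Real.exp_add, Real.exp_neg]; field_simp
  a_y u t := by
    apply sl2_ext <;> simp [two_mul]
    rw [Real.exp_add, Real.exp_neg]; field_simp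
  w_x t := by
    apply sl2_ext <;> simp
  w_y t := by
    apply sl2_ext <;> simp
  w_a u := by
    apply sl2_ext <;> simp

theorem sl2W_pow_two : sl2W ^ 2 = -1 := by
  rw [pow_two]
  apply sl2_ext <;> simp

theorem sl2W_pow_four : sl2W ^ 4 = 1 := by
  rw [show 4 = 2 * 2 from rfl, pow_mul, sl2W_pow_two, neg_one_sq]

theorem sl2W_zpow_four_mul (k : ℤ) : sl2W ^ (4 * k) = 1 := by
  rw [_root_.zpow_mul, show sl2W ^ (4 : ℤ) = 1 by exact_mod_cast sl2W_pow_four, one_zpow]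

/-- The only coincidences in the Bruhat decomposition of the identity. -/
theorem sl2_bruhat_eq_one {s u t : ℝ} {i : ℤ} (h : sl2X s * sl2W ^ i * sl2A u * sl2X t = 1) :
    (4 : ℤ) ∣ i ∧ u = 0 ∧ t = -s := by
  have hi : sl2W ^ i = sl2W ^ (i % 4).toNat := by
    have h4 : (0 : ℤ) ≤ i % 4 := Int.emod_nonneg _ (by norm_num)
    conv_lhs => rw [← Int.mul_ediv_add_emod i 4]
    rw [zpow_add, sl2W_zpow_four_mul, one_mul, ← zpow_natCast, Int.toNat_of_nonneg h4]
  have h2 : sl2W ^ (i % 4).toNat * (sl2A u * sl2X t) = sl2X (-s) := by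
    rw [← hi, sl2Relations.x_neg, ← mul_assoc]
    rw [mul_assoc, mul_assoc, ← mul_assoc (sl2W ^ i)] at h
    exact eq_inv_of_mul_eq_one_right h
  have hlt : (i % 4).toNat < 4 := by omega
  have hdvd : (i % 4).toNat = 0 → (4 : ℤ) ∣ i := by omega
  have he := Real.exp_pos u
  have h00 := congrArg (fun g => g.1 0 0) h2
  have h01 := congrArg (fun g => g.1 0 1) h2
  have h10 := congrArg (fun g => g.1 1 0) h2
  generalize (i % 4).toNat = m at *
  -- Residues 1 and 3 give a nonzero lower left entry, and residue 2 a negative upper left entry;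
  -- only residue 0 survives.
  interval_cases m
  · refine ⟨hdvd rfl, ?_⟩
    simp at h00 h01
    subst h00
    exact ⟨rfl, by simpa using h01⟩
  · simp at h10
  · rw [sl2W_pow_two] at *
    simp at h00
    linarith
  · rw [pow_succ, sl2W_pow_two] at *
    simp at h10

end SL2

/-! ### Real 𝔰𝔩₂-triples and their root subgroups in the cover. -/

section MatrixConj

variable {h e f : Matrix (Fin n) (Fin n) ℝ}

open NormedSpace

theorem Matrix.exp_smul_e_mul_h (he : h * e - e * h = 2 • e) (t : ℝ) :
    exp (t • e) * h = (h - (2 * t) • e) * exp (t • e) := by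
  let _ : NormedRing (Matrix (Fin n) (Fin n) ℝ) := Matrix.linftyOpNormedRing
  let _ : NormedAlgebra ℝ (Matrix (Fin n) (Fin n) ℝ) := Matrix.linftyOpNormedAlgebra
  exact _root_.exp_smul_e_mul_h he t

theorem Matrix.exp_smul_f_mul_h (hf : h * f - f * h = -(2 • f)) (t : ℝ) :
    exp (t • f) * h = (h + (2 * t) • f) * exp (t • f) := by
  let _ : NormedRing (Matrix (Fin n) (Fin n) ℝ) := Matrix.linftyOpNormedRing
  let _ : NormedAlgebra ℝ (Matrix (Fin n) (Fin n) ℝ) := Matrix.linftyOpNormedAlgebra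
  exact _root_.exp_smul_f_mul_h hf t

theorem Matrix.exp_smul_f_mul_e (hef : e * f - f * e = h) (hf : h * f - f * h = -(2 • f)) (t : ℝ) :
    exp (t • f) * e = (e - t • h - t ^ 2 • f) * exp (t • f) := by
  let _ : NormedRing (Matrix (Fin n) (Fin n) ℝ) := Matrix.linftyOpNormedRing
  let _ : NormedAlgebra ℝ (Matrix (Fin n) (Fin n) ℝ) := Matrix.linftyOpNormedAlgebra
  exact _root_.exp_smul_f_mul_e hef hf t

theorem Matrix.exp_smul_e_mul_f (hef : e * f - f * e = h) (he : h * e - e * h = 2 • e) (t : ℝ) :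
    exp (t • e) * f = (f + t • h - t ^ 2 • e) * exp (t • e) := by
  let _ : NormedRing (Matrix (Fin n) (Fin n) ℝ) := Matrix.linftyOpNormedRing
  let _ : NormedAlgebra ℝ (Matrix (Fin n) (Fin n) ℝ) := Matrix.linftyOpNormedAlgebra
  exact _root_.exp_smul_e_mul_f hef he t

theorem Matrix.exp_smul_h_mul_e (he : h * e - e * h = 2 • e) (t : ℝ) :
    exp (t • h) * e = (Real.exp (2 * t) • e) * exp (t • h) := by
  let _ : NormedRing (Matrix (Fin n) (Fin n) ℝ) := Matrix.linftyOpNormedRing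
  let _ : NormedAlgebra ℝ (Matrix (Fin n) (Fin n) ℝ) := Matrix.linftyOpNormedAlgebra
  exact _root_.exp_smul_h_mul_e he t

theorem Matrix.exp_smul_h_mul_f (hf : h * f - f * h = -(2 • f)) (t : ℝ) :
    exp (t • h) * f = (Real.exp (-(2 * t)) • f) * exp (t • h) := by
  let _ : NormedRing (Matrix (Fin n) (Fin n) ℝ) := Matrix.linftyOpNormedRing
  let _ : NormedAlgebra ℝ (Matrix (Fin n) (Fin n) ℝ) := Matrix.linftyOpNormedAlgebra
  exact _root_.exp_smul_h_mul_f hf t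

theorem Matrix.weyl_mul (hef : e * f - f * e = h) (he : h * e - e * h = 2 • e)
    (hf : h * f - f * h = -(2 • f)) :
    exp e * exp (-f) * exp e * h = -h * (exp e * exp (-f) * exp e) ∧
    exp e * exp (-f) * exp e * e = -f * (exp e * exp (-f) * exp e) ∧
    exp e * exp (-f) * exp e * f = -e * (exp e * exp (-f) * exp e) := by
  let _ : NormedRing (Matrix (Fin n) (Fin n) ℝ) := Matrix.linftyOpNormedRing
  let _ : NormedAlgebra ℝ (Matrix (Fin n) (Fin n) ℝ) := Matrix.linftyOpNormedAlgebra
  exact ⟨exp_mul_exp_mul_exp_mul_h hef he hf, exp_mul_exp_mul_exp_mul_e hef he hf,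
    exp_mul_exp_mul_exp_mul_f hef he hf⟩

theorem Matrix.exp_gaussCurve {x₁ x₂ x₃ T : ℝ} {u v z : ℝ → ℝ}
    (H : IsGaussCurve x₁ x₂ x₃ T u v z)
    (hef : e * f - f * e = h) (he : h * e - e * h = 2 • e)
    (hf : h * f - f * h = -(2 • f)) {t : ℝ} (ht : t ∈ Set.Icc 0 T) :
    exp (u t • f) * exp (v t • h) * exp (z t • e) = exp (t • (x₁ • h + x₂ • e + x₃ • f)) := by
  let _ : NormedRing (Matrix (Fin n) (Fin n) ℝ) := Matrix.linftyOpNormedRing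
  let _ : NormedAlgebra ℝ (Matrix (Fin n) (Fin n) ℝ) := Matrix.linftyOpNormedAlgebra
  exact H.exp_eq hef he hf ht

/-- `exp (2π (e - f)) = 1` for an `𝔰𝔩₂`-triple of real matrices. -/
theorem Matrix.exp_two_pi_smul_e_sub_f (hef : e * f - f * e = h) (he : h * e - e * h = 2 • e)
    (hf : h * f - f * h = -(2 • f)) :
    exp (realToComplexMatrix n ((2 * Real.pi) • (e - f))) = 1 := by
  have hlift (X Y : Matrix (Fin n) (Fin n) ℝ) : realToComplexMatrix n X * realToComplexMatrix n Y -
      realToComplexMatrix n Y * realToComplexMatrix n X = realToComplexMatrix n (X * Y - Y * X) := by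
    rw [map_sub, realToComplexMatrix_mul, realToComplexMatrix_mul]
  have hef' := hlift e f
  have he' := hlift h e
  have hf' := hlift h f
  rw [hef] at hef'
  rw [he, map_nsmul] at he'
  rw [hf, map_neg, map_nsmul] at hf'
  -- `exp(2π(e - f))` is the square of `exp(π(e - f)) = exp(πi h)`, hence `exp(2πi h)`.
  have h1 := Matrix.exp_pi_smul_e_sub_f hef' he' hf'
  have h2 := Matrix.exp_two_pi_I_smul_eq_one hef' he' hf'
  have h3 (X : Matrix (Fin n) (Fin n) ℂ) : exp (X + X) = exp X * exp X :=
    Matrix.exp_add_of_commute _ _ (Commute.refl X)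
  have h4 : realToComplexMatrix n ((2 * Real.pi) • (e - f)) =
      (Real.pi : ℂ) • (realToComplexMatrix n e - realToComplexMatrix n f) +
      (Real.pi : ℂ) • (realToComplexMatrix n e - realToComplexMatrix n f) := by
    rw [map_smul, map_sub, ← two_smul ℝ, mul_smul]
    rfl
  rw [h4, h3, ← h1, ← h3, ← add_smul, ← h2]
  congr 2
  ring

end MatrixConj

namespace TwoFoldCover

variable (R : RealReductiveLinear G n) (C : TwoFoldCover G Gt) {h e f : R.g₀}

theorem triple_matrix (ht : IsSl2Triple h e f) :
    e.1 * f.1 - f.1 * e.1 = h.1 ∧ h.1 * e.1 - e.1 * h.1 = 2 • e.1 ∧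
      h.1 * f.1 - f.1 * h.1 = -(2 • f.1) := by
  refine ⟨?_, ?_, ?_⟩
  · rw [← coe_lie, ht.lie_e_f]
  · rw [← coe_lie, ht.lie_h_e_nsmul]; rfl
  · rw [← coe_lie, ht.lie_h_f_nsmul]; rfl

theorem conj_expT_mul {g : Gt} {X Y : R.g₀}
    (h : (C.toGL R g).val * X = (Y : Matrix (Fin n) (Fin n) ℝ) * (C.toGL R g).val) :
    g * C.expT R X = C.expT R Y * g :=
  mul_inv_eq_iff_eq_mul.1 (C.conj_expT R h)

/-- The Weyl group element of an `𝔰𝔩₂`-triple in the covering group. -/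
def weylT (e f : R.g₀) : Gt := C.expT R e * C.expT R (-f) * C.expT R e

/-- Apart from the addition laws and the definition of `w`, every relation is a conjugation rule,
and `conj_expT` lifts those from matrices. -/
theorem sl2Relations_expT (ht : IsSl2Triple h e f) :
    Sl2Relations (fun t : ℝ => C.expT R (t • e)) (fun t : ℝ => C.expT R (t • f))
      (fun t : ℝ => C.expT R (t • h)) (C.weylT R e f) := by
  obtain ⟨hef, he, hf⟩ := triple_matrix R ht
  obtain ⟨wh, we, wf⟩ := Matrix.weyl_mul hef he hf
  have hw : (C.toGL R (C.weylT R e f)).val = NormedSpace.exp e.1 * NormedSpace.exp (-f.1) *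
      NormedSpace.exp e.1 := by
    simp only [weylT, map_mul, Units.val_mul, C.toGL_expT]
    rfl
  refine ⟨C.expT_add_smul R e, C.expT_add_smul R f, C.expT_add_smul R h, ?_, fun u t => ?_,
    fun u t => ?_, fun t => ?_, fun t => ?_, fun t => ?_⟩
  · simp [weylT]
  · refine C.conj_expT_mul R ?_
    rw [C.toGL_expT]
    show NormedSpace.exp (u • h.1) * (t • e.1) = ((Real.exp (2 * u) * t) • e.1) * _
    rw [mul_smul_comm, Matrix.exp_smul_h_mul_e he, smul_mul_assoc, smul_mul_assoc, smul_smul,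
      mul_comm t]
    rfl
  · refine C.conj_expT_mul R ?_
    rw [C.toGL_expT]
    show NormedSpace.exp (u • h.1) * (t • f.1) = ((Real.exp (-(2 * u)) * t) • f.1) * _
    rw [mul_smul_comm, Matrix.exp_smul_h_mul_f hf, smul_mul_assoc, smul_mul_assoc, smul_smul,
      mul_comm t]
    rfl
  · refine C.conj_expT_mul R ?_
    rw [hw]
    show _ * (t • e.1) = ((-t) • f.1) * _
    rw [mul_smul_comm, we, neg_smul, ← smul_neg, smul_mul_assoc]
  · refine C.conj_expT_mul R ?_
    rw [hw]
    show _ * (t • f.1) = ((-t) • e.1) * _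
    rw [mul_smul_comm, wf, neg_smul, ← smul_neg, smul_mul_assoc]
  · refine C.conj_expT_mul R ?_
    rw [hw]
    show _ * (t • h.1) = ((-t) • h.1) * _
    rw [mul_smul_comm, wh, neg_smul, ← smul_neg, smul_mul_assoc]

/-- Both sides lift the same curve of matrices over an interval and start at 1. -/
theorem expT_gaussCurve (ht : IsSl2Triple h e f) {x₁ x₂ x₃ T : ℝ} {u v z : ℝ → ℝ}
    (H : IsGaussCurve x₁ x₂ x₃ T u v z) {t : ℝ} (hT : t ∈ Set.Icc 0 T) :
    C.expT R (u t • f) * C.expT R (v t • h) * C.expT R (z t • e) =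
      C.expT R (t • (x₁ • h + x₂ • e + x₃ • f)) := by
  obtain ⟨hef, he, hf⟩ := triple_matrix R ht
  have hu : ContinuousOn u (Set.Icc 0 T) := fun s hs =>
    let ⟨_, _, _, h, _⟩ := H.hasDerivAt s hs
    h.continuousAt.continuousWithinAt
  have hv : ContinuousOn v (Set.Icc 0 T) := fun s hs =>
    let ⟨_, _, _, _, h, _⟩ := H.hasDerivAt s hs
    h.continuousAt.continuousWithinAt
  have hz : ContinuousOn z (Set.Icc 0 T) := fun s hs =>
    let ⟨_, _, _, _, _, h, _⟩ := H.hasDerivAt s hs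
    h.continuousAt.continuousWithinAt
  refine C.eqOn_of_toGL_eq R isPreconnected_Icc
    (f := fun t => C.expT R (u t • f) * C.expT R (v t • h) * C.expT R (z t • e))
    (g := fun t => C.expT R (t • (x₁ • h + x₂ • e + x₃ • f))) ?_ ?_ (fun s hs => ?_)
    (t₀ := 0) ⟨le_rfl, hT.1.trans hT.2⟩ ?_ hT
  · exact (((C.continuous_expT_smul R f).comp_continuousOn hu).mul
      ((C.continuous_expT_smul R h).comp_continuousOn hv)).mul
      ((C.continuous_expT_smul R e).comp_continuousOn hz)
  · exact (C.continuous_expT_smul R _).continuousOn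
  · apply Units.ext
    simp only [map_mul, Units.val_mul, C.toGL_expT]
    exact Matrix.exp_gaussCurve H hef he hf hs
  · simp [H.u_zero, H.v_zero, H.z_zero]

theorem expT_pi_div_two (ht : IsSl2Triple h e f) :
    C.expT R ((Real.pi / 2) • (e - f)) = C.weylT R e f := by
  have h1 := C.expT_gaussCurve R ht isGaussCurve_rotation (t := Real.pi / 4)
    ⟨by positivity, le_rfl⟩
  -- At `t = π/4` the Gauss coordinates of the rotation are `-1`, `log cos(π/4)`, `1`, and
  -- `cos²(π/4) = 1/2` gives `exp(2l) = 2`. The square of that rotation is the Weyl element.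
  have h2 := (C.sl2Relations_expT R ht).y_mul_a_mul_x_sq (-Real.log (Real.cos (Real.pi / 4))) (by
    rw [mul_neg, Real.exp_neg, mul_comm, Real.exp_mul, Real.exp_log (by rw [Real.cos_pi_div_four]; positivity),
      Real.cos_pi_div_four]
    norm_num [div_pow])
  simp only [neg_neg] at h2
  simp only [Real.tan_pi_div_four] at h1
  rw [h1, ← C.expT_add_smul] at h2
  rw [← h2]
  congr 1
  module

theorem expT_two_pi (ht : IsSl2Triple h e f) :
    C.expT R ((2 * Real.pi) • (e - f)) = C.weylT R e f ^ 4 := by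
  rw [← C.expT_pi_div_two R ht, pow_succ, pow_succ, pow_two, ← C.expT_add_smul, ← C.expT_add_smul,
    ← C.expT_add_smul]
  congr 2
  ring

theorem expT_two_pi_eq_one_or_neg (ht : IsSl2Triple h e f) :
    C.expT R ((2 * Real.pi) • (e - f)) = 1 ∨ C.expT R ((2 * Real.pi) • (e - f)) = C.neg := by
  obtain ⟨hef, he, hf⟩ := triple_matrix R ht
  exact C.expT_eq_one_or_neg R (Matrix.exp_two_pi_smul_e_sub_f hef he hf)

theorem expT_nsmul (X : R.g₀) (k : ℕ) : C.expT R ((k : ℝ) • X) = C.expT R X ^ k := by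
  induction k with
  | zero => simp
  | succ k ih => rw [Nat.cast_succ, C.expT_add_smul, ih, one_smul, pow_succ]

/-- The subgroup of the covering group generated by the root subgroups of an `𝔰𝔩₂`-triple. -/
def rootGroup (e f : R.g₀) : Subgroup Gt :=
  Subgroup.closure (Set.range (fun t : ℝ => C.expT R (t • e)) ∪
    Set.range (fun t : ℝ => C.expT R (t • f)))

theorem expT_e_mem (t : ℝ) : C.expT R (t • e) ∈ C.rootGroup R e f :=
  Subgroup.subset_closure (Or.inl ⟨t, rfl⟩)

theorem expT_f_mem (t : ℝ) : C.expT R (t • f) ∈ C.rootGroup R e f :=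
  Subgroup.subset_closure (Or.inr ⟨t, rfl⟩)

theorem weylT_mem : C.weylT R e f ∈ C.rootGroup R e f := by
  have h1 := C.expT_e_mem R (e := e) (f := f) 1
  have h2 := C.expT_f_mem R (e := e) (f := f) (-1)
  rw [one_smul] at h1
  rw [neg_one_smul] at h2
  exact mul_mem (mul_mem h1 h2) h1

theorem expT_h_mem (ht : IsSl2Triple h e f) (t : ℝ) :
    C.expT R (t • h) ∈ C.rootGroup R e f := by
  have h1 := (C.sl2Relations_expT R ht).x_mul_y_mul_x (Real.exp_pos t)
  rw [Real.log_exp, ← mul_inv_eq_iff_eq_mul] at h1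
  rw [← h1]
  exact mul_mem (mul_mem (mul_mem (C.expT_e_mem R _) (C.expT_f_mem R _)) (C.expT_e_mem R _))
    (inv_mem (C.weylT_mem R))

/-- Gauss coordinates reach only short exponentials; an arbitrary one is a power of a short one. -/
theorem expT_mem_rootGroup (ht : IsSl2Triple h e f) (x₁ x₂ x₃ : ℝ) :
    C.expT R (x₁ • h + x₂ • e + x₃ • f) ∈ C.rootGroup R e f := by
  obtain ⟨T, hT, u, v, z, H⟩ := exists_isGaussCurve x₁ x₂ x₃
  obtain ⟨k, hk⟩ := exists_nat_one_div_lt hT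
  have h1 := C.expT_gaussCurve R ht H (t := 1 / ((k : ℝ) + 1)) ⟨by positivity, hk.le⟩
  have h2 : C.expT R (x₁ • h + x₂ • e + x₃ • f) =
      C.expT R ((1 / ((k : ℝ) + 1)) • (x₁ • h + x₂ • e + x₃ • f)) ^ (k + 1) := by
    rw [← C.expT_nsmul, smul_smul]
    push_cast
    rw [mul_one_div_cancel (by positivity), one_smul]
  rw [h2, ← h1]
  exact pow_mem (mul_mem (mul_mem (C.expT_f_mem R _) (C.expT_h_mem R ht _)) (C.expT_e_mem R _)) _

end TwoFoldCover

/-! ### Linearity of the root group when `exp(2π(e - f)) = 1`. -/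

section NonlinearCriterion

/-- Values in a matrix monoid over any finite index type suffice, because a homomorphism from a
group lands in the units. This suits block sums. -/
theorem not_isNonlinearGroup_of_hom {S : Type*} [Group S] [TopologicalSpace S]
    [IsTopologicalGroup S] {ι : Type*} [Fintype ι] [DecidableEq ι] (f : S →* Matrix ι ι ℂ)
    (hf : Continuous f) (hinj : Function.Injective f) : ¬ IsNonlinearGroup S := by
  intro h
  let φ : Matrix ι ι ℂ ≃ₐ[ℂ] Matrix (Fin (Fintype.card ι)) (Fin (Fintype.card ι)) ℂ :=
    Matrix.reindexAlgEquiv ℂ ℂ (Fintype.equivFin ι)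
  let g : S →* Matrix (Fin (Fintype.card ι)) (Fin (Fintype.card ι)) ℂ :=
    (φ : Matrix ι ι ℂ →* Matrix (Fin (Fintype.card ι)) (Fin (Fintype.card ι)) ℂ).comp f
  have hg : Continuous g := Continuous.matrix_reindex hf _ _
  have hgi : Function.Injective g := φ.injective.comp hinj
  refine h ⟨Fintype.card ι, g.toHomUnits, ?_, ?_⟩
  · rw [Units.continuous_iff]
    exact ⟨hg, hg.comp continuous_inv⟩
  · intro x y hxy
    exact hgi (congrArg Units.val hxy)

end NonlinearCriterion

namespace TwoFoldCover

variable (R : RealReductiveLinear G n) (C : TwoFoldCover G Gt) {h e f : R.g₀}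

/-- The graph of the local homomorphism from `SL(2, ℝ)` to the covering group. -/
def sl2Graph (e f : R.g₀) : Subgroup (Matrix.SpecialLinearGroup (Fin 2) ℝ × Gt) :=
  Subgroup.closure (Set.range (fun t : ℝ => (sl2X t, C.expT R (t • e))) ∪
    Set.range (fun t : ℝ => (sl2Y t, C.expT R (t • f))))

theorem sl2Graph_X (t : ℝ) : (sl2X t, C.expT R (t • e)) ∈ C.sl2Graph R e f :=
  Subgroup.subset_closure (Or.inl ⟨t, rfl⟩)

theorem sl2Graph_Y (t : ℝ) : (sl2Y t, C.expT R (t • f)) ∈ C.sl2Graph R e f :=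
  Subgroup.subset_closure (Or.inr ⟨t, rfl⟩)

theorem sl2Graph_W : (sl2W, C.weylT R e f) ∈ C.sl2Graph R e f := by
  have h1 := C.sl2Graph_X R (e := e) (f := f) 1
  have h2 := C.sl2Graph_Y R (e := e) (f := f) (-1)
  have h3 := mul_mem (mul_mem h1 h2) h1
  rw [Prod.mk_mul_mk, Prod.mk_mul_mk, ← sl2Relations.w_eq] at h3
  simpa [weylT] using h3

theorem sl2Graph_A (ht : IsSl2Triple h e f) (t : ℝ) :
    (sl2A t, C.expT R (t • h)) ∈ C.sl2Graph R e f := by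
  have h1 := (sl2Relations.prod (C.sl2Relations_expT R ht)).x_mul_y_mul_x (Real.exp_pos t)
  rw [Real.log_exp, ← mul_inv_eq_iff_eq_mul] at h1
  rw [← h1]
  exact mul_mem (mul_mem (mul_mem (C.sl2Graph_X R _) (C.sl2Graph_Y R _)) (C.sl2Graph_X R _))
    (inv_mem (C.sl2Graph_W R))

theorem exists_sl2Graph_of_mem {x : Gt} (hx : x ∈ C.rootGroup R e f) :
    ∃ s, (s, x) ∈ C.sl2Graph R e f := by
  have : C.rootGroup R e f = (C.sl2Graph R e f).map (MonoidHom.snd _ _) := by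
    rw [rootGroup, sl2Graph, MonoidHom.map_closure, Set.image_union, ← Set.range_comp,
      ← Set.range_comp]
    rfl
  rw [this] at hx
  obtain ⟨⟨s, _⟩, h, rfl⟩ := hx
  exact ⟨s, h⟩

/-- If the fourth power of the Weyl group element is trivial then the elements of the graph are
determined by their components in `SL(2, ℝ)`. -/
theorem eq_one_of_sl2Graph (ht : IsSl2Triple h e f) (hw : C.weylT R e f ^ 4 = 1) {x : Gt}
    (hx : (1, x) ∈ C.sl2Graph R e f) : x = 1 := by
  have H := C.sl2Relations_expT R ht
  obtain ⟨s, i, u, t, h1⟩ := (sl2Relations.prod H).exists_eq_of_mem_closure hx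
  have h2 := congrArg Prod.fst h1
  have h3 := congrArg Prod.snd h1
  simp only [Prod.fst_mul, Prod.snd_mul, Prod.pow_fst, Prod.pow_snd] at h2 h3
  -- The parameters are forced by the component in SL(2, ℝ); the only freedom left in the cover is a
  -- power of `w ^ 4`.
  obtain ⟨⟨k, rfl⟩, rfl, rfl⟩ := sl2_bruhat_eq_one h2.symm
  rw [h3, zpow_mul, show C.weylT R e f ^ (4 : ℤ) = 1 by exact_mod_cast hw, one_zpow, zero_smul,
    expT_zero, mul_one, mul_one, ← C.expT_add_smul, add_neg_cancel, zero_smul, expT_zero]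

theorem eq_of_sl2Graph (ht : IsSl2Triple h e f) (hw : C.weylT R e f ^ 4 = 1)
    {s : Matrix.SpecialLinearGroup (Fin 2) ℝ} {x y : Gt}
    (hx : (s, x) ∈ C.sl2Graph R e f) (hy : (s, y) ∈ C.sl2Graph R e f) : x = y := by
  have h1 := mul_mem (inv_mem hy) hx
  rw [Prod.inv_mk, Prod.mk_mul_mk, inv_mul_cancel] at h1
  exact (inv_mul_eq_one.1 (C.eq_one_of_sl2Graph R ht hw h1)).symm

/-- The image in the matrix Lie algebra of a trace zero matrix under an `𝔰𝔩₂`-triple. -/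
def tripleMap (h e f : R.g₀) (M : Matrix (Fin 2) (Fin 2) ℝ) : Matrix (Fin n) (Fin n) ℝ :=
  M 0 0 • h.1 + M 0 1 • e.1 + M 1 0 • f.1

/-- Equivariance of the linear map attached to the triple. It holds for the two families of
generators and passes to products and inverses, so the adjoint action of a graph element on the
triple depends only on its component `s`. -/
theorem toGL_mul_tripleMap (ht : IsSl2Triple h e f)
    {s : Matrix.SpecialLinearGroup (Fin 2) ℝ} {x : Gt} (hx : (s, x) ∈ C.sl2Graph R e f) :
    ∀ M : Matrix (Fin 2) (Fin 2) ℝ, M 1 1 = - M 0 0 →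
      (C.toGL R x).val * tripleMap R h e f M =
        tripleMap R h e f (s.1 * M * (s⁻¹).1) * (C.toGL R x).val := by
  obtain ⟨hef, he, hf⟩ := triple_matrix R ht
  have htr (s : Matrix.SpecialLinearGroup (Fin 2) ℝ) (M : Matrix (Fin 2) (Fin 2) ℝ)
      (hM : M 1 1 = - M 0 0) : (s.1 * M * (s⁻¹).1) 1 1 = - (s.1 * M * (s⁻¹).1) 0 0 := by
    rw [Matrix.SpecialLinearGroup.coe_inv, Matrix.adjugate_fin_two]
    simp only [Matrix.mul_apply, Fin.sum_univ_two, hM, Matrix.of_apply, Matrix.cons_val',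
      Matrix.cons_val_zero, Matrix.cons_val_one, Matrix.cons_val_fin_one]
    ring
  suffices H : ∀ q ∈ C.sl2Graph R e f, ∀ M : Matrix (Fin 2) (Fin 2) ℝ, M 1 1 = - M 0 0 →
      (C.toGL R q.2).val * tripleMap R h e f M =
        tripleMap R h e f (q.1.1 * M * (q.1⁻¹).1) * (C.toGL R q.2).val from H _ hx
  intro q hq
  induction hq using Subgroup.closure_induction with
  | mem q hq =>
    intro M hM
    rcases hq with ⟨t, rfl⟩ | ⟨t, rfl⟩
    · have c1 := Matrix.exp_smul_e_mul_h he t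
      have c2 := Matrix.exp_smul_e_mul_f hef he t
      have c3 : NormedSpace.exp (t • e.1) * e.1 = e.1 * NormedSpace.exp (t • e.1) :=
        (((Commute.refl e.1).smul_left t).exp_left).eq
      rw [C.toGL_expT]
      show NormedSpace.exp (t • e.1) * _ = _ * NormedSpace.exp (t • e.1)
      rw [tripleMap, mul_add, mul_add, mul_smul_comm, mul_smul_comm, mul_smul_comm, c1, c2, c3,
        ← smul_mul_assoc, ← smul_mul_assoc, ← smul_mul_assoc, ← add_mul, ← add_mul]
      congr 1
      rw [tripleMap, Matrix.SpecialLinearGroup.coe_inv, Matrix.adjugate_fin_two, coe_sl2X]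
      simp only [Matrix.mul_apply, Fin.sum_univ_two, hM, Matrix.of_apply, Matrix.cons_val',
        Matrix.cons_val_zero, Matrix.cons_val_one, Matrix.cons_val_fin_one]
      module
    · have c1 := Matrix.exp_smul_f_mul_h hf t
      have c2 := Matrix.exp_smul_f_mul_e hef hf t
      have c3 : NormedSpace.exp (t • f.1) * f.1 = f.1 * NormedSpace.exp (t • f.1) :=
        (((Commute.refl f.1).smul_left t).exp_left).eq
      rw [C.toGL_expT]
      show NormedSpace.exp (t • f.1) * _ = _ * NormedSpace.exp (t • f.1)
      rw [tripleMap, mul_add, mul_add, mul_smul_comm, mul_smul_comm, mul_smul_comm, c1, c2, c3,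
        ← smul_mul_assoc, ← smul_mul_assoc, ← smul_mul_assoc, ← add_mul, ← add_mul]
      congr 1
      rw [tripleMap, Matrix.SpecialLinearGroup.coe_inv, Matrix.adjugate_fin_two, coe_sl2Y]
      simp only [Matrix.mul_apply, Fin.sum_univ_two, hM, Matrix.of_apply, Matrix.cons_val',
        Matrix.cons_val_zero, Matrix.cons_val_one, Matrix.cons_val_fin_one]
      module
  | one => intro M hM; simp
  | mul q r _ _ hq hr =>
    intro M hM
    rw [Prod.snd_mul, map_mul, Units.val_mul, mul_assoc, hr M hM, ← mul_assoc, hq _ (htr _ _ hM),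
      mul_assoc, Prod.fst_mul, mul_inv_rev]
    simp only [Matrix.SpecialLinearGroup.coe_mul, mul_assoc]
  | inv q _ hq =>
    intro M hM
    have h1 := hq _ (htr q.1⁻¹ M hM)
    have h2 : q.1.1 * ((q.1⁻¹).1 * M * (q.1⁻¹⁻¹).1) * (q.1⁻¹).1 = M := by
      have h3 : q.1.1 * (q.1⁻¹).1 = 1 := by
        rw [← Matrix.SpecialLinearGroup.coe_mul, mul_inv_cancel]; rfl
      rw [inv_inv, mul_assoc, mul_assoc, h3, mul_one, ← mul_assoc, h3, one_mul]
    rw [h2] at h1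
    rw [Prod.fst_inv, Prod.snd_inv, map_inv, Units.inv_mul_eq_iff_eq_mul, ← mul_assoc, h1, mul_assoc,
      Units.mul_inv, mul_one]

/-- Coordinates on the span of an `𝔰𝔩₂`-triple in the space of matrices. -/
theorem exists_triple_coord (ht : IsSl2Triple h e f) :
    ∃ ξ : Matrix (Fin n) (Fin n) ℝ →ₗ[ℝ] (Fin 3 → ℝ), Continuous ξ ∧
      ∀ a b c : ℝ, ξ (a • h.1 + b • e.1 + c • f.1) = ![a, b, c] := by
  let Ψ : (Fin 3 → ℝ) →ₗ[ℝ] Matrix (Fin n) (Fin n) ℝ :=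
    Fintype.linearCombination ℝ ![h.1, e.1, f.1]
  have hΨ (a b c : ℝ) : Ψ ![a, b, c] = a • h.1 + b • e.1 + c • f.1 := by
    simp [Ψ, Fintype.linearCombination_apply, Fin.sum_univ_three]
  have hinj : LinearMap.ker Ψ = ⊥ := by
    rw [LinearMap.ker_eq_bot']
    intro v hv
    have hv3 : v = ![v 0, v 1, v 2] := by
      ext i; fin_cases i <;> rfl
    rw [hv3, hΨ] at hv
    have h0 : v 0 • h + v 1 • e + v 2 • f = 0 := Subtype.ext hv
    have heh : ⁅e, h⁆ = -((2 : ℝ) • e) := by rw [← lie_skew, ht.lie_h_e_smul ℝ]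
    -- One bracket with `e` removes the coefficient of `e`; a second one isolates that of `f`.
    have h1 : -(2 * v 0) • e + v 2 • h = 0 := by
      have := congrArg (⁅e, ·⁆) h0
      simp only [lie_add, lie_smul, lie_self, ht.lie_e_f, heh, lie_zero, smul_zero, add_zero] at this
      rw [← this]; module
    have h2 : -(2 * v 2) • e = 0 := by
      have := congrArg (⁅e, ·⁆) h1
      simp only [lie_add, lie_smul, lie_self, heh, lie_zero, smul_zero, zero_add] at this
      rw [← this]; module
    have hc : v 2 = 0 := by
      have := (smul_eq_zero.1 h2).resolve_right ht.e_ne_zero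
      linarith
    rw [hc, zero_smul, add_zero] at h1 h0
    have ha : v 0 = 0 := by
      have := (smul_eq_zero.1 h1).resolve_right ht.e_ne_zero
      linarith
    rw [ha, zero_smul, zero_add] at h0
    have hb : v 1 = 0 := (smul_eq_zero.1 h0).resolve_right ht.e_ne_zero
    rw [hv3, ha, hb, hc]
    ext i; fin_cases i <;> rfl
  obtain ⟨ξ, hξ⟩ := LinearMap.exists_leftInverse_of_injective Ψ hinj
  refine ⟨ξ, ξ.continuous_of_finiteDimensional, fun a b c => ?_⟩
  rw [← hΨ]
  exact LinearMap.congr_fun hξ _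

end TwoFoldCover

theorem continuous_sl2X : Continuous sl2X :=
  Continuous.subtype_mk (continuous_matrix fun i j => by
    fin_cases i <;> fin_cases j <;> simp <;> fun_prop) _

theorem continuous_sl2Y : Continuous sl2Y :=
  Continuous.subtype_mk (continuous_matrix fun i j => by
    fin_cases i <;> fin_cases j <;> simp <;> fun_prop) _

theorem continuous_sl2A : Continuous sl2A :=
  Continuous.subtype_mk (continuous_matrix fun i j => by
    fin_cases i <;> fin_cases j <;> simp <;> fun_prop) _

theorem sl2_eq_gauss {s : Matrix.SpecialLinearGroup (Fin 2) ℝ} (ha : 0 < s.1 0 0) :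
    s = sl2Y (s.1 1 0 / s.1 0 0) * sl2A (Real.log (s.1 0 0)) * sl2X (s.1 0 1 / s.1 0 0) := by
  have hdet := s.2
  rw [Matrix.det_fin_two] at hdet
  apply sl2_ext <;> simp [Real.exp_neg, Real.exp_log ha]
  · field_simp
  · field_simp
  · field_simp
    linear_combination hdet

namespace TwoFoldCover

variable (R : RealReductiveLinear G n) (C : TwoFoldCover G Gt) {h e f : R.g₀}

/-- The adjoint action of the covering group on the matrix Lie algebra. -/
def adT (x : Gt) (X : Matrix (Fin n) (Fin n) ℝ) : Matrix (Fin n) (Fin n) ℝ :=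
  (C.toGL R x).val * X * (C.toGL R x⁻¹).val

theorem continuous_adT (X : Matrix (Fin n) (Fin n) ℝ) : Continuous fun x => C.adT R x X :=
  ((Units.continuous_val.comp (C.continuous_toGL R)).mul continuous_const).mul
    (Units.continuous_val.comp ((C.continuous_toGL R).comp continuous_inv))

theorem adT_one (X : Matrix (Fin n) (Fin n) ℝ) : C.adT R 1 X = X := by simp [adT]

theorem adT_mul (x y : Gt) (X : Matrix (Fin n) (Fin n) ℝ) :
    C.adT R (x * y) X = C.adT R x (C.adT R y X) := by
  simp [adT, mul_assoc]

theorem adT_neg (X : Matrix (Fin n) (Fin n) ℝ) : C.adT R C.neg X = X := by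
  simp [adT, C.toGL_neg]

/-- Together with `adT_f`, this makes the entries of `s` visible, up to sign, in the adjoint action.
That action is continuous on the cover, whereas `s` itself is not known in advance to depend
continuously on `x`. -/
theorem adT_e (ht : IsSl2Triple h e f) {s : Matrix.SpecialLinearGroup (Fin 2) ℝ} {x : Gt}
    (hx : (s, x) ∈ C.sl2Graph R e f) :
    C.adT R x e.1 = (-(s.1 0 0 * s.1 1 0)) • h.1 + (s.1 0 0 ^ 2) • e.1 + (-s.1 1 0 ^ 2) • f.1 := by
  have h1 := C.toGL_mul_tripleMap R ht hx !![0, 1; 0, 0] (by simp)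
  have h2 : tripleMap R h e f !![0, 1; 0, 0] = e.1 := by simp [tripleMap]
  rw [h2] at h1
  rw [adT, map_inv, h1, mul_assoc, Units.mul_inv, mul_one, tripleMap,
    Matrix.SpecialLinearGroup.coe_inv, Matrix.adjugate_fin_two]
  simp only [Matrix.mul_apply, Fin.sum_univ_two, Matrix.of_apply, Matrix.cons_val',
    Matrix.cons_val_zero, Matrix.cons_val_one, Matrix.cons_val_fin_one]
  module

theorem adT_f (ht : IsSl2Triple h e f) {s : Matrix.SpecialLinearGroup (Fin 2) ℝ} {x : Gt}
    (hx : (s, x) ∈ C.sl2Graph R e f) :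
    C.adT R x f.1 = (s.1 0 1 * s.1 1 1) • h.1 + (-s.1 0 1 ^ 2) • e.1 + (s.1 1 1 ^ 2) • f.1 := by
  have h1 := C.toGL_mul_tripleMap R ht hx !![0, 0; 1, 0] (by simp)
  have h2 : tripleMap R h e f !![0, 0; 1, 0] = f.1 := by simp [tripleMap]
  rw [h2] at h1
  rw [adT, map_inv, h1, mul_assoc, Units.mul_inv, mul_one, tripleMap,
    Matrix.SpecialLinearGroup.coe_inv, Matrix.adjugate_fin_two]
  simp only [Matrix.mul_apply, Fin.sum_univ_two, Matrix.of_apply, Matrix.cons_val',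
    Matrix.cons_val_zero, Matrix.cons_val_one, Matrix.cons_val_fin_one]
  module

theorem eq_one_or_of_adT (ht : IsSl2Triple h e f) {s : Matrix.SpecialLinearGroup (Fin 2) ℝ}
    {x : Gt} (hx : (s, x) ∈ C.sl2Graph R e f) (he : C.adT R x e.1 = e.1)
    (hf : C.adT R x f.1 = f.1) : s = 1 ∨ s = -1 := by
  obtain ⟨ξ, -, hξ⟩ := exists_triple_coord R ht
  have h1 := congrArg ξ he
  have h2 := congrArg ξ hf
  rw [C.adT_e R ht hx, hξ, show e.1 = (0 : ℝ) • h.1 + (1 : ℝ) • e.1 + (0 : ℝ) • f.1 by simp, hξ] at h1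
  rw [C.adT_f R ht hx, hξ, show f.1 = (0 : ℝ) • h.1 + (0 : ℝ) • e.1 + (1 : ℝ) • f.1 by simp, hξ] at h2
  have ha : s.1 0 0 ^ 2 = 1 := by simpa using congrFun h1 1
  have hc : s.1 1 0 = 0 := by simpa using congrFun h1 2
  have hb : s.1 0 1 = 0 := by simpa using congrFun h2 1
  have hdet := s.2
  rw [Matrix.det_fin_two, hc, mul_zero, sub_zero] at hdet
  rcases (mul_self_eq_one_iff (a := s.1 0 0)).1 (by rw [← pow_two]; exact ha) with ha | ha
  all_goals rw [ha] at hdet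
  · left
    apply sl2_ext <;> simp [ha, hb, hc]
    linarith
  · right
    apply sl2_ext <;> simp [ha, hb, hc]
    linarith

/-- Elements of the graph whose adjoint action is near the identity are near the identity,
up to sign. -/
theorem eventually_sl2Graph (ht : IsSl2Triple h e f) (hw : C.weylT R e f ^ 4 = 1)
    {U : Set (Matrix.SpecialLinearGroup (Fin 2) ℝ × Gt)} (hU : U ∈ nhds 1) :
    ∀ᶠ x in nhds (1 : Gt), ∀ s x', (s, x') ∈ C.sl2Graph R e f → C.adT R x' e.1 = C.adT R x e.1 →
      C.adT R x' f.1 = C.adT R x f.1 → s.1 0 0 ≠ 0 ∧ (0 < s.1 0 0 → (s, x') ∈ U) := by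
  obtain ⟨ξ, hξc, hξ⟩ := exists_triple_coord R ht
  -- A local parametrization of the graph by Gauss coordinates, continuous at the identity.
  let κ : ℝ × ℝ × ℝ → Matrix.SpecialLinearGroup (Fin 2) ℝ × Gt := fun q =>
    (sl2Y (q.2.2 / q.1), C.expT R ((q.2.2 / q.1) • f)) *
      (sl2A (Real.log q.1), C.expT R (Real.log q.1 • h)) *
      (sl2X (q.2.1 / q.1), C.expT R ((q.2.1 / q.1) • e))
  have hκ1 : κ (1, 0, 0) = 1 := by
    simp [κ, sl2Relations.x_zero, sl2Relations.y_zero, sl2Relations.a_zero]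
  have hκ : ContinuousAt κ (1, 0, 0) := by
    have c1 : ContinuousAt (fun q : ℝ × ℝ × ℝ => q.2.2 / q.1) (1, 0, 0) :=
      continuousAt_snd.snd.div continuousAt_fst one_ne_zero
    have c2 : ContinuousAt (fun q : ℝ × ℝ × ℝ => Real.log q.1) (1, 0, 0) :=
      continuousAt_fst.log one_ne_zero
    have c3 : ContinuousAt (fun q : ℝ × ℝ × ℝ => q.2.1 / q.1) (1, 0, 0) :=
      continuousAt_snd.fst.div continuousAt_fst one_ne_zero
    refine ContinuousAt.mul (ContinuousAt.mul ?_ ?_) ?_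
    · exact ((continuous_sl2Y.prodMk (C.continuous_expT_smul R f)).continuousAt).comp c1
    · exact ((continuous_sl2A.prodMk (C.continuous_expT_smul R h)).continuousAt).comp c2
    · exact ((continuous_sl2X.prodMk (C.continuous_expT_smul R e)).continuousAt).comp c3
  rw [← hκ1] at hU
  obtain ⟨δ, hδ, hball⟩ := Metric.mem_nhds_iff.1 (hκ hU)
  have k1 : Continuous fun x => ξ (C.adT R x e.1) := hξc.comp (C.continuous_adT R _)
  have k2 : Continuous fun x => ξ (C.adT R x f.1) := hξc.comp (C.continuous_adT R _)
  have v1 : ξ (C.adT R 1 e.1) = ![0, 1, 0] := by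
    rw [adT_one, ← hξ 0 1 0]; simp
  have v2 : ξ (C.adT R 1 f.1) = ![0, 0, 1] := by
    rw [adT_one, ← hξ 0 0 1]; simp
  -- For a graph element with entries `a, b, c, d` these three coordinates are `a²`, `-c²` and
  -- `-b²`.
  have E1 : ∀ᶠ x in nhds (1 : Gt), |ξ (C.adT R x e.1) 1 - 1| < min δ 1 := by
    have : Continuous fun x => |ξ (C.adT R x e.1) 1 - 1| :=
      (((continuous_apply 1).comp k1).sub continuous_const).abs
    refine this.continuousAt.eventually (gt_mem_nhds ?_)
    beta_reduce; rw [v1]; simpa using hδ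
  have E2 : ∀ᶠ x in nhds (1 : Gt), |ξ (C.adT R x e.1) 2| < δ ^ 2 := by
    have : Continuous fun x => |ξ (C.adT R x e.1) 2| := ((continuous_apply 2).comp k1).abs
    refine this.continuousAt.eventually (gt_mem_nhds ?_)
    beta_reduce; rw [v1]; simpa using pow_pos hδ 2
  have E3 : ∀ᶠ x in nhds (1 : Gt), |ξ (C.adT R x f.1) 1| < δ ^ 2 := by
    have : Continuous fun x => |ξ (C.adT R x f.1) 1| := ((continuous_apply 1).comp k2).abs
    refine this.continuousAt.eventually (gt_mem_nhds ?_)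
    beta_reduce; rw [v2]; simpa using pow_pos hδ 2
  filter_upwards [E1, E2, E3] with x h1 h2 h3 s x' hx he hf
  rw [← he, C.adT_e R ht hx, hξ] at h1 h2
  rw [← hf, C.adT_f R ht hx, hξ] at h3
  simp only [Matrix.cons_val_one, Matrix.cons_val_zero, Matrix.cons_val] at h1 h2 h3
  rw [abs_neg, abs_pow, pow_lt_pow_iff_left₀ (abs_nonneg _) hδ.le two_ne_zero] at h2 h3
  rw [lt_min_iff] at h1
  refine ⟨fun h0 => ?_, fun hpos => ?_⟩
  · rw [h0] at h1
    norm_num at h1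
  · have ha : |s.1 0 0 - 1| < δ := by
      -- As `a > 0`, the factor `a + 1` in `a² - 1` only increases the absolute value.
      refine lt_of_le_of_lt ?_ h1.1
      have : s.1 0 0 ^ 2 - 1 = (s.1 0 0 - 1) * (s.1 0 0 + 1) := by ring
      rw [this, abs_mul]
      refine le_mul_of_one_le_right (abs_nonneg _) ?_
      rw [abs_of_pos (by linarith)]
      linarith
    have hmem : κ (s.1 0 0, s.1 0 1, s.1 1 0) ∈ U := by
      apply hball
      rw [Metric.mem_ball, Prod.dist_eq, Prod.dist_eq]
      simp only [Real.dist_eq, sub_zero]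
      exact max_lt ha (max_lt h3 h2)
    have hg : κ (s.1 0 0, s.1 0 1, s.1 1 0) ∈ C.sl2Graph R e f :=
      mul_mem (mul_mem (C.sl2Graph_Y R _) (C.sl2Graph_A R ht _)) (C.sl2Graph_X R _)
    have hs : (κ (s.1 0 0, s.1 0 1, s.1 1 0)).1 = s := (sl2_eq_gauss hpos).symm
    have hq : ∀ q ∈ C.sl2Graph R e f, q.1 = s → (s, x') = q := by
      rintro ⟨_, y⟩ hq rfl
      rw [C.eq_of_sl2Graph R ht hw hx hq]
    -- The component in SL(2, ℝ) determines the graph element, so `x'` is the value of `κ`.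
    rwa [hq _ hg hs]

/-- In a Hausdorff group a fixed `g ≠ 1` moves all small elements away from 1; this is how the sign
of an element near 1 is recognized. -/
theorem eventually_mul_notMem {g : Gt} (hg : g ≠ 1) :
    ∃ U ∈ nhds (1 : Gt), ∀ x ∈ U, g * x ∉ U := by
  obtain ⟨V, W, hV, hW, h1, h2, hd⟩ := t2_separation hg
  refine ⟨W ∩ (fun x => g * x) ⁻¹' V, Filter.inter_mem (hW.mem_nhds h2)
    ((continuous_const_mul g).continuousAt.preimage_mem_nhds (hV.mem_nhds (by simpa using h1))), ?_⟩
  intro x hx hx'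
  exact Set.disjoint_left.1 hd hx.2 hx'.1

end TwoFoldCover

namespace TwoFoldCover

variable (R : RealReductiveLinear G n) (C : TwoFoldCover G Gt) {h e f : R.g₀}

theorem sl2Graph_neg {s : Matrix.SpecialLinearGroup (Fin 2) ℝ} {x : Gt}
    (hx : (s, x) ∈ C.sl2Graph R e f) : (-s, C.weylT R e f ^ 2 * x) ∈ C.sl2Graph R e f := by
  have h1 := mul_mem (pow_mem (C.sl2Graph_W R (e := e) (f := f)) 2) hx
  rwa [Prod.pow_mk, Prod.mk_mul_mk, sl2W_pow_two, neg_one_mul] at h1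

theorem eventually_sl2Graph_or (ht : IsSl2Triple h e f) (hw : C.weylT R e f ^ 4 = 1)
    {U : Set (Matrix.SpecialLinearGroup (Fin 2) ℝ × Gt)} (hU : U ∈ nhds 1) :
    ∀ᶠ x in nhds (1 : Gt), ∀ s x', (s, x') ∈ C.sl2Graph R e f → C.adT R x' e.1 = C.adT R x e.1 →
      C.adT R x' f.1 = C.adT R x f.1 → (s, x') ∈ U ∨ (-s, C.weylT R e f ^ 2 * x') ∈ U := by
  filter_upwards [C.eventually_sl2Graph R ht hw hU] with x hx s x' hs he hf
  obtain ⟨h0, h1⟩ := hx s x' hs he hf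
  rcases lt_or_gt_of_ne h0 with h2 | h2
  · right
    have hs' := C.sl2Graph_neg R hs
    have he' : C.adT R (C.weylT R e f ^ 2 * x') e.1 = C.adT R x e.1 := by
      rw [← he, C.adT_e R ht hs, C.adT_e R ht hs']
      simp
    have hf' : C.adT R (C.weylT R e f ^ 2 * x') f.1 = C.adT R x f.1 := by
      rw [← hf, C.adT_f R ht hs, C.adT_f R ht hs']
      simp
    refine (hx _ _ hs' he' hf').2 ?_
    simpa using h2
  · exact Or.inl (h1 h2)

/-- If the root group is linear and `-1` is not in it, then its product with `{1, -1}` is linear. -/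
theorem not_isNonlinearGroup_of_notMem (ht : IsSl2Triple h e f) (hw : C.weylT R e f ^ 4 = 1)
    (hneg : C.neg ∉ C.rootGroup R e f) (M : Subgroup Gt)
    (hM : ∀ x ∈ M, x ∈ C.rootGroup R e f ∨ C.neg * x ∈ C.rootGroup R e f) :
    ¬ IsNonlinearGroup M := by
  classical
  set S := C.rootGroup R e f with hS
  have hiff {x : Gt} (hx : C.neg * x ∈ S) : x ∉ S := fun h => hneg (by
    simpa using mul_mem hx (inv_mem h))
  -- The sign of an element relative to the root group `S`, well defined since -1 is not in `S`.
  let χ : M →* ℂ :=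
    { toFun := fun x => if (x : Gt) ∈ S then 1 else -1
      map_one' := if_pos (one_mem S)
      map_mul' := fun x y => by
        have hcomm : C.neg * ((x : Gt) * y) = x * (C.neg * y) := by
          rw [← mul_assoc, C.neg_central, mul_assoc]
        rcases hM x x.2 with hx | hx <;> rcases hM y y.2 with hy | hy
        · simp [hx, hy, mul_mem hx hy]
        · have h1 : (x : Gt) * y ∉ S := hiff (by rw [hcomm]; exact mul_mem hx hy)
          simp [hx, hiff hy, h1]
        · have h1 : (x : Gt) * y ∉ S := hiff (by rw [← mul_assoc]; exact mul_mem hx hy)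
          simp [hiff hx, hy, h1]
        · have h1 : (x : Gt) * y ∈ S := by
            have := mul_mem hx hy
            rwa [mul_assoc, ← hcomm, ← mul_assoc C.neg C.neg, C.neg_mul_neg, one_mul] at this
          simp [hiff hx, hiff hy, h1] }
  have hχ : Continuous χ := by
    refine continuous_of_continuousAt_one χ ?_
    -- If `-x` belongs to `S` for a small `x`, then `-x` or `-w² x` must be small. Both are
    -- excluded, the second because `w` belongs to `S` and -1 does not.
    have hζ : C.weylT R e f ^ 2 * C.neg ≠ 1 := fun h => hneg (by
      have : C.neg = (C.weylT R e f ^ 2)⁻¹ := (inv_eq_of_mul_eq_one_right h).symm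
      rw [this]
      exact inv_mem (pow_mem (C.weylT_mem R) 2))
    obtain ⟨U₁, hU₁, h1⟩ := eventually_mul_notMem C.neg_ne_one
    obtain ⟨U₂, hU₂, h2⟩ := eventually_mul_notMem hζ
    have hU : (Set.univ ×ˢ (U₁ ∩ U₂) : Set (Matrix.SpecialLinearGroup (Fin 2) ℝ × Gt)) ∈ nhds 1 :=
      prod_mem_nhds Filter.univ_mem (Filter.inter_mem hU₁ hU₂)
    have key : ∀ᶠ x in nhds (1 : Gt), C.neg * x ∉ S := by
      filter_upwards [C.eventually_sl2Graph_or R ht hw hU, hU₁, hU₂] with x hx hx1 hx2 hxS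
      obtain ⟨s, hs⟩ := C.exists_sl2Graph_of_mem R hxS
      rcases hx s _ hs (by rw [adT_mul, adT_neg]) (by rw [adT_mul, adT_neg]) with h3 | h3
      · exact h1 x hx1 h3.2.1
      · refine h2 x hx2 ?_
        rw [mul_assoc]
        exact h3.2.2
    have key' : ∀ᶠ x in nhds (1 : M), χ x = 1 := by
      filter_upwards [continuous_subtype_val.continuousAt.eventually
        (show ∀ᶠ x in nhds ((1 : M) : Gt), C.neg * x ∉ S from key)] with x hx
      exact if_pos ((hM x x.2).resolve_right hx)
    exact (continuousAt_const (y := (1 : ℂ))).congr (key'.mono fun x hx => hx.symm)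
  let r : M →* Matrix (Fin n) (Fin n) ℂ :=
    ((Complex.ofRealHom.mapMatrix : Matrix (Fin n) (Fin n) ℝ →+* _) : _ →* _).comp
      ((Units.coeHom _).comp ((C.toGL R).comp M.subtype))
  have hr : Continuous r := by
    refine Continuous.matrix_map ?_ Complex.continuous_ofReal
    exact Units.continuous_val.comp ((C.continuous_toGL R).comp continuous_subtype_val)
  have hr1 (x : M) (hx : r x = 1) : (x : Gt) = 1 ∨ (x : Gt) = C.neg := by
    rw [← C.toGL_eq_one_iff (R := R)]
    apply Units.ext
    apply realToComplexMatrix_injective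
    rw [Units.val_one, realToComplexMatrix_one]
    exact hx
  -- The representation of `G` has kernel in `{1, -1}` here, and `χ` separates these two elements.
  let F : M →* Matrix (Fin n ⊕ Unit) (Fin n ⊕ Unit) ℂ :=
    { toFun := fun x => Matrix.fromBlocks (r x) 0 0 (Matrix.diagonal fun _ => χ x)
      map_one' := by simp
      map_mul' := fun x y => by simp [Matrix.fromBlocks_multiply] }
  refine not_isNonlinearGroup_of_hom F ?_ ?_
  · exact hr.matrix_fromBlocks continuous_const continuous_const
      (Continuous.matrix_diagonal (continuous_pi fun _ => hχ))
  · rw [injective_iff_map_eq_one]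
    intro x hx
    have h3 : Matrix.fromBlocks (r x) 0 0 (Matrix.diagonal fun _ : Unit => χ x) =
        Matrix.fromBlocks 1 0 0 1 := by rw [Matrix.fromBlocks_one]; exact hx
    rw [Matrix.fromBlocks_inj] at h3
    have h4 : χ x = 1 := by simpa using congrFun (congrFun h3.2.2.2 ()) ()
    rcases hr1 x h3.1 with h5 | h5
    · exact Subtype.ext h5
    · exfalso
      have : χ x = -1 := if_neg (by rw [h5]; exact hneg)
      rw [this] at h4
      norm_num at h4

/-- If the root group contains `-1` and `exp(2π(e - f)) = 1` then it is linear. -/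
theorem not_isNonlinearGroup_of_mem (ht : IsSl2Triple h e f) (hw : C.weylT R e f ^ 4 = 1)
    (hneg : C.neg ∈ C.rootGroup R e f) (M : Subgroup Gt)
    (hM : ∀ x ∈ M, x ∈ C.rootGroup R e f) : ¬ IsNonlinearGroup M := by
  have hζ : (-1, C.weylT R e f ^ 2) ∈ C.sl2Graph R e f := by
    simpa using C.sl2Graph_neg R (one_mem (C.sl2Graph R e f))
  -- The element -1 acts trivially, so its component is `±1`; it is not 1, since the graph is
  -- single-valued over SL(2, ℝ).
  have hneg' : (-1, C.neg) ∈ C.sl2Graph R e f := by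
    obtain ⟨s, hs⟩ := C.exists_sl2Graph_of_mem R hneg
    rcases C.eq_one_or_of_adT R ht hs (C.adT_neg R _) (C.adT_neg R _) with rfl | rfl
    · exact absurd (C.eq_one_of_sl2Graph R ht hw hs) C.neg_ne_one
    · exact hs
  have hζneg : C.weylT R e f ^ 2 = C.neg := C.eq_of_sl2Graph R ht hw hζ hneg'
  have huniq {s : Matrix.SpecialLinearGroup (Fin 2) ℝ} (hs : (s, (1 : Gt)) ∈ C.sl2Graph R e f) :
      s = 1 := by
    rcases C.eq_one_or_of_adT R ht hs (C.adT_one R _) (C.adT_one R _) with rfl | rfl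
    · rfl
    · exact absurd (C.eq_of_sl2Graph R ht hw hneg' hs) C.neg_ne_one
  have huniq' {s s' : Matrix.SpecialLinearGroup (Fin 2) ℝ} {x : Gt}
      (hs : (s, x) ∈ C.sl2Graph R e f) (hs' : (s', x) ∈ C.sl2Graph R e f) : s = s' := by
    have := mul_mem hs (inv_mem hs')
    rw [Prod.inv_mk, Prod.mk_mul_mk, mul_inv_cancel] at this
    exact mul_inv_eq_one.1 (huniq this)
  -- The graph is now single-valued in both directions, so it embeds `M` in SL(2, ℝ).
  choose σ hσ using fun x : M => C.exists_sl2Graph_of_mem R (hM x x.2)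
  let σ' : M →* Matrix.SpecialLinearGroup (Fin 2) ℝ :=
    { toFun := σ
      map_one' := huniq' (hσ 1) (one_mem _)
      map_mul' := fun x y => huniq' (hσ (x * y)) (mul_mem (hσ x) (hσ y)) }
  have hc : Continuous σ' := by
    refine continuous_of_continuousAt_one σ' ?_
    rw [ContinuousAt, map_one]
    intro V hV
    obtain ⟨U₁, hU₁, h1⟩ := eventually_mul_notMem C.neg_ne_one
    have hU : (V ×ˢ U₁ : Set (Matrix.SpecialLinearGroup (Fin 2) ℝ × Gt)) ∈ nhds 1 :=
      prod_mem_nhds hV hU₁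
    have key := (C.eventually_sl2Graph_or R ht hw hU).and hU₁
    rw [Filter.mem_map]
    filter_upwards [continuous_subtype_val.continuousAt.eventually
      (show ∀ᶠ x in nhds ((1 : M) : Gt), _ from key)] with x hx
    rcases hx.1 _ _ (hσ x) rfl rfl with h3 | h3
    · exact h3.1
    -- As `w² = -1`, the other alternative would put `-x` near 1 together with `x`.
    · rw [hζneg] at h3
      exact absurd h3.2 (h1 _ hx.2)
  let F : M →* Matrix (Fin 2) (Fin 2) ℂ :=
    ((Complex.ofRealHom.mapMatrix : Matrix (Fin 2) (Fin 2) ℝ →+* _) : _ →* _).comp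
      { toFun := fun x => (σ' x).1
        map_one' := by simp
        map_mul' := fun x y => by simp }
  refine not_isNonlinearGroup_of_hom F ?_ ?_
  · exact Continuous.matrix_map (continuous_subtype_val.comp hc) Complex.continuous_ofReal
  · rw [injective_iff_map_eq_one]
    intro x hx
    have h2 : (σ' x).1 = 1 := by
      apply realToComplexMatrix_injective
      rw [realToComplexMatrix_one]
      exact hx
    have h3 : σ x = 1 := Subtype.ext h2
    have h4 := hσ x
    rw [h3] at h4
    exact Subtype.ext (C.eq_one_of_sl2Graph R ht hw h4)

/-- If the product of the root group of an `𝔰𝔩₂`-triple with `{1, -1}` is nonlinear then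
`exp(2π(e - f)) = -1`. -/
theorem expT_two_pi_eq_neg (ht : IsSl2Triple h e f) (M : Subgroup Gt)
    (hM : ∀ x ∈ M, x ∈ C.rootGroup R e f ∨ C.neg * x ∈ C.rootGroup R e f)
    (hnl : IsNonlinearGroup M) : C.expT R ((2 * Real.pi) • (e - f)) = C.neg := by
  refine (C.expT_two_pi_eq_one_or_neg R ht).resolve_left fun h1 => ?_
  rw [C.expT_two_pi R ht] at h1
  by_cases hneg : C.neg ∈ C.rootGroup R e f
  · refine C.not_isNonlinearGroup_of_mem R ht h1 hneg M (fun x hx => ?_) hnl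
    refine (hM x hx).elim id fun h2 => ?_
    have := mul_mem hneg h2
    rwa [← mul_assoc, C.neg_mul_neg, one_mul] at this
  · exact C.not_isNonlinearGroup_of_notMem R ht h1 hneg M hM hnl

/-- The exponential of `2π(e - f)` for a metaplectic root. -/
theorem expT_two_pi_eq_neg_of_isMetaplectic (ht : IsSl2Triple h e f) {H : R.Cartan}
    {α : H.hDual} (hα : C.IsMetaplectic H α)
    (hspan : ∀ X : R.g₀, toComplexification X ∈ H.mAlg α →
      ∃ x₁ x₂ x₃ : ℝ, X = x₁ • h + x₂ • e + x₃ • f) :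
    C.expT R ((2 * Real.pi) • (e - f)) = C.neg := by
  refine C.expT_two_pi_eq_neg R ht ((H.mGroup α).comap C.p) (fun x hx => ?_) hα.2
  -- Only this inclusion is needed: it places the preimage of `M_α` in `±` the root group.
  have key : H.mGroup α ≤ (C.rootGroup R e f).map C.p := by
    refine (Subgroup.closure_le _).2 ?_
    rintro y ⟨X, hX, hy⟩
    obtain ⟨x₁, x₂, x₃, rfl⟩ := hspan X hX
    exact ⟨_, C.expT_mem_rootGroup R ht x₁ x₂ x₃, (C.isExp_p R hy).symm⟩
  obtain ⟨y, hy, hyx⟩ := key hx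
  have h1 : C.p (x * y⁻¹) = 1 := by rw [map_mul, map_inv, hyx, mul_inv_cancel]
  rcases (C.ker_p _).1 h1 with h2 | h2
  · left
    rwa [mul_inv_eq_one.1 h2]
  · right
    rw [mul_inv_eq_iff_eq_mul.1 h2, ← mul_assoc, C.neg_mul_neg, one_mul]
    exact hy

end TwoFoldCover

/-! ### Complexification and complex conjugation. -/

section Complexification

variable {L L' : Type*} [LieRing L] [LieAlgebra ℝ L] [LieRing L'] [LieAlgebra ℝ L']

theorem toComplexification_add (X Y : L) :
    toComplexification (X + Y) = toComplexification X + toComplexification Y :=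
  TensorProduct.tmul_add _ _ _

theorem toComplexification_neg (X : L) : toComplexification (-X) = -toComplexification X :=
  TensorProduct.tmul_neg _ _

theorem toComplexification_sub (X Y : L) :
    toComplexification (X - Y) = toComplexification X - toComplexification Y :=
  TensorProduct.tmul_sub _ _ _

theorem toComplexification_zero : toComplexification (0 : L) = 0 := TensorProduct.tmul_zero _ _

theorem smul_toComplexification (c : ℂ) (X : L) : c • toComplexification X = c ⊗ₜ[ℝ] X := by
  rw [toComplexification, TensorProduct.smul_tmul', smul_eq_mul, mul_one]

theorem toComplexification_smul (c : ℝ) (X : L) :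
    toComplexification (c • X) = (c : ℂ) • toComplexification X := by
  rw [smul_toComplexification, toComplexification, ← TensorProduct.smul_tmul]
  simp

theorem toComplexification_lie (X Y : L) :
    toComplexification ⁅X, Y⁆ = ⁅toComplexification X, toComplexification Y⁆ := by
  simp [toComplexification]

theorem complexifyMap_toComplexification (f : L →ₗ[ℝ] L') (X : L) :
    complexifyMap f (toComplexification X) = toComplexification (f X) := by
  simp [complexifyMap, toComplexification]

@[elab_as_elim]
theorem Complexification.induction {P : Complexification L → Prop} (Z : Complexification L)
    (hr : ∀ X, P (toComplexification X)) (hs : ∀ (c : ℂ) Z, P Z → P (c • Z))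
    (ha : ∀ Z W, P Z → P W → P (Z + W)) : P Z := by
  induction Z using TensorProduct.induction_on with
  | zero => simpa [toComplexification_zero] using hr 0
  | tmul c X =>
    rw [← smul_toComplexification]
    exact hs c _ (hr X)
  | add Z W hZ hW => exact ha Z W hZ hW

/-- The real part of an element of the complexification. -/
def Complexification.re : Complexification L →ₗ[ℝ] L :=
  (TensorProduct.lid ℝ L : ℝ ⊗[ℝ] L →ₗ[ℝ] L) ∘ₗ TensorProduct.map Complex.reLm LinearMap.id

/-- Complex conjugation on the complexification. -/
def Complexification.conj : Complexification L →ₗ[ℝ] Complexification L :=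
  TensorProduct.map Complex.conjAe.toLinearMap LinearMap.id

namespace Complexification

theorem re_smul_toComplexification (c : ℂ) (X : L) : re (c • toComplexification X) = c.re • X := by
  rw [smul_toComplexification]
  simp [re]

theorem re_toComplexification (X : L) : re (toComplexification X) = X := by
  rw [← one_smul ℂ (toComplexification X), re_smul_toComplexification]
  simp

theorem conj_toComplexification (X : L) : conj (toComplexification X) = toComplexification X := by
  simp [conj, toComplexification]

theorem conj_smul (c : ℂ) (Z : Complexification L) :
    conj (c • Z) = (starRingEnd ℂ c) • conj Z := by
  induction Z using TensorProduct.induction_on with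
  | zero => simp
  | tmul d X => simp [conj, TensorProduct.smul_tmul']
  | add Z W hZ hW => rw [smul_add, map_add, hZ, hW, map_add, smul_add]

theorem conj_conj (Z : Complexification L) : conj (conj Z) = Z := by
  induction Z using Complexification.induction with
  | hr X => rw [conj_toComplexification, conj_toComplexification]
  | hs c Z hZ => rw [conj_smul, conj_smul, hZ, Complex.conj_conj]
  | ha Z W hZ hW => rw [map_add, map_add, hZ, hW]

theorem conj_lie (Z W : Complexification L) : conj ⁅Z, W⁆ = ⁅conj Z, conj W⁆ := by
  induction Z using Complexification.induction with
  | hr X =>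
    induction W using Complexification.induction with
    | hr Y => simp only [← toComplexification_lie, conj_toComplexification]
    | hs c Z hZ => rw [lie_smul, conj_smul, hZ, conj_smul, lie_smul]
    | ha Z W hZ hW => rw [lie_add, map_add, hZ, hW, map_add, lie_add]
  | hs c Z hZ => rw [smul_lie, conj_smul, hZ, conj_smul, smul_lie]
  | ha Z W hZ hW => rw [add_lie, map_add, hZ, hW, map_add, add_lie]

theorem conj_complexifyMap (f : L →ₗ[ℝ] L') (Z : Complexification L) :
    conj (complexifyMap f Z) = complexifyMap f (conj Z) := by
  induction Z using Complexification.induction with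
  | hr X => simp only [complexifyMap_toComplexification, conj_toComplexification]
  | hs c Z hZ => rw [map_smul, conj_smul, hZ, conj_smul, map_smul]
  | ha Z W hZ hW => rw [map_add, map_add, hZ, hW, map_add, map_add]

theorem eq_re_add_im (Z : Complexification L) : Z = toComplexification (re Z) +
    Complex.I • toComplexification (re (-Complex.I • Z)) := by
  induction Z using TensorProduct.induction_on with
  | zero => simp [toComplexification_zero]
  | tmul c X =>
    rw [← smul_toComplexification, smul_smul, re_smul_toComplexification,
      re_smul_toComplexification, toComplexification_smul, toComplexification_smul, smul_smul,
      ← add_smul]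
    congr 1
    apply Complex.ext <;> simp
  | add Z W hZ hW =>
    conv_lhs => rw [hZ, hW]
    simp only [map_add, smul_add, toComplexification_add]
    abel

theorem exists_eq_add (Z : Complexification L) :
    ∃ X Y : L, Z = toComplexification X + Complex.I • toComplexification Y :=
  ⟨_, _, eq_re_add_im Z⟩

theorem conj_add_I_smul (X Y : L) :
    conj (toComplexification X + Complex.I • toComplexification Y) =
      toComplexification X - Complex.I • toComplexification Y := by
  rw [map_add, conj_smul, conj_toComplexification, conj_toComplexification, Complex.conj_I,
    neg_smul, sub_eq_add_neg]

theorem toComplexification_injective :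
    Function.Injective (toComplexification : L → Complexification L) :=
  Function.LeftInverse.injective re_toComplexification

theorem eq_zero_of_add_I_smul {X Y : L}
    (h : toComplexification X + Complex.I • toComplexification Y = 0) : X = 0 ∧ Y = 0 := by
  have h1 := congrArg re h
  rw [map_add, re_toComplexification, re_smul_toComplexification] at h1
  have hX : X = 0 := by simpa using h1
  refine ⟨hX, ?_⟩
  rw [hX, toComplexification_zero, zero_add, smul_eq_zero] at h
  have := h.resolve_left Complex.I_ne_zero
  rwa [← toComplexification_zero, toComplexification_injective.eq_iff] at this

theorem exists_eq_of_conj_eq {Z : Complexification L} (h : conj Z = Z) :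
    ∃ X : L, toComplexification X = Z := by
  obtain ⟨X, Y, rfl⟩ := exists_eq_add Z
  rw [conj_add_I_smul, sub_eq_iff_eq_add, add_assoc, left_eq_add, ← two_smul ℂ, smul_eq_zero,
    smul_eq_zero] at h
  exact ⟨X, by rw [(h.resolve_left two_ne_zero).resolve_left Complex.I_ne_zero]; simp⟩

theorem complexifyMap_injective {f : L →ₗ[ℝ] L'} (hf : Function.Injective f) :
    Function.Injective (complexifyMap f) := by
  rw [injective_iff_map_eq_zero]
  intro Z hZ
  obtain ⟨X, Y, rfl⟩ := exists_eq_add Z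
  rw [map_add, map_smul, complexifyMap_toComplexification, complexifyMap_toComplexification] at hZ
  obtain ⟨h1, h2⟩ := eq_zero_of_add_I_smul hZ
  rw [hf (h1.trans (map_zero f).symm), hf (h2.trans (map_zero f).symm)]
  simp [toComplexification_zero]

theorem hom_ext {V : Type*} [AddCommGroup V] [Module ℂ V] {f g : Complexification L →ₗ[ℂ] V}
    (h : ∀ X, f (toComplexification X) = g (toComplexification X)) : f = g := by
  ext Z
  exact h Z

theorem re_add_I_smul_of_real {a b c : ℂ} {X h e f : L}
    (H : toComplexification X = a • toComplexification h + b • toComplexification e +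
      c • toComplexification f) : X = a.re • h + b.re • e + c.re • f := by
  have := congrArg re H
  rwa [re_toComplexification, map_add, map_add, re_smul_toComplexification,
    re_smul_toComplexification, re_smul_toComplexification] at this

end Complexification

end Complexification

theorem Matrix.bilin_lie_add_eq_zero_of_exp_invariant
    (β : Matrix (Fin n) (Fin n) ℝ →ₗ[ℝ] Matrix (Fin n) (Fin n) ℝ →ₗ[ℝ] ℝ)
    {X Y Z : Matrix (Fin n) (Fin n) ℝ}
    (h : ∀ t : ℝ, β (NormedSpace.exp (t • X) * Y * NormedSpace.exp (t • -X))
      (NormedSpace.exp (t • X) * Z * NormedSpace.exp (t • -X)) = β Y Z) :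
    β (X * Y - Y * X) Z + β Y (X * Z - Z * X) = 0 := by
  let _ : NormedRing (Matrix (Fin n) (Fin n) ℝ) := Matrix.linftyOpNormedRing
  let _ : NormedAlgebra ℝ (Matrix (Fin n) (Fin n) ℝ) := Matrix.linftyOpNormedAlgebra
  exact _root_.bilin_lie_add_eq_zero_of_exp_invariant β h

/-! ### The invariant form and its positivity. -/

namespace RealReductiveLinear

variable (R : RealReductiveLinear G n)

theorem conj_mem_g₀ (a : G) (Y : R.g₀) : (R.ρ a).val * Y.1 * (R.ρ a⁻¹).val ∈ R.g₀ := by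
  obtain ⟨φ, hc, hadd, hexp⟩ := (R.mem_g₀ Y.1).1 Y.2
  refine (R.mem_g₀ _).2 ⟨fun t => a * φ t * a⁻¹, by fun_prop, fun s t => ?_, fun t => ?_⟩
  · simp only [hadd]; group
  · rw [map_mul, map_mul, Units.val_mul, Units.val_mul, hexp, map_inv, ← Matrix.exp_units_conj,
      mul_smul_comm, smul_mul_assoc]

theorem B_lie (X Y Z : R.g₀) : R.B ⁅X, Y⁆ Z + R.B Y ⁅X, Z⁆ = 0 := by
  -- `B` lives only on `𝔤₀`; a linear projection extends it to all matrices, where the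
  -- differentiation takes place.
  obtain ⟨π, hπ⟩ := R.g₀.toSubmodule.exists_isCompl
  let q : Matrix (Fin n) (Fin n) ℝ →ₗ[ℝ] R.g₀ := R.g₀.toSubmodule.projectionOnto π hπ
  have hq (W : R.g₀) : q W.1 = W := Submodule.projectionOnto_apply_left hπ W
  obtain ⟨φ, hφ⟩ := (R.mem_g₀ X.1).1 X.2
  have h1 := Matrix.bilin_lie_add_eq_zero_of_exp_invariant (R.B.compl₁₂ q q)
    (X := X.1) (Y := Y.1) (Z := Z.1) fun t => by
      have e1 : NormedSpace.exp (t • X.1) = (R.ρ (φ t)).val := (hφ.2.2 t).symm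
      have e2 : NormedSpace.exp (t • -X.1) = (R.ρ (φ t)⁻¹).val := by
        rw [← hφ.neg, hφ.2.2, smul_neg, neg_smul]
      rw [e1, e2]
      have e3 := R.B_Ad (φ t) Y Z ⟨_, R.conj_mem_g₀ (φ t) Y⟩ ⟨_, R.conj_mem_g₀ (φ t) Z⟩ rfl rfl
      simp only [LinearMap.compl₁₂_apply, hq]
      rw [← e3]
      congr 1
      · congr 1
        exact hq ⟨_, R.conj_mem_g₀ (φ t) Y⟩
      · exact hq ⟨_, R.conj_mem_g₀ (φ t) Z⟩
  simp only [LinearMap.compl₁₂_apply, hq] at h1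
  rw [show X.1 * Y.1 - Y.1 * X.1 = (⁅X, Y⁆ : R.g₀).1 from rfl,
    show X.1 * Z.1 - Z.1 * X.1 = (⁅X, Z⁆ : R.g₀).1 from rfl, hq, hq] at h1
  exact h1

theorem B_θ_left (X Y : R.g₀) : R.B (R.θ X) Y = R.B X (R.θ Y) := by
  rw [← R.B_θ X (R.θ Y), R.θ_invol]

/-- The inner product `-B(X, θ Y)` is positive definite. -/
theorem B_θ_neg {X : R.g₀} (hX : X ≠ 0) : R.B X (R.θ X) < 0 := by
  set k := X + R.θ X with hk
  set p := X - R.θ X with hp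
  have hθk : R.θ k = k := by rw [hk, map_add, R.θ_invol, add_comm]
  have hθp : R.θ p = -p := by rw [hp, map_sub, R.θ_invol, neg_sub]
  have e1 : R.B k k = 2 * R.B X X + 2 * R.B X (R.θ X) := by
    simp only [hk, map_add, LinearMap.add_apply, R.B_θ, R.B_symm (R.θ X) X]; ring
  have e2 : R.B p p = 2 * R.B X X - 2 * R.B X (R.θ X) := by
    simp only [hp, map_sub, LinearMap.sub_apply, R.B_θ, R.B_symm (R.θ X) X]; ring
  have h1 : R.B k k ≤ 0 := by
    rcases eq_or_ne k 0 with h | h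
    · rw [h]; simp
    · exact (R.B_neg k hθk h).le
  have h2 : 0 ≤ R.B p p := by
    rcases eq_or_ne p 0 with h | h
    · rw [h]; simp
    · exact (R.B_pos p hθp h).le
  rcases eq_or_ne k 0 with h | h
  · have h3 : p ≠ 0 := by
      intro h4
      apply hX
      have : (2 : ℝ) • X = k + p := by rw [hk, hp, two_smul]; abel
      rw [h, h4, add_zero] at this
      exact (smul_eq_zero.1 this).resolve_left two_ne_zero
    have := R.B_pos p hθp h3
    linarith
  · have := R.B_neg k hθk h
    linarith

open Complexification

/-- The complex bilinear extension of the invariant form. -/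
def Bg : LinearMap.BilinForm ℂ R.g := LinearMap.BilinForm.baseChange ℂ R.B

theorem Bg_toComplexification (X Y : R.g₀) :
    R.Bg (toComplexification X) (toComplexification Y) = R.B X Y := by
  rw [Bg, toComplexification, toComplexification, LinearMap.BilinForm.baseChange_tmul]
  simp

theorem θg_toComplexification (X : R.g₀) :
    R.θg (toComplexification X) = toComplexification (R.θ X) :=
  complexifyMap_toComplexification _ _

theorem conj_θg (Z : R.g) : conj (R.θg Z) = R.θg (conj Z) := conj_complexifyMap _ _

theorem θg_θg (Z : R.g) : R.θg (R.θg Z) = Z := by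
  induction Z using Complexification.induction with
  | hr X => rw [θg_toComplexification, θg_toComplexification, R.θ_invol]
  | hs c Z hZ => rw [map_smul, map_smul, hZ]
  | ha Z W hZ hW => rw [map_add, map_add, hZ, hW]

theorem θg_lie (Z W : R.g) : R.θg ⁅Z, W⁆ = ⁅R.θg Z, R.θg W⁆ := by
  induction Z using Complexification.induction with
  | hr X =>
    induction W using Complexification.induction with
    | hr Y => simp only [← toComplexification_lie, θg_toComplexification, LieHom.map_lie]
    | hs c Z hZ => rw [lie_smul, map_smul, hZ, map_smul, lie_smul]
    | ha Z W hZ hW => rw [lie_add, map_add, hZ, hW, map_add, lie_add]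
  | hs c Z hZ => rw [smul_lie, map_smul, hZ, map_smul, smul_lie]
  | ha Z W hZ hW => rw [add_lie, map_add, hZ, hW, map_add, add_lie]

theorem Bg_θg (Z W : R.g) : R.Bg (R.θg Z) (R.θg W) = R.Bg Z W := by
  induction Z using Complexification.induction with
  | hr X =>
    induction W using Complexification.induction with
    | hr Y => rw [θg_toComplexification, θg_toComplexification, Bg_toComplexification,
        Bg_toComplexification, R.B_θ]
    | hs c Z hZ => rw [map_smul, map_smul, hZ, map_smul]
    | ha Z W hZ hW => rw [map_add, map_add, hZ, hW, map_add]
  | hs c Z hZ => rw [map_smul, map_smul, LinearMap.smul_apply, hZ, map_smul, LinearMap.smul_apply]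
  | ha Z W hZ hW =>
    rw [map_add, map_add, LinearMap.add_apply, hZ, hW, map_add, LinearMap.add_apply]

theorem Bg_symm (Z W : R.g) : R.Bg Z W = R.Bg W Z := by
  induction Z using Complexification.induction with
  | hr X =>
    induction W using Complexification.induction with
    | hr Y => rw [Bg_toComplexification, Bg_toComplexification, R.B_symm]
    | hs c Z hZ => rw [map_smul, hZ, map_smul, LinearMap.smul_apply]
    | ha Z W hZ hW => rw [map_add, hZ, hW, map_add, LinearMap.add_apply]
  | hs c Z hZ => rw [map_smul, LinearMap.smul_apply, hZ, map_smul]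
  | ha Z W hZ hW => rw [map_add, LinearMap.add_apply, hZ, hW, map_add]

theorem Bg_lie_toComplexification (X : R.g₀) (Z W : R.g) :
    R.Bg ⁅toComplexification X, Z⁆ W = -R.Bg Z ⁅toComplexification X, W⁆ := by
  induction Z using Complexification.induction with
  | hr Y =>
    induction W using Complexification.induction with
    | hr Z =>
      rw [← toComplexification_lie, ← toComplexification_lie, Bg_toComplexification,
        Bg_toComplexification, eq_neg_of_add_eq_zero_left (R.B_lie X Y Z)]
      push_cast
      rfl
    | hs c Z hZ => rw [map_smul, hZ, lie_smul, map_smul, smul_neg]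
    | ha Z W hZ hW => rw [map_add, hZ, hW, lie_add, map_add, neg_add]
  | hs c Z hZ =>
    rw [lie_smul, map_smul, LinearMap.smul_apply, hZ, map_smul, LinearMap.smul_apply, smul_neg]
  | ha Z W hZ hW =>
    rw [lie_add, map_add, LinearMap.add_apply, hZ, hW, map_add, LinearMap.add_apply, neg_add]

theorem Bg_lie (V Z W : R.g) : R.Bg ⁅V, Z⁆ W = -R.Bg Z ⁅V, W⁆ := by
  induction V using Complexification.induction with
  | hr X => exact R.Bg_lie_toComplexification X Z W
  | hs c V hV =>
    rw [smul_lie, smul_lie, map_smul, LinearMap.smul_apply, hV, map_smul, smul_neg]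
  | ha V V' h h' =>
    rw [add_lie, add_lie, map_add, LinearMap.add_apply, h, h', map_add, neg_add]

/-- The hermitian form `-B(Z, θ conj Z)`, as a real number. -/
def normSq (Z : R.g) : ℝ := -R.B (re Z) (R.θ (re Z)) -
  R.B (re (-Complex.I • Z)) (R.θ (re (-Complex.I • Z)))

theorem Bg_θg_conj (Z : R.g) : R.Bg Z (R.θg (conj Z)) = -(R.normSq Z : ℂ) := by
  conv_lhs => rw [eq_re_add_im Z]
  rw [normSq]
  set X := re Z
  set Y := re (-Complex.I • Z)
  rw [conj_add_I_smul, map_sub, map_smul, θg_toComplexification, θg_toComplexification]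
  simp only [map_add, map_sub, map_smul, LinearMap.add_apply, LinearMap.smul_apply,
    Bg_toComplexification, smul_eq_mul]
  rw [← R.B_θ_left X Y, R.B_symm (R.θ X) Y]
  push_cast
  linear_combination (-(R.B Y (R.θ Y)) : ℂ) * Complex.I_mul_I

theorem normSq_pos {Z : R.g} (hZ : Z ≠ 0) : 0 < R.normSq Z := by
  have hle (X : R.g₀) : R.B X (R.θ X) ≤ 0 := by
    rcases eq_or_ne X 0 with h | h
    · rw [h]; simp
    · exact (R.B_θ_neg h).le
  rw [normSq]
  set X := re Z with hX
  set Y := re (-Complex.I • Z) with hY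
  rcases eq_or_ne X 0 with h | h
  · have hY0 : Y ≠ 0 := by
      intro h0
      apply hZ
      rw [eq_re_add_im Z, ← hX, ← hY, h, h0]
      simp [toComplexification_zero]
    linarith [hle X, R.B_θ_neg hY0]
  · linarith [hle Y, R.B_θ_neg h]

end RealReductiveLinear

/-! ### Cartan subalgebras and root spaces. -/

namespace RealReductiveLinear.Cartan

open Complexification

variable {R : RealReductiveLinear G n} (H : R.Cartan)

/-- For the inner product `-B(X, θY)` the adjoint of `ad X` is `-ad (θX)`, here a multiple of `ad
X`; so `ad X` and its square have the same kernel. -/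
theorem ad_eq_zero_of_pow {X : R.g₀} {c : ℝ} (hX : R.θ X = c • X) {Y : R.g₀} (k : ℕ)
    (h : ((LieAlgebra.ad ℝ R.g₀ X) ^ (k + 1)) Y = 0) : ⁅X, Y⁆ = 0 := by
  have key (Y : R.g₀) (hY : ⁅X, ⁅X, Y⁆⁆ = 0) : ⁅X, Y⁆ = 0 := by
    by_contra h0
    have h1 := R.B_θ_neg h0
    have h2 := R.B_lie X Y (R.θ ⁅X, Y⁆)
    have h3 : ⁅X, R.θ ⁅X, Y⁆⁆ = R.θ ⁅c • X, ⁅X, Y⁆⁆ := by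
      rw [LieHom.map_lie R.θ (c • X), ← hX, R.θ_invol]
    rw [h3, smul_lie, hY, smul_zero, map_zero, map_zero, add_zero] at h2
    exact h1.ne h2
  induction k with
  | zero => simpa using h
  | succ k ih =>
    apply ih
    rw [pow_succ', Module.End.mul_apply, LieAlgebra.ad_apply]
    apply key
    rw [pow_succ', Module.End.mul_apply, pow_succ', Module.End.mul_apply] at h
    exact h

theorem lie_eq_zero_of_θ_eq (X Y : H.h₀) {c : ℝ} (hX : R.θ X = c • X.1) :
    ⁅(X : R.g₀), (Y : R.g₀)⁆ = 0 := by
  have := H.isCartan.nilpotent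
  obtain ⟨k, hk⟩ := LieModule.exists_forall_pow_toEnd_eq_zero ℝ H.h₀ H.h₀
  have h1 (k : ℕ) (Y : H.h₀) : (((LieModule.toEnd ℝ H.h₀ H.h₀ X) ^ k) Y : R.g₀) =
      ((LieAlgebra.ad ℝ R.g₀ X) ^ k) Y := by
    induction k with
    | zero => simp
    | succ k ih =>
      rw [pow_succ', pow_succ', Module.End.mul_apply, Module.End.mul_apply, ← ih]
      rfl
  refine ad_eq_zero_of_pow hX k ?_
  rw [pow_succ', Module.End.mul_apply, ← h1, hk]
  simp

/-- A `θ`-stable Cartan subalgebra is abelian. -/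
theorem lie_eq_zero (X Y : H.h₀) : ⁅(X : R.g₀), (Y : R.g₀)⁆ = 0 := by
  have e1 := H.lie_eq_zero_of_θ_eq (X + H.θh₀ X) Y (c := 1) (by
    show R.θ (X.1 + R.θ X.1) = (1 : ℝ) • (X.1 + R.θ X.1)
    rw [map_add, R.θ_invol, one_smul, add_comm])
  have e2 := H.lie_eq_zero_of_θ_eq (X - H.θh₀ X) Y (c := -1) (by
    show R.θ (X.1 - R.θ X.1) = (-1 : ℝ) • (X.1 - R.θ X.1)
    rw [map_sub, R.θ_invol, neg_one_smul, neg_sub])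
  have e3 : (2 : ℝ) • (X : R.g₀) = (X + H.θh₀ X : H.h₀) + (X - H.θh₀ X : H.h₀) := by
    push_cast
    rw [two_smul]; abel
  have e4 : (2 : ℝ) • ⁅(X : R.g₀), (Y : R.g₀)⁆ = 0 := by
    rw [← smul_lie, e3, add_lie, e1, e2, add_zero]
  exact (smul_eq_zero.1 e4).resolve_left two_ne_zero

theorem incl_ofReal (X : H.h₀) : H.incl (H.ofReal X) = toComplexification (X : R.g₀) :=
  complexifyMap_toComplexification _ _

theorem incl_injective : Function.Injective H.incl :=
  complexifyMap_injective (f := (H.h₀.incl : H.h₀ →ₗ[ℝ] R.g₀)) Subtype.val_injective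

theorem conj_incl (T : H.h) : conj (H.incl T) = H.incl (conj T) := conj_complexifyMap _ _

theorem conj_θh (T : H.h) : conj (H.θh T) = H.θh (conj T) := conj_complexifyMap _ _

theorem θh_ofReal (X : H.h₀) : H.θh (H.ofReal X) = H.ofReal (H.θh₀ X) :=
  complexifyMap_toComplexification _ _

theorem θg_incl (T : H.h) : R.θg (H.incl T) = H.incl (H.θh T) := by
  induction T using Complexification.induction with
  | hr X =>
    change R.θg (H.incl (H.ofReal X)) = H.incl (H.θh (H.ofReal X))
    rw [incl_ofReal, θh_ofReal, incl_ofReal, θg_toComplexification]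
    rfl
  | hs c Z hZ => rw [map_smul, map_smul, hZ, map_smul, map_smul]
  | ha Z W hZ hW => rw [map_add, map_add, hZ, hW, map_add, map_add]

theorem θh_θh (T : H.h) : H.θh (H.θh T) = T := by
  apply H.incl_injective
  rw [← θg_incl, ← θg_incl, θg_θg]

variable {H}

theorem dual_ext {α β : H.hDual} (h : ∀ X : H.h₀, α (H.ofReal X) = β (H.ofReal X)) : α = β :=
  hom_ext h

theorem lie_incl {α : H.hDual} {Z : R.g} (hZ : Z ∈ H.rootSpace α) (T : H.h) :
    ⁅H.incl T, Z⁆ = α T • Z := by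
  induction T using Complexification.induction with
  | hr X => exact hZ X
  | hs c T hT => rw [map_smul, smul_lie, hT, map_smul, smul_smul, smul_eq_mul]
  | ha T T' h h' => rw [map_add, add_lie, h, h', map_add, add_smul]

theorem lie_incl_incl (T T' : H.h) : ⁅H.incl T, H.incl T'⁆ = 0 := by
  have : H.incl T' ∈ H.rootSpace 0 := by
    intro X
    rw [LinearMap.zero_apply, zero_smul]
    induction T' using Complexification.induction with
    | hr Y =>
      change ⁅H.incl (H.ofReal X), H.incl (H.ofReal Y)⁆ = 0
      rw [incl_ofReal, incl_ofReal, ← toComplexification_lie, H.lie_eq_zero,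
        toComplexification_zero]
    | hs c T hT => rw [map_smul, lie_smul, hT, smul_zero]
    | ha T T' h h' => rw [map_add, lie_add, h, h', add_zero]
  rw [lie_incl this, LinearMap.zero_apply, zero_smul]

theorem exists_eq_of_lie_eq_zero {Y : R.g₀} (h : ∀ X : H.h₀, ⁅(X : R.g₀), Y⁆ = 0) : Y ∈ H.h₀ := by
  rw [← H.isCartan.self_normalizing, LieSubalgebra.mem_normalizer_iff']
  intro X hX
  rw [h ⟨X, hX⟩]
  exact H.h₀.zero_mem

/-- The Cartan subalgebra is its own centralizer. -/
theorem exists_incl_eq {Z : R.g} (hZ : Z ∈ H.rootSpace 0) : ∃ T, H.incl T = Z := by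
  obtain ⟨Y, Y', rfl⟩ := Complexification.exists_eq_add Z
  have key (X : H.h₀) : ⁅(X : R.g₀), Y⁆ = 0 ∧ ⁅(X : R.g₀), Y'⁆ = 0 := by
    have h1 := hZ X
    rw [LinearMap.zero_apply, zero_smul, incl_ofReal, lie_add, lie_smul, ← toComplexification_lie,
      ← toComplexification_lie] at h1
    exact eq_zero_of_add_I_smul h1
  refine ⟨H.ofReal ⟨Y, exists_eq_of_lie_eq_zero fun X => (key X).1⟩ +
    Complex.I • H.ofReal ⟨Y', exists_eq_of_lie_eq_zero fun X => (key X).2⟩, ?_⟩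
  rw [map_add, map_smul, incl_ofReal, incl_ofReal]

theorem lie_mem_rootSpace {α β : H.hDual} {Z W : R.g} (hZ : Z ∈ H.rootSpace α)
    (hW : W ∈ H.rootSpace β) : ⁅Z, W⁆ ∈ H.rootSpace (α + β) := by
  intro X
  rw [leibniz_lie, hZ X, hW X, smul_lie, lie_smul, ← add_smul]
  rfl

theorem θg_mem_rootSpace {α : H.hDual} {Z : R.g} (hZ : Z ∈ H.rootSpace α) :
    R.θg Z ∈ H.rootSpace (α ∘ₗ H.θh) := by
  intro X
  have : H.incl (H.ofReal X) = R.θg (H.incl (H.θh (H.ofReal X))) := by rw [θg_incl, θh_θh]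
  rw [this, ← θg_lie, lie_incl hZ, map_smul]
  rfl

/-- The adjoint of `ad T` for the hermitian form is `-ad (θ conj T)`. Comparing the eigenvalues on
`Z` shows that roots are imaginary on the compact part and real on the vector part of the Cartan
subalgebra. -/
theorem conj_apply_of_mem {α : H.hDual} {Z : R.g} (hZ : Z ∈ H.rootSpace α) (h0 : Z ≠ 0)
    (X : H.h₀) : starRingEnd ℂ (α (H.θh (H.ofReal X))) = -α (H.ofReal X) := by
  have h1 := R.Bg_lie (H.incl (H.ofReal X)) Z (R.θg (conj Z))
  have h2 : ⁅H.incl (H.ofReal X), R.θg (conj Z)⁆ =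
      R.θg (conj ⁅H.incl (H.θh (H.ofReal X)), Z⁆) := by
    rw [conj_lie, θg_lie, conj_incl, θg_incl, conj_θh, θh_θh, ofReal, conj_toComplexification]
  rw [h2, lie_incl hZ, lie_incl hZ, conj_smul, map_smul, map_smul, map_smul, LinearMap.smul_apply,
    Bg_θg_conj, smul_eq_mul, smul_eq_mul, ← neg_mul] at h1
  have h3 : -(R.normSq Z : ℂ) ≠ 0 := by
    rw [neg_ne_zero]
    exact_mod_cast (R.normSq_pos h0).ne'
  rw [mul_right_cancel₀ h3 h1, neg_neg]

theorem conj_θg_mem_rootSpace {α : H.hDual} {Z : R.g} (hZ : Z ∈ H.rootSpace α) :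
    R.θg (conj Z) ∈ H.rootSpace (-α) := by
  rcases eq_or_ne Z 0 with rfl | h0
  · rw [map_zero, map_zero]
    exact zero_mem _
  · intro X
    have h2 : ⁅H.incl (H.ofReal X), R.θg (conj Z)⁆ =
        R.θg (conj ⁅H.incl (H.θh (H.ofReal X)), Z⁆) := by
      rw [conj_lie, θg_lie, conj_incl, θg_incl, conj_θh, θh_θh, ofReal, conj_toComplexification]
    rw [h2, lie_incl hZ, conj_smul, map_smul, conj_apply_of_mem hZ h0, LinearMap.neg_apply]

theorem conj_mem_rootSpace {α : H.hDual} {Z : R.g} (hZ : Z ∈ H.rootSpace α) :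
    conj Z ∈ H.rootSpace (-(α ∘ₗ H.θh)) := by
  have := θg_mem_rootSpace (conj_θg_mem_rootSpace hZ)
  rwa [θg_θg, LinearMap.neg_comp] at this

theorem exists_mem_rootSpace {α : H.hDual} (hα : α ∈ H.roots) : ∃ Z ∈ H.rootSpace α, Z ≠ 0 :=
  Submodule.exists_mem_ne_zero_of_ne_bot hα.2

theorem mem_roots {α : H.hDual} (hα : α ≠ 0) {Z : R.g} (hZ : Z ∈ H.rootSpace α) (h0 : Z ≠ 0) :
    α ∈ H.roots :=
  ⟨hα, (Submodule.ne_bot_iff _).2 ⟨Z, hZ, h0⟩⟩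

theorem neg_mem_roots {α : H.hDual} (hα : α ∈ H.roots) : -α ∈ H.roots := by
  obtain ⟨Z, hZ, h0⟩ := exists_mem_rootSpace hα
  refine mem_roots (neg_ne_zero.2 hα.1) (conj_θg_mem_rootSpace hZ) fun h => h0 ?_
  rw [← conj_conj Z, ← R.θg_θg (conj Z), h, map_zero, map_zero]

theorem comp_θh_mem_roots {α : H.hDual} (hα : α ∈ H.roots) : α ∘ₗ H.θh ∈ H.roots := by
  obtain ⟨Z, hZ, h0⟩ := exists_mem_rootSpace hα
  refine mem_roots (fun h => hα.1 ?_) (θg_mem_rootSpace hZ) fun h => h0 ?_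
  · refine LinearMap.ext fun T => ?_
    have := LinearMap.congr_fun h (H.θh T)
    rwa [LinearMap.comp_apply, θh_θh] at this
  · rw [← R.θg_θg Z, h, map_zero]

end RealReductiveLinear.Cartan

/-! ### Coroots, root triples and reflections. -/

namespace RealReductiveLinear.Cartan

open Complexification

variable {R : RealReductiveLinear G n} {H : R.Cartan}

theorem Bg_lie_incl {α : H.hDual} {Z : R.g} (hZ : Z ∈ H.rootSpace α) (W : R.g) (T : H.h) :
    R.Bg ⁅Z, W⁆ (H.incl T) = R.Bg Z W * α T := by
  rw [R.Bg_lie, ← lie_skew, lie_incl hZ, map_neg, neg_neg, map_smul, R.Bg_symm, smul_eq_mul,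
    mul_comm]

theorem eq_zero_of_Bg_incl {T : H.h} (h : ∀ T', R.Bg (H.incl T) (H.incl T') = 0) : T = 0 := by
  have h1 := h (H.θh (conj T))
  rw [← θg_incl, ← conj_incl, R.Bg_θg_conj, neg_eq_zero] at h1
  by_contra h0
  have h2 : H.incl T ≠ 0 := fun h3 => h0 (H.incl_injective (h3.trans (map_zero _).symm))
  exact (R.normSq_pos h2).ne' (by exact_mod_cast h1)

theorem θg_conj_lie (Z : R.g) :
    R.θg (conj ⁅Z, -R.θg (conj Z)⁆) = -⁅Z, -R.θg (conj Z)⁆ := by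
  rw [conj_lie, θg_lie, map_neg, map_neg, R.conj_θg, conj_conj, θg_θg, lie_neg, lie_skew, lie_neg, neg_neg]

/-- Normalized root vectors. -/
theorem exists_rootVector {α : H.hDual} (hα : α ∈ H.roots) :
    ∃ E ∈ H.rootSpace α, E ≠ 0 ∧ ∃ c, H.incl c = ⁅E, -R.θg (conj E)⁆ ∧ α c = 2 := by
  obtain ⟨Z, hZ, h0⟩ := exists_mem_rootSpace hα
  have hF : -R.θg (conj Z) ∈ H.rootSpace (-α) := neg_mem (conj_θg_mem_rootSpace hZ)
  obtain ⟨c₀, hc₀⟩ := exists_incl_eq (by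
    have := lie_mem_rootSpace hZ hF
    rwa [add_neg_cancel] at this)
  have hN := R.normSq_pos h0
  have hB (T : H.h) : R.Bg (H.incl c₀) (H.incl T) = R.normSq Z * α T := by
    rw [hc₀, Bg_lie_incl hZ, map_neg, Bg_θg_conj, neg_neg]
  have hc0 : H.incl c₀ ≠ 0 := by
    intro h
    apply hα.1
    refine LinearMap.ext fun T => ?_
    have h1 := hB T
    rw [h, map_zero, LinearMap.zero_apply, zero_eq_mul] at h1
    exact h1.resolve_left (by exact_mod_cast hN.ne')
  -- A quotient of two hermitian norms, hence positive, so a real rescaling of `Z` achieves the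
  -- value 2.
  have hα0 : α c₀ = ((R.normSq (H.incl c₀) / R.normSq Z : ℝ) : ℂ) := by
    have h1 := R.Bg_θg_conj (H.incl c₀)
    rw [hc₀, θg_conj_lie, ← hc₀, map_neg, hB, neg_inj] at h1
    have h2 : (R.normSq Z : ℂ) ≠ 0 := by exact_mod_cast hN.ne'
    push_cast
    rw [eq_div_iff h2, mul_comm, h1]
  set r := R.normSq (H.incl c₀) / R.normSq Z with hr
  have hr0 : 0 < r := div_pos (R.normSq_pos hc0) hN
  refine ⟨(Real.sqrt (2 / r) : ℂ) • Z, Submodule.smul_mem _ _ hZ, ?_, ((2 / r : ℝ) : ℂ) • c₀, ?_, ?_⟩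
  · refine smul_ne_zero ?_ h0
    exact_mod_cast (Real.sqrt_pos.2 (by positivity)).ne'
  · rw [map_smul, hc₀, conj_smul, map_smul, Complex.conj_ofReal, smul_lie, ← smul_neg, lie_smul,
      smul_smul, ← Complex.ofReal_mul, Real.mul_self_sqrt (by positivity)]
  · rw [map_smul, hα0, smul_eq_mul, ← Complex.ofReal_mul, div_mul_cancel₀ _ hr0.ne']
    simp

/-- A vector proportional to the `B`-dual of `α` is fixed by its value under `α`. Hence the choice
made in `coroot` does not matter. -/
theorem eq_of_Bg {α : H.hDual} {c c' : H.h} {k k' : ℂ}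
    (h : ∀ T, R.Bg (H.incl c) (H.incl T) = k * α T)
    (h' : ∀ T, R.Bg (H.incl c') (H.incl T) = k' * α T) (hc : α c = 2) (hc' : α c' = 2) :
    c = c' := by
  have h1 : k' • c - k • c' = 0 := eq_zero_of_Bg_incl fun T => by
    rw [map_sub, map_smul, map_smul, map_sub, map_smul, map_smul, LinearMap.sub_apply,
      LinearMap.smul_apply, LinearMap.smul_apply, h, h', smul_eq_mul, smul_eq_mul]
    ring
  have h2 : k' = k := by
    have := congrArg α h1
    rw [map_sub, map_smul, map_smul, hc, hc', map_zero, smul_eq_mul, smul_eq_mul] at this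
    linear_combination this / 2
  have hk : k ≠ 0 := by
    rintro rfl
    have : c = 0 := eq_zero_of_Bg_incl fun T => by rw [h, zero_mul]
    rw [this, map_zero] at hc
    exact two_ne_zero hc.symm
  rw [h2, ← smul_sub, smul_eq_zero] at h1
  exact sub_eq_zero.1 (h1.resolve_left hk)

theorem IsCoroot.exists_Bg {α : H.hDual} {c : H.h} (hc : H.IsCoroot α c) :
    ∃ k : ℂ, ∀ T, R.Bg (H.incl c) (H.incl T) = k * α T := by
  obtain ⟨⟨E, hE, F, hF, h⟩, -⟩ := hc
  exact ⟨_, fun T => by rw [← h, Bg_lie_incl hE]⟩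

theorem isCoroot_coroot {α : H.hDual} (hα : α ∈ H.roots) : H.IsCoroot α (H.coroot α) := by
  obtain ⟨E, hE, -, c, hc, h2⟩ := exists_rootVector hα
  exact Classical.epsilon_spec (p := H.IsCoroot α)
    ⟨c, ⟨E, hE, _, neg_mem (conj_θg_mem_rootSpace hE), hc.symm⟩, h2⟩

theorem apply_coroot {α : H.hDual} (hα : α ∈ H.roots) : α (H.coroot α) = 2 :=
  (isCoroot_coroot hα).2

theorem coroot_eq_of_Bg {α : H.hDual} (hα : α ∈ H.roots) {c : H.h} {k : ℂ}
    (h : ∀ T, R.Bg (H.incl c) (H.incl T) = k * α T) (hc : α c = 2) : H.coroot α = c := by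
  obtain ⟨k', h'⟩ := (isCoroot_coroot hα).exists_Bg
  exact eq_of_Bg h' h (apply_coroot hα) hc

theorem coroot_eq_of_lie {α : H.hDual} (hα : α ∈ H.roots) {c : H.h} {E : R.g}
    (hE : E ∈ H.rootSpace α) {F : R.g} (h : H.incl c = ⁅E, F⁆) (hc : α c = 2) :
    H.coroot α = c :=
  coroot_eq_of_Bg hα (k := R.Bg E F) (fun T => by rw [h, Bg_lie_incl hE]) hc

theorem isSl2Triple_of_lie {α : H.hDual} {c : H.h} {E F : R.g}
    (hE : E ∈ H.rootSpace α) (hF : F ∈ H.rootSpace (-α)) (h : H.incl c = ⁅E, F⁆) (hc : α c = 2) :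
    IsSl2Triple (H.incl c) E F where
  h_ne_zero h0 := by
    have : c = 0 := H.incl_injective (h0.trans (map_zero _).symm)
    rw [this, map_zero] at hc
    exact two_ne_zero hc.symm
  lie_e_f := h.symm
  lie_h_e_nsmul := by rw [lie_incl hE, hc, ofNat_smul_eq_nsmul]
  lie_h_f_nsmul := by
    rw [lie_incl hF, LinearMap.neg_apply, hc, neg_smul, ofNat_smul_eq_nsmul]

/-- The `𝔰𝔩₂`-triple of a root. -/
theorem exists_isSl2Triple {α : H.hDual} (hα : α ∈ H.roots) :
    ∃ E ∈ H.rootSpace α, E ≠ 0 ∧ IsSl2Triple (H.incl (H.coroot α)) E (-R.θg (conj E)) := by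
  obtain ⟨E, hE, h0, c, hc, h2⟩ := exists_rootVector hα
  refine ⟨E, hE, h0, ?_⟩
  rw [coroot_eq_of_lie hα hE hc h2]
  exact isSl2Triple_of_lie hE (neg_mem (conj_θg_mem_rootSpace hE)) hc h2

theorem exists_Bg_coroot {α : H.hDual} (hα : α ∈ H.roots) :
    ∃ k : ℝ, 0 < k ∧ ∀ T, R.Bg (H.incl (H.coroot α)) (H.incl T) = k * α T := by
  obtain ⟨E, hE, h0, t⟩ := exists_isSl2Triple hα
  refine ⟨R.normSq E, R.normSq_pos h0, fun T => ?_⟩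
  rw [← t.lie_e_f, Bg_lie_incl hE, map_neg, Bg_θg_conj, neg_neg]

theorem conj_coroot {α : H.hDual} (hα : α ∈ H.roots) :
    conj (H.coroot α) = -H.θh (H.coroot α) := by
  obtain ⟨E, hE, h0, t⟩ := exists_isSl2Triple hα
  have h1 := θg_conj_lie E
  rw [t.lie_e_f, conj_incl, θg_incl, ← map_neg] at h1
  have h2 := congrArg H.θh (H.incl_injective h1)
  rwa [θh_θh, map_neg] at h2

/-- Root spaces are one-dimensional. -/
theorem exists_eq_smul {α : H.hDual} {E F Z : R.g} {c : H.h} (hE : E ∈ H.rootSpace α)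
    (hF : F ∈ H.rootSpace (-α)) (t : IsSl2Triple (H.incl c) E F) (hZ : Z ∈ H.rootSpace α) :
    ∃ a : ℂ, Z = a • E := by
  have hc : α c = 2 := by
    have h1 := t.lie_h_e_nsmul
    rw [lie_incl hE, ← ofNat_smul_eq_nsmul ℂ] at h1
    exact smul_left_injective ℂ t.e_ne_zero h1
  have hB : R.Bg E F ≠ 0 := by
    intro h0
    apply t.h_ne_zero
    have : c = 0 := eq_zero_of_Bg_incl fun T => by
      rw [← t.lie_e_f, Bg_lie_incl hE, h0, zero_mul]
    rw [this, map_zero]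
  refine ⟨R.Bg Z F / R.Bg E F, ?_⟩
  -- The part of `Z` that `B` does not see against `F`. Then `[W, F] = 0`, which is impossible for a
  -- nonzero vector of weight 2.
  set W := Z - (R.Bg Z F / R.Bg E F) • E with hW
  have hWα : W ∈ H.rootSpace α := sub_mem hZ (Submodule.smul_mem _ _ hE)
  have hBW : R.Bg W F = 0 := by
    rw [hW, map_sub, map_smul, LinearMap.sub_apply, LinearMap.smul_apply, smul_eq_mul,
      div_mul_cancel₀ _ hB, sub_self]
  have hWF : ⁅W, F⁆ = 0 := by
    obtain ⟨T, hT⟩ := exists_incl_eq (by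
      have := lie_mem_rootSpace hWα hF
      rwa [add_neg_cancel] at this)
    have : T = 0 := eq_zero_of_Bg_incl fun T' => by
      rw [hT, Bg_lie_incl hWα, hBW, zero_mul]
    rw [← hT, this, map_zero]
  by_contra hne
  have hW0 : W ≠ 0 := fun h => hne (sub_eq_zero.1 h)
  refine t.lie_f_ne_zero (k := 2) ?_ hW0 (by norm_num) ?_
  · rw [lie_incl hWα, hc]
    norm_num
  · rw [← lie_skew, hWF, neg_zero]

theorem exists_eq_smul_of_mem {α : H.hDual} (hα : α ∈ H.roots) {E Z : R.g}
    (hE : E ∈ H.rootSpace α) (h0 : E ≠ 0) (hZ : Z ∈ H.rootSpace α) : ∃ a : ℂ, Z = a • E := by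
  obtain ⟨E₁, hE₁, -, t⟩ := exists_isSl2Triple hα
  obtain ⟨a, rfl⟩ := exists_eq_smul hE₁ (neg_mem (conj_θg_mem_rootSpace hE₁)) t hZ
  obtain ⟨b, rfl⟩ := exists_eq_smul hE₁ (neg_mem (conj_θg_mem_rootSpace hE₁)) t hE
  have hb : b ≠ 0 := by
    rintro rfl
    exact h0 (zero_smul _ _)
  exact ⟨a / b, by rw [smul_smul, div_mul_cancel₀ _ hb]⟩

theorem coroot_neg {α : H.hDual} (hα : α ∈ H.roots) : H.coroot (-α) = -H.coroot α := by
  obtain ⟨k, -, hk⟩ := exists_Bg_coroot hα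
  refine coroot_eq_of_Bg (neg_mem_roots hα) (k := k) (fun T => ?_) ?_
  · rw [map_neg, map_neg, LinearMap.neg_apply, LinearMap.neg_apply, hk, mul_neg]
  · rw [LinearMap.neg_apply, map_neg, neg_neg, apply_coroot hα]

theorem Bg_incl_θh (T T' : H.h) :
    R.Bg (H.incl (H.θh T)) (H.incl T') = R.Bg (H.incl T) (H.incl (H.θh T')) := by
  rw [← θg_incl, ← R.Bg_θg, θg_θg, θg_incl]

theorem coroot_comp_θh {α : H.hDual} (hα : α ∈ H.roots) :
    H.coroot (α ∘ₗ H.θh) = H.θh (H.coroot α) := by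
  obtain ⟨k, -, hk⟩ := exists_Bg_coroot hα
  refine coroot_eq_of_Bg (comp_θh_mem_roots hα) (k := k) (fun T => ?_) ?_
  · rw [Bg_incl_θh, hk]; rfl
  · rw [LinearMap.comp_apply, θh_θh, apply_coroot hα]

theorem exists_int_apply_coroot {α β : H.hDual} (hα : α ∈ H.roots) (hβ : β ∈ H.roots) :
    ∃ k : ℤ, β (H.coroot α) = k := by
  obtain ⟨E, hE, h0, t⟩ := exists_isSl2Triple hα
  obtain ⟨W, hW, hW0⟩ := exists_mem_rootSpace hβ
  have := FiniteDimensional.finiteDimensional_submodule R.g₀.toSubmodule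
  exact t.exists_int (lie_incl hW _) hW0

theorem pow_toEnd_mem_rootSpace {α β : H.hDual} {E W : R.g} (hE : E ∈ H.rootSpace α)
    (hW : W ∈ H.rootSpace β) (k : ℕ) :
    ((LieModule.toEnd ℂ R.g R.g E) ^ k) W ∈ H.rootSpace (β + (k : ℂ) • α) := by
  induction k with
  | zero => simpa using hW
  | succ k ih =>
    rw [pow_succ', Module.End.mul_apply]
    have := lie_mem_rootSpace hE ih
    rw [show β + ((k + 1 : ℕ) : ℂ) • α = α + (β + (k : ℂ) • α) by push_cast; module]
    exact this

/-- Roots are stable under reflections. -/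
theorem reflection_mem_roots {α β : H.hDual} (hα : α ∈ H.roots) (hβ : β ∈ H.roots) :
    β - β (H.coroot α) • α ∈ H.roots := by
  have hne : β - β (H.coroot α) • α ≠ 0 := by
    intro h
    have h1 : β = β (H.coroot α) • α := sub_eq_zero.1 h
    have h2 := LinearMap.congr_fun h1 (H.coroot α)
    rw [LinearMap.smul_apply, apply_coroot hα, smul_eq_mul] at h2
    have h3 : β (H.coroot α) = 0 := by linear_combination -h2
    rw [h3, zero_smul] at h1
    exact hβ.1 h1
  have key {α : H.hDual} (hα : α ∈ H.roots) (k : ℕ) (hk : β (H.coroot α) = k) :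
      ∃ Z ∈ H.rootSpace (β - β (H.coroot α) • α), Z ≠ 0 := by
    obtain ⟨E, hE, h0, t⟩ := exists_isSl2Triple hα
    obtain ⟨W, hW, hW0⟩ := exists_mem_rootSpace hβ
    have := FiniteDimensional.finiteDimensional_submodule R.g₀.toSubmodule
    obtain ⟨j, hj⟩ := t.exists_pow_f_pow_e_ne_zero (k := k) (by rw [lie_incl hW, hk]) hW0
    refine ⟨_, ?_, hj⟩
    have h1 := pow_toEnd_mem_rootSpace (neg_mem (conj_θg_mem_rootSpace hE))
      (pow_toEnd_mem_rootSpace hE hW j) (k + j)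
    rwa [show β + (j : ℂ) • α + ((k + j : ℕ) : ℂ) • -α = β - β (H.coroot α) • α by
      rw [hk]; push_cast; module] at h1
  obtain ⟨k, hk⟩ := exists_int_apply_coroot hα hβ
  rcases le_total 0 k with h | h
  · lift k to ℕ using h
    obtain ⟨Z, hZ, h0⟩ := key hα k (by exact_mod_cast hk)
    exact mem_roots hne hZ h0
  · obtain ⟨k', rfl⟩ := Int.exists_eq_neg_ofNat h
    obtain ⟨Z, hZ, h0⟩ := key (neg_mem_roots hα) k' (by
      rw [coroot_neg hα, map_neg, hk]; simp)
    rw [coroot_neg hα, map_neg, smul_neg, neg_smul, neg_neg] at hZ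
    exact mem_roots hne hZ h0

theorem coroot_reflection {α β : H.hDual} (hα : α ∈ H.roots) (hβ : β ∈ H.roots) :
    H.coroot (β - β (H.coroot α) • α) = H.coroot β - α (H.coroot β) • H.coroot α := by
  obtain ⟨k, -, hk⟩ := exists_Bg_coroot hα
  obtain ⟨l, -, hl⟩ := exists_Bg_coroot hβ
  have hkl : (l : ℂ) * β (H.coroot α) = k * α (H.coroot β) := by
    rw [← hl, ← hk, R.Bg_symm]
  refine coroot_eq_of_Bg (reflection_mem_roots hα hβ) (k := l) (fun T => ?_) ?_
  · rw [map_sub, map_smul, map_sub, map_smul, LinearMap.sub_apply, LinearMap.smul_apply, hk, hl,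
      LinearMap.sub_apply, LinearMap.smul_apply, smul_eq_mul, smul_eq_mul]
    linear_combination (α T) * hkl
  · simp only [LinearMap.sub_apply, LinearMap.smul_apply, map_sub, map_smul, smul_eq_mul,
      apply_coroot hα, apply_coroot hβ]
    ring

/-- A root is determined by its values on a basis, and each value is an eigenvalue of an operator on
a finite-dimensional space. -/
theorem finite_roots : H.roots.Finite := by
  have := FiniteDimensional.finiteDimensional_submodule R.g₀.toSubmodule
  have : FiniteDimensional ℝ H.h₀ :=
    FiniteDimensional.finiteDimensional_submodule H.h₀.toSubmodule
  let b := Module.finBasis ℝ H.h₀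
  let v : H.hDual → (Fin (Module.finrank ℝ H.h₀) → ℂ) := fun α i => α (H.ofReal (b i))
  have hv : Set.InjOn v H.roots := by
    intro α _ β _ hαβ
    apply dual_ext
    intro X
    have h1 : ∀ i, α (H.ofReal (b i)) = β (H.ofReal (b i)) := fun i => congrFun hαβ i
    rw [← b.sum_repr X]
    have h2 (γ : H.hDual) : γ (H.ofReal (∑ i, b.repr X i • b i)) =
        ∑ i, (b.repr X i : ℂ) * γ (H.ofReal (b i)) := by
      have : H.ofReal (∑ i, b.repr X i • b i) = ∑ i, (b.repr X i : ℂ) • H.ofReal (b i) := by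
        rw [ofReal, toComplexification, TensorProduct.tmul_sum]
        exact Finset.sum_congr rfl fun i _ => toComplexification_smul _ _
      rw [this, map_sum]
      simp
    rw [h2, h2]
    exact Finset.sum_congr rfl fun i _ => by rw [h1]
  refine Set.Finite.of_finite_image (Set.Finite.subset
    (Set.Finite.pi' fun i => Module.End.finite_hasEigenvalue
      (LieAlgebra.ad ℂ R.g (H.incl (H.ofReal (b i))))) ?_) hv
  rintro _ ⟨α, hα, rfl⟩ i
  obtain ⟨Z, hZ, h0⟩ := exists_mem_rootSpace hα
  exact Module.End.hasEigenvalue_of_hasEigenvector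
    (Module.End.hasEigenvector_iff.2 ⟨Module.End.mem_eigenspace_iff.2 (hZ (b i)), h0⟩)

end RealReductiveLinear.Cartan

/-! ### Real forms of the root triples. -/

theorem complexMatrix_toComplexification {L : LieSubalgebra ℝ (Matrix (Fin n) (Fin n) ℝ)} (X : L) :
    complexMatrix L (toComplexification X) = realToComplexMatrix n X := by
  simp [complexMatrix, toComplexification]

theorem complexMatrix_lie {L : LieSubalgebra ℝ (Matrix (Fin n) (Fin n) ℝ)}
    (Z W : Complexification L) : complexMatrix L ⁅Z, W⁆ =
      complexMatrix L Z * complexMatrix L W - complexMatrix L W * complexMatrix L Z := by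
  induction Z using Complexification.induction with
  | hr X =>
    induction W using Complexification.induction with
    | hr Y =>
      rw [← toComplexification_lie]
      simp only [complexMatrix_toComplexification, LieSubalgebra.coe_bracket, Ring.lie_def, map_sub,
        realToComplexMatrix_mul]
    | hs c Z hZ => rw [lie_smul, map_smul, hZ, map_smul, mul_smul_comm, smul_mul_assoc, smul_sub]
    | ha Z W hZ hW => rw [lie_add, map_add, hZ, hW, map_add, mul_add, add_mul]; abel
  | hs c Z hZ => rw [smul_lie, map_smul, hZ, map_smul, mul_smul_comm, smul_mul_assoc, smul_sub]
  | ha Z W hZ hW => rw [add_lie, map_add, hZ, hW, map_add, mul_add, add_mul]; abel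

namespace RealReductiveLinear

open Complexification

variable {R : RealReductiveLinear G n}

theorem complexMatrix_triple {h e f : R.g} (t : IsSl2Triple h e f) :
    complexMatrix R.g₀ e * complexMatrix R.g₀ f - complexMatrix R.g₀ f * complexMatrix R.g₀ e =
      complexMatrix R.g₀ h ∧
    complexMatrix R.g₀ h * complexMatrix R.g₀ e - complexMatrix R.g₀ e * complexMatrix R.g₀ h =
      2 • complexMatrix R.g₀ e ∧
    complexMatrix R.g₀ h * complexMatrix R.g₀ f - complexMatrix R.g₀ f * complexMatrix R.g₀ h =
      -(2 • complexMatrix R.g₀ f) := by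
  refine ⟨?_, ?_, ?_⟩
  · rw [← complexMatrix_lie, t.lie_e_f]
  · rw [← complexMatrix_lie, t.lie_h_e_nsmul, map_nsmul]
  · rw [← complexMatrix_lie, t.lie_h_f_nsmul, map_neg, map_nsmul]

theorem exp_two_pi_I_smul_of_triple {h e f : R.g} (t : IsSl2Triple h e f) :
    NormedSpace.exp ((2 * Real.pi * Complex.I : ℂ) • complexMatrix R.g₀ h) = 1 := by
  obtain ⟨h1, h2, h3⟩ := complexMatrix_triple t
  exact Matrix.exp_two_pi_I_smul_eq_one h1 h2 h3

theorem exp_pi_I_smul_of_triple {h e f : R.g} (t : IsSl2Triple h e f) :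
    NormedSpace.exp ((Real.pi * Complex.I : ℂ) • complexMatrix R.g₀ h) =
      NormedSpace.exp ((Real.pi : ℂ) • (complexMatrix R.g₀ e - complexMatrix R.g₀ f)) := by
  obtain ⟨h1, h2, h3⟩ := complexMatrix_triple t
  exact Matrix.exp_pi_smul_e_sub_f h1 h2 h3

theorem isSl2Triple_of_toComplexification {h e f : R.g₀}
    (t : IsSl2Triple (toComplexification h) (toComplexification e) (toComplexification f)) :
    IsSl2Triple h e f where
  h_ne_zero h0 := t.h_ne_zero (by rw [h0, toComplexification_zero])
  lie_e_f := toComplexification_injective (by rw [toComplexification_lie, t.lie_e_f])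
  lie_h_e_nsmul := toComplexification_injective (by
    rw [toComplexification_lie, t.lie_h_e_nsmul, two_nsmul, two_nsmul, toComplexification_add])
  lie_h_f_nsmul := toComplexification_injective (by
    rw [toComplexification_lie, t.lie_h_f_nsmul, two_nsmul, two_nsmul, toComplexification_neg,
      toComplexification_add])

namespace Cartan

variable {H : R.Cartan}

/-- The complex span of the triple is a subalgebra containing both root spaces, hence `𝔪_α`. Taking
real parts makes the coefficients real. -/
theorem exists_eq_of_mem_mAlg {h e f : R.g₀} (t : IsSl2Triple h e f) {α : H.hDual}
    (hα : ∀ Z ∈ H.rootSpace α, ∃ a b c : ℂ,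
      Z = a • toComplexification h + b • toComplexification e + c • toComplexification f)
    (hα' : ∀ Z ∈ H.rootSpace (-α), ∃ a b c : ℂ,
      Z = a • toComplexification h + b • toComplexification e + c • toComplexification f)
    (X : R.g₀) (hX : toComplexification X ∈ H.mAlg α) :
    ∃ x₁ x₂ x₃ : ℝ, X = x₁ • h + x₂ • e + x₃ • f := by
  have hef : ⁅toComplexification e, toComplexification f⁆ = toComplexification h := by
    rw [← toComplexification_lie, t.lie_e_f]
  have hhe : ⁅toComplexification h, toComplexification e⁆ = (2 : ℂ) • toComplexification e := by
    rw [← toComplexification_lie, t.lie_h_e_nsmul, two_nsmul, two_smul, toComplexification_add]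
  have hhf : ⁅toComplexification h, toComplexification f⁆ = -((2 : ℂ) • toComplexification f) := by
    rw [← toComplexification_lie, t.lie_h_f_nsmul, two_nsmul, two_smul, toComplexification_neg,
      toComplexification_add]
  let S : LieSubalgebra ℂ R.g :=
    { carrier := {Z | ∃ a b c : ℂ, Z = a • toComplexification h + b • toComplexification e +
        c • toComplexification f}
      zero_mem' := ⟨0, 0, 0, by simp⟩
      add_mem' := by
        rintro _ _ ⟨a, b, c, rfl⟩ ⟨a', b', c', rfl⟩
        exact ⟨a + a', b + b', c + c', by module⟩
      smul_mem' := by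
        rintro r _ ⟨a, b, c, rfl⟩
        exact ⟨r * a, r * b, r * c, by module⟩
      lie_mem' := by
        rintro _ _ ⟨a, b, c, rfl⟩ ⟨a', b', c', rfl⟩
        refine ⟨b * c' - c * b', 2 * (a * b' - b * a'), 2 * (c * a' - a * c'), ?_⟩
        simp only [add_lie, lie_add, smul_lie, lie_smul, lie_self, hef, hhe, hhf,
          ← lie_skew (toComplexification f) (toComplexification e),
          ← lie_skew (toComplexification e) (toComplexification h),
          ← lie_skew (toComplexification f) (toComplexification h)]
        module }
  have hle : H.mAlg α ≤ S := LieSubalgebra.lieSpan_le.2 (Set.union_subset hα hα')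
  obtain ⟨a, b, c, habc⟩ := hle hX
  exact ⟨_, _, _, re_add_I_smul_of_real habc⟩

theorem θh_coroot_of_imag {α : H.hDual} (hα : α ∈ H.imagRoots) :
    H.θh (H.coroot α) = H.coroot α := by
  rw [← coroot_comp_θh hα.1, hα.2]

theorem mem_compactRoots_or {α : H.hDual} (hα : α ∈ H.imagRoots) :
    α ∈ H.compactRoots ∨ α ∈ H.noncompactRoots := by
  obtain ⟨E, hE, h0⟩ := exists_mem_rootSpace hα.1
  have h1 := θg_mem_rootSpace hE
  rw [hα.2] at h1
  obtain ⟨a, ha⟩ := exists_eq_smul_of_mem hα.1 hE h0 h1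
  have h2 := congrArg R.θg ha
  rw [θg_θg, map_smul, ha, smul_smul] at h2
  have h3 : a * a = 1 := by
    have : (a * a - 1) • E = 0 := by rw [sub_smul, ← h2, one_smul, sub_self]
    exact sub_eq_zero.1 ((smul_eq_zero.1 this).resolve_right h0)
  rcases mul_self_eq_one_iff.1 h3 with rfl | rfl
  · refine Or.inl ⟨hα, fun Z hZ => ?_⟩
    obtain ⟨b, rfl⟩ := exists_eq_smul_of_mem hα.1 hE h0 hZ
    rw [map_smul, ha, one_smul]
  · refine Or.inr ⟨hα, fun Z hZ => ?_⟩
    obtain ⟨b, rfl⟩ := exists_eq_smul_of_mem hα.1 hE h0 hZ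
    rw [map_smul, ha, neg_one_smul, smul_neg]

theorem exists_ofReal_eq_I_smul_coroot {α : H.hDual} (hα : α ∈ H.imagRoots) :
    ∃ T : H.h₀, H.ofReal T = Complex.I • H.coroot α :=
  exists_eq_of_conj_eq (by
    rw [conj_smul, conj_coroot hα.1, θh_coroot_of_imag hα, Complex.conj_I, smul_neg, neg_smul,
      neg_neg])

/-- The `𝔰𝔩₂`-triple of a noncompact imaginary root. -/
theorem exists_triple_of_noncompact {α : H.hDual} (hα : α ∈ H.noncompactRoots) {T : H.h₀}
    (hT : H.ofReal T = Complex.I • H.coroot α) :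
    ∃ h e f : R.g₀, IsSl2Triple h e f ∧ e - f = T ∧
      ∀ X : R.g₀, toComplexification X ∈ H.mAlg α →
        ∃ x₁ x₂ x₃ : ℝ, X = x₁ • h + x₂ • e + x₃ • f := by
  obtain ⟨E, hE, h0, t⟩ := exists_isSl2Triple hα.1.1
  have hF : -R.θg (conj E) = conj E := by rw [← R.conj_θg, hα.2 E hE, map_neg, neg_neg]
  rw [hF] at t
  have hE' : conj E ∈ H.rootSpace (-α) := by
    have := conj_mem_rootSpace hE
    rwa [hα.1.2] at this
  -- A Cayley transform: `E + conj E`, `-i(E - conj E)` and `T = i α^∨` are real and span a copy of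
  -- 𝔰𝔩(2, ℝ), arranged below so that `e - f = T`.
  obtain ⟨h, hh⟩ := exists_eq_of_conj_eq (Z := E + conj E) (by rw [map_add, conj_conj, add_comm])
  obtain ⟨b, hb⟩ := exists_eq_of_conj_eq (Z := -Complex.I • (E - conj E)) (by
    rw [conj_smul, map_sub, conj_conj, map_neg, Complex.conj_I]; module)
  have hTg : toComplexification (T : R.g₀) = Complex.I • H.incl (H.coroot α) := by
    rw [← incl_ofReal, hT, map_smul]
  set c := H.incl (H.coroot α)
  have hcE : ⁅c, E⁆ = (2 : ℂ) • E := t.lie_h_e_smul ℂ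
  have hcE' : ⁅c, conj E⁆ = -((2 : ℂ) • conj E) := by
    rw [t.lie_h_f_nsmul, two_nsmul, two_smul]
  have hEE' : ⁅E, conj E⁆ = c := t.lie_e_f
  have hI := Complex.I_mul_I
  have he : toComplexification ((1 / 2 : ℝ) • (T.1 + b)) =
      (1 / 2 : ℂ) • (Complex.I • c - Complex.I • (E - conj E)) := by
    rw [toComplexification_smul, toComplexification_add, hTg, hb, neg_smul, ← sub_eq_add_neg]
    norm_num
  have hf : toComplexification ((1 / 2 : ℝ) • (b - T.1)) =
      -((1 / 2 : ℂ) • (Complex.I • c + Complex.I • (E - conj E))) := by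
    rw [toComplexification_smul, toComplexification_sub, hTg, hb]
    push_cast
    module
  have ht : IsSl2Triple h ((1 / 2 : ℝ) • (T.1 + b)) ((1 / 2 : ℝ) • (b - T.1)) := by
    refine isSl2Triple_of_toComplexification ?_
    rw [hh, he, hf]
    refine ⟨?_, ?_, ?_, ?_⟩
    · intro h1
      have h2 : ⁅c, E + conj E⁆ = 0 := by rw [h1, lie_zero]
      rw [lie_add, hcE, hcE'] at h2
      have h3 : (4 : ℂ) • E = 0 := by
        have : (4 : ℂ) • E = (2 : ℂ) • (E + conj E) + ((2 : ℂ) • E + -((2 : ℂ) • conj E)) := by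
          module
        rw [this, h1, h2, smul_zero, add_zero]
      exact h0 ((smul_eq_zero.1 h3).resolve_left (by norm_num))
    · simp only [lie_add, sub_lie, lie_sub, smul_lie, lie_smul, lie_neg, lie_self, hcE,
        hcE', hEE', ← lie_skew E c, ← lie_skew (conj E) c, ← lie_skew (conj E) E]
      match_scalars <;> first | ring1 | (ring_nf; rw [Complex.I_sq]; norm_num)
    · simp only [add_lie, lie_sub, lie_smul, lie_self, hcE,
        hcE', hEE', ← lie_skew E c, ← lie_skew (conj E) c, ← lie_skew (conj E) E]
      module
    · simp only [add_lie, lie_add, lie_sub, lie_smul, lie_neg, lie_self, hcE,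
        hcE', hEE', ← lie_skew E c, ← lie_skew (conj E) c, ← lie_skew (conj E) E]
      module
  have hspan : E = (1 / 2 : ℂ) • toComplexification h +
      (Complex.I / 2) • toComplexification ((1 / 2 : ℝ) • (T.1 + b)) +
      (Complex.I / 2) • toComplexification ((1 / 2 : ℝ) • (b - T.1)) := by
    rw [hh, he, hf]
    match_scalars <;> first | ring1 | (ring_nf; rw [Complex.I_sq]; norm_num)
  have hspan' : conj E = (1 / 2 : ℂ) • toComplexification h +
      (-Complex.I / 2) • toComplexification ((1 / 2 : ℝ) • (T.1 + b)) +
      (-Complex.I / 2) • toComplexification ((1 / 2 : ℝ) • (b - T.1)) := by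
    rw [hh, he, hf]
    match_scalars <;> first | ring1 | (ring_nf; rw [Complex.I_sq]; norm_num)
  refine ⟨h, _, _, ht, ?_, exists_eq_of_mem_mAlg ht (fun Z hZ => ?_) fun Z hZ => ?_⟩
  · module
  · obtain ⟨a, rfl⟩ := exists_eq_smul_of_mem hα.1.1 hE h0 hZ
    exact ⟨_, _, _, by conv_lhs => rw [hspan, smul_add, smul_add, smul_smul, smul_smul, smul_smul]⟩
  · obtain ⟨a, rfl⟩ := exists_eq_smul_of_mem (neg_mem_roots hα.1.1) hE' t.f_ne_zero hZ
    exact ⟨_, _, _, by conv_lhs => rw [hspan', smul_add, smul_add, smul_smul, smul_smul, smul_smul]⟩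

/-- The `𝔰𝔲₂`-triple attached to an `𝔰𝔩₂`-triple `(c, E, -conj E)`. -/
theorem _root_.RealReductiveLinear.exists_su2_of_triple {c E : R.g} (t : IsSl2Triple c E (-conj E))
    {T : R.g₀} (hT : toComplexification T = Complex.I • c) :
    ∃ J J' : R.g₀, ⁅T, J⁆ = (2 : ℝ) • J' ∧ ⁅T, J'⁆ = -((2 : ℝ) • J) ∧
      ⁅J, J'⁆ = (2 : ℝ) • T := by
  obtain ⟨J, hJ⟩ := exists_eq_of_conj_eq (Z := E + conj E) (by rw [map_add, conj_conj, add_comm])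
  obtain ⟨J', hJ'⟩ := exists_eq_of_conj_eq (Z := Complex.I • (E - conj E)) (by
    rw [conj_smul, map_sub, conj_conj, Complex.conj_I]; module)
  have hcE : ⁅c, E⁆ = (2 : ℂ) • E := t.lie_h_e_smul ℂ
  have hcE' : ⁅c, conj E⁆ = -((2 : ℂ) • conj E) := by
    have := t.lie_h_f_nsmul
    rwa [two_nsmul, ← two_smul ℂ, lie_neg, smul_neg, neg_inj] at this
  have hEE' : ⁅E, conj E⁆ = -c := by rw [← t.lie_e_f, lie_neg, neg_neg]
  refine ⟨J, J', toComplexification_injective ?_, toComplexification_injective ?_,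
    toComplexification_injective ?_⟩ <;>
  · simp only [toComplexification_lie, toComplexification_smul, toComplexification_neg, hT, hJ,
      hJ', Complex.ofReal_ofNat]
    simp only [add_lie, lie_add, lie_sub, smul_lie, lie_smul, lie_self, hcE, hcE', hEE',
      ← lie_skew (conj E) E]
    match_scalars <;> first | ring1 | (ring_nf; rw [Complex.I_sq]; norm_num)

/-- The `𝔰𝔩₂`-triple of a real root. -/
theorem isSl2Triple_of_real {α : H.hDual} (hα : α ∈ H.realRoots) {E : R.g₀}
    (hE : toComplexification E ∈ H.rootSpace α)
    (hc : toComplexification ⁅E, -R.θ E⁆ = H.incl (H.coroot α)) :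
    IsSl2Triple ⁅E, -R.θ E⁆ E (-R.θ E) ∧
      ∀ X : R.g₀, toComplexification X ∈ H.mAlg α →
        ∃ x₁ x₂ x₃ : ℝ, X = x₁ • ⁅E, -R.θ E⁆ + x₂ • E + x₃ • -R.θ E := by
  have hF : toComplexification (-R.θ E) ∈ H.rootSpace (-α) := by
    rw [toComplexification_neg, ← R.θg_toComplexification, ← hα.2]
    exact neg_mem (θg_mem_rootSpace hE)
  have ht : IsSl2Triple ⁅E, -R.θ E⁆ E (-R.θ E) := by
    refine isSl2Triple_of_toComplexification ?_
    rw [hc]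
    exact isSl2Triple_of_lie hE hF (by rw [← hc, toComplexification_lie]) (apply_coroot hα.1)
  refine ⟨ht, exists_eq_of_mem_mAlg ht (fun Z hZ => ?_) fun Z hZ => ?_⟩
  · obtain ⟨a, rfl⟩ := exists_eq_smul_of_mem hα.1 hE (fun h => ht.e_ne_zero
      (toComplexification_injective (h.trans toComplexification_zero.symm))) hZ
    exact ⟨0, a, 0, by simp⟩
  · obtain ⟨a, rfl⟩ := exists_eq_smul_of_mem (neg_mem_roots hα.1) hF (fun h => ht.f_ne_zero
      (toComplexification_injective (h.trans toComplexification_zero.symm))) hZ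
    exact ⟨0, 0, a, by simp⟩

/-- Conjugation preserves the root line and sends `E` to `u E` with `|u| = 1`. Multiplying `E` by a
square root of `u` makes it real without changing the normalization. -/
theorem exists_real_rootVector {α : H.hDual} (hα : α ∈ H.realRoots) :
    ∃ E : R.g₀, toComplexification E ∈ H.rootSpace α ∧
      toComplexification ⁅E, -R.θ E⁆ = H.incl (H.coroot α) := by
  obtain ⟨E, hE, h0, t⟩ := exists_isSl2Triple hα.1
  have h1 := conj_mem_rootSpace hE
  rw [hα.2, neg_neg] at h1
  obtain ⟨u, hu⟩ := exists_eq_smul_of_mem hα.1 hE h0 h1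
  have hu1 : starRingEnd ℂ u * u = 1 := by
    have h2 := conj_conj E
    rw [hu, conj_smul, hu, smul_smul] at h2
    have : (starRingEnd ℂ u * u - 1) • E = 0 := by rw [sub_smul, h2, one_smul, sub_self]
    exact sub_eq_zero.1 ((smul_eq_zero.1 this).resolve_right h0)
  obtain ⟨v, hv⟩ := IsAlgClosed.exists_pow_nat_eq u (n := 2) two_pos
  have hv1 : starRingEnd ℂ v * v = 1 := by
    rw [← hv, map_pow, ← mul_pow, ← Complex.normSq_eq_conj_mul_self] at hu1
    rw [← Complex.normSq_eq_conj_mul_self]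
    have h3 : Complex.normSq v ^ 2 = 1 := by exact_mod_cast hu1
    rw [(pow_eq_one_iff_of_nonneg (Complex.normSq_nonneg v) two_ne_zero).1 h3, Complex.ofReal_one]
  obtain ⟨E', hE'⟩ := exists_eq_of_conj_eq (Z := v • E) (by
    rw [conj_smul, hu, smul_smul, ← hv, pow_two, ← mul_assoc, hv1, one_mul])
  refine ⟨E', ?_, ?_⟩
  · rw [hE']
    exact Submodule.smul_mem _ _ hE
  · have h3 : toComplexification ⁅E', -R.θ E'⁆ =
        ⁅toComplexification E', -R.θg (conj (toComplexification E'))⁆ := by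
      rw [conj_toComplexification, θg_toComplexification, ← toComplexification_neg,
        toComplexification_lie]
    rw [h3, hE', conj_smul, map_smul, ← smul_neg, smul_lie, lie_smul, smul_smul, mul_comm, hv1,
      one_smul, t.lie_e_f]

end Cartan

end RealReductiveLinear

/-! ### Complex roots and simple lacing. -/

namespace RealReductiveLinear.Cartan

open Complexification

variable {R : RealReductiveLinear G n} {H : R.Cartan}

/-- The hermitian norm of `α^∨ + c θα^∨` is a positive multiple of `2 + c m`, and this vector is
nonzero because `α` is neither real nor imaginary. The two signs `c` together give `|m| < 2`. -/
theorem two_add_mul_pos {α : H.hDual} (hα : α ∈ H.complexRoots) {m : ℤ}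
    (hm : α (H.θh (H.coroot α)) = m) {c : ℤ} (hc : c * c = 1) : 0 < 2 + c * m := by
  obtain ⟨k, hk, hB⟩ := exists_Bg_coroot hα.1
  set w := H.coroot α + (c : ℂ) • H.θh (H.coroot α) with hw
  have hBw (T : H.h) : R.Bg (H.incl w) (H.incl T) = k * (α T + c * α (H.θh T)) := by
    rw [hw, map_add, map_smul, map_add, map_smul, LinearMap.add_apply, LinearMap.smul_apply,
      Bg_incl_θh, hB, hB, smul_eq_mul]
    ring
  have hk0 : (k : ℂ) ≠ 0 := by exact_mod_cast hk.ne'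
  have hcc : (c : ℂ) * c = 1 := by exact_mod_cast hc
  have hw0 : H.incl w ≠ 0 := by
    intro h0
    have h1 (T : H.h) : α (H.θh T) = -c * α T := by
      have h2 := hBw T
      rw [h0, map_zero, LinearMap.zero_apply, zero_eq_mul] at h2
      linear_combination c * h2.resolve_left hk0 - α (H.θh T) * hcc
    rcases mul_self_eq_one_iff.1 hc with rfl | rfl
    · exact hα.2.1 (LinearMap.ext fun T => by simpa using h1 T)
    · exact hα.2.2 (LinearMap.ext fun T => by simpa using h1 T)
  have hconj : R.θg (conj (H.incl w)) = -H.incl w := by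
    rw [conj_incl, θg_incl, hw, map_add, conj_smul, conj_θh, conj_coroot hα.1, map_add, map_smul,
      map_neg, map_neg, θh_θh, map_intCast]
    simp only [map_add, map_smul, map_neg, smul_neg, neg_add]
  have h1 := R.Bg_θg_conj (H.incl w)
  rw [hconj, map_neg, neg_inj, hBw, hw, map_add, map_smul, map_add, map_smul, θh_θh, map_add,
    map_smul, apply_coroot hα.1, hm, smul_eq_mul, smul_eq_mul, ← hw] at h1
  have h2 : ((k * (2 * (2 + (c * m : ℤ))) : ℝ) : ℂ) = (R.normSq (H.incl w) : ℂ) := by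
    rw [← h1]
    push_cast
    linear_combination (-2 : ℂ) * k * hcc
  have h3 : k * (2 * (2 + (c * m : ℤ))) = R.normSq (H.incl w) := by exact_mod_cast h2
  have h4 := R.normSq_pos hw0
  rw [← h3] at h4
  have h5 : (0 : ℝ) < 2 + (c * m : ℤ) := by
    have := pos_of_mul_pos_right h4 hk.le
    linarith
  exact_mod_cast h5

/-- The pairing of a complex root with the Cartan involution of its coroot. -/
theorem apply_θh_coroot {α : H.hDual} (hα : α ∈ H.complexRoots) :
    α (H.θh (H.coroot α)) = 0 ∨ α (H.θh (H.coroot α)) = -1 ∨ α (H.θh (H.coroot α)) = 1 := by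
  obtain ⟨m, hm⟩ := exists_int_apply_coroot (comp_θh_mem_roots hα.1) hα.1
  rw [coroot_comp_θh hα.1] at hm
  have h1 := two_add_mul_pos hα hm (c := 1) rfl
  have h2 := two_add_mul_pos hα hm (c := -1) rfl
  have h3 : m = 0 ∨ m = -1 ∨ m = 1 := by omega
  rw [hm]
  rcases h3 with rfl | rfl | rfl <;> simp

theorem lengthSq_eq (α : H.hDual) :
    H.lengthSq α = (∑ β ∈ H.finite_roots.toFinset, α (H.coroot β) ^ 2).re := by
  rw [lengthSq, finsum_mem_eq_finite_toFinset_sum _ H.finite_roots]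
  rfl

/-- Reflection in `β` permutes the roots; in each term it preserves the factor with `α` and negates
the one with `β`. -/
theorem sum_mul_eq_zero {α β : H.hDual} (hβ : β ∈ H.roots) (h0 : α (H.coroot β) = 0) :
    ∑ γ ∈ H.finite_roots.toFinset, α (H.coroot γ) * β (H.coroot γ) = 0 := by
  have h1 : ∑ γ ∈ H.finite_roots.toFinset, α (H.coroot γ) * β (H.coroot γ) =
      ∑ γ ∈ H.finite_roots.toFinset, -(α (H.coroot γ) * β (H.coroot γ)) := by
    refine Finset.sum_nbij' (fun γ => γ - γ (H.coroot β) • β) (fun γ => γ - γ (H.coroot β) • β)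
      ?_ ?_ ?_ ?_ ?_
    · intro γ hγ
      rw [Set.Finite.mem_toFinset] at hγ ⊢
      exact reflection_mem_roots hβ hγ
    · intro γ hγ
      rw [Set.Finite.mem_toFinset] at hγ ⊢
      exact reflection_mem_roots hβ hγ
    · intro γ _
      simp only [LinearMap.sub_apply, LinearMap.smul_apply, apply_coroot hβ, smul_eq_mul]
      module
    · intro γ _
      simp only [LinearMap.sub_apply, LinearMap.smul_apply, apply_coroot hβ, smul_eq_mul]
      module
    · intro γ hγ
      rw [Set.Finite.mem_toFinset] at hγ
      rw [coroot_reflection hβ hγ, map_sub, map_sub, map_smul, map_smul, h0, apply_coroot hβ,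
        smul_eq_mul, smul_eq_mul]
      ring
  rw [Finset.sum_neg_distrib] at h1
  exact self_eq_neg.1 h1

theorem lengthSq_sub {α β : H.hDual} (hβ : β ∈ H.roots) (h0 : α (H.coroot β) = 0) :
    H.lengthSq (α - β) = H.lengthSq α + H.lengthSq β := by
  rw [lengthSq_eq, lengthSq_eq, lengthSq_eq, ← Complex.add_re, ← Finset.sum_add_distrib]
  congr 1
  rw [← sub_eq_zero, ← Finset.sum_sub_distrib]
  have h1 := congrArg (fun z => (-2 : ℂ) * z) (sum_mul_eq_zero hβ h0)
  rw [Finset.mul_sum, mul_zero] at h1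
  rw [← h1]
  refine Finset.sum_congr rfl fun γ _ => ?_
  rw [LinearMap.sub_apply]
  ring

theorem lengthSq_pos {α : H.hDual} (hα : α ∈ H.roots) : 0 < H.lengthSq α := by
  rw [lengthSq_eq, Complex.re_sum]
  refine Finset.sum_pos' (fun β hβ => ?_) ⟨α, by rwa [Set.Finite.mem_toFinset], ?_⟩
  · rw [Set.Finite.mem_toFinset] at hβ
    obtain ⟨k, hk⟩ := exists_int_apply_coroot hβ hα
    rw [hk, ← Int.cast_pow, Complex.intCast_re]
    exact_mod_cast sq_nonneg k
  · rw [apply_coroot hα]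
    norm_num

/-- In the simply laced case the difference of orthogonal roots is not a root. -/
theorem sub_notMem_roots (hsl : R.SimplyLaced) {α β : H.hDual} (hα : α ∈ H.roots)
    (hβ : β ∈ H.roots) (h0 : α (H.coroot β) = 0) (h0' : β (H.coroot α) = 0) :
    α - β ∉ H.roots := by
  intro h
  -- By Pythagoras `α - β` would be strictly longer than `α`, although the two are not orthogonal.
  have h1 : H.SameFactor (α - β) α := by
    refine Relation.EqvGen.rel _ _ ⟨h, hα, ?_⟩
    rw [pairing, LinearMap.sub_apply, apply_coroot hα, h0', sub_zero]
    exact two_ne_zero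
  have h2 := hsl H _ h _ hα h1
  rw [lengthSq_sub hβ h0] at h2
  linarith [lengthSq_pos hβ]

theorem lie_eq_zero_of_notMem {α β : H.hDual} {Z W : R.g} (hZ : Z ∈ H.rootSpace α)
    (hW : W ∈ H.rootSpace β) (h0 : α + β ≠ 0) (h : α + β ∉ H.roots) : ⁅Z, W⁆ = 0 := by
  by_contra hne
  exact h (mem_roots h0 (lie_mem_rootSpace hZ hW) hne)

/-- The `𝔰𝔩₂`-triple attached to a complex root orthogonal to its image under the Cartan
involution. -/
theorem exists_triple_of_complex (hsl : R.SimplyLaced) {α : H.hDual} (hα : α ∈ H.complexRoots)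
    (h0 : α (H.θh (H.coroot α)) = 0) :
    ∃ U : R.g, IsSl2Triple (H.incl (H.coroot α + H.θh (H.coroot α))) U (-conj U) := by
  obtain ⟨E, hE, hE0, t⟩ := exists_isSl2Triple hα.1
  have hαθ := comp_θh_mem_roots hα.1
  -- The cross terms in the bracket of `E + θE` with its conjugate lie in the root spaces of `±(α -
  -- θα)`, so they vanish and the triples of `α` and `θα` add up.
  have hnot : α - α ∘ₗ H.θh ∉ H.roots := by
    refine sub_notMem_roots hsl hα.1 hαθ ?_ h0
    rw [coroot_comp_θh hα.1, h0]
  have hne : α - α ∘ₗ H.θh ≠ 0 := fun h => hα.2.2 (sub_eq_zero.1 h).symm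
  have h1 : ⁅E, conj E⁆ = 0 := by
    refine lie_eq_zero_of_notMem hE (conj_mem_rootSpace hE) ?_ ?_ <;> rwa [← sub_eq_add_neg]
  have h2 : ⁅R.θg E, R.θg (conj E)⁆ = 0 := by rw [← θg_lie, h1, map_zero]
  have h3 : ⁅E, R.θg (conj E)⁆ = -H.incl (H.coroot α) := by
    rw [← t.lie_e_f, lie_neg, neg_neg]
  have h4 : ⁅R.θg E, conj E⁆ = -H.incl (H.θh (H.coroot α)) := by
    rw [← θg_incl, ← map_neg, ← h3, θg_lie, θg_θg]
  have hc : α (H.coroot α + H.θh (H.coroot α)) = 2 := by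
    rw [map_add, h0, add_zero, apply_coroot hα.1]
  have hc' : (α ∘ₗ H.θh) (H.coroot α + H.θh (H.coroot α)) = 2 := by
    rw [LinearMap.comp_apply, map_add, θh_θh, add_comm, hc]
  have e1 := lie_incl hE (H.coroot α + H.θh (H.coroot α))
  have e2 := lie_incl (θg_mem_rootSpace hE) (H.coroot α + H.θh (H.coroot α))
  have e3 := lie_incl (conj_mem_rootSpace hE) (H.coroot α + H.θh (H.coroot α))
  have e4 := lie_incl (conj_θg_mem_rootSpace hE) (H.coroot α + H.θh (H.coroot α))
  rw [LinearMap.neg_apply] at e3 e4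
  rw [hc] at e1 e4
  rw [hc'] at e2 e3
  refine ⟨E + R.θg E, ?_, ?_, ?_, ?_⟩
  · intro h
    have h5 := H.incl_injective (h.trans (map_zero _).symm)
    rw [h5, map_zero] at hc
    exact two_ne_zero hc.symm
  · rw [map_add, R.conj_θg, lie_neg, add_lie, lie_add, lie_add, h1, h2, h3, h4, map_add]
    abel
  · rw [lie_add, e1, e2]
    module
  · rw [map_add conj, R.conj_θg, lie_neg, lie_add, e3, e4]
    module

/-- If `⟨α, θα^∨⟩ = -1` then `α + θα` is a noncompact imaginary root. -/
theorem add_comp_θh_mem_noncompactRoots {α : H.hDual} (hα : α ∈ H.complexRoots)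
    (h0 : α (H.θh (H.coroot α)) = -1) :
    α + α ∘ₗ H.θh ∈ H.noncompactRoots ∧
      H.coroot (α + α ∘ₗ H.θh) = H.coroot α + H.θh (H.coroot α) := by
  obtain ⟨E, hE, hE0, t⟩ := exists_isSl2Triple hα.1
  have := FiniteDimensional.finiteDimensional_submodule R.g₀.toSubmodule
  have hE' := θg_mem_rootSpace hE
  have hne : α + α ∘ₗ H.θh ≠ 0 := fun h => hα.2.1 (eq_neg_of_add_eq_zero_right h)
  -- `θE` has weight -1 for the triple of `α`, and raising is injective on negative weights.
  have h1 : ⁅E, R.θg E⁆ ≠ 0 := by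
    refine t.lie_e_ne_zero (k := -1) ?_ (fun h => hE0 ?_) (by norm_num)
    · rw [lie_incl hE', LinearMap.comp_apply, h0]
      norm_num
    · rw [← R.θg_θg E, h, map_zero]
  have hroot := mem_roots hne (lie_mem_rootSpace hE hE') h1
  have himag : α + α ∘ₗ H.θh ∈ H.imagRoots := by
    refine ⟨hroot, LinearMap.ext fun T => ?_⟩
    simp only [LinearMap.comp_apply, LinearMap.add_apply, θh_θh]
    ring
  refine ⟨⟨himag, fun Z hZ => ?_⟩, ?_⟩
  · obtain ⟨a, rfl⟩ := exists_eq_smul_of_mem hroot (lie_mem_rootSpace hE hE') h1 hZ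
    -- `θ` exchanges the two entries of the bracket `[E, θE]`, so it acts by -1.
    rw [map_smul, θg_lie, θg_θg, ← lie_skew, smul_neg]
  · obtain ⟨k, -, hB⟩ := exists_Bg_coroot hα.1
    refine coroot_eq_of_Bg hroot (k := k) (fun T => ?_) ?_
    · rw [map_add, map_add, LinearMap.add_apply, Bg_incl_θh, hB, hB, LinearMap.add_apply,
        LinearMap.comp_apply, mul_add]
    · simp only [LinearMap.comp_apply, LinearMap.add_apply, map_add, θh_θh, h0, apply_coroot hα.1]
      norm_num

/-- If `⟨α, θα^∨⟩ = 1` then `α - θα` is a real root. -/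
theorem sub_comp_θh_mem_realRoots {α : H.hDual} (hα : α ∈ H.complexRoots)
    (h0 : α (H.θh (H.coroot α)) = 1) :
    α - α ∘ₗ H.θh ∈ H.realRoots ∧
      H.coroot (α - α ∘ₗ H.θh) = H.coroot α - H.θh (H.coroot α) := by
  have hroot : α - α ∘ₗ H.θh ∈ H.roots := by
    have := reflection_mem_roots (comp_θh_mem_roots hα.1) hα.1
    rwa [coroot_comp_θh hα.1, h0, one_smul] at this
  refine ⟨⟨hroot, LinearMap.ext fun T => ?_⟩, ?_⟩
  · simp only [LinearMap.comp_apply, LinearMap.sub_apply, LinearMap.neg_apply, θh_θh]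
    ring
  · obtain ⟨k, -, hB⟩ := exists_Bg_coroot hα.1
    refine coroot_eq_of_Bg hroot (k := k) (fun T => ?_) ?_
    · rw [map_sub, map_sub, LinearMap.sub_apply, Bg_incl_θh, hB, hB, LinearMap.sub_apply,
        LinearMap.comp_apply, mul_sub]
    · simp only [LinearMap.comp_apply, LinearMap.sub_apply, map_sub, θh_θh, h0, apply_coroot hα.1]
      norm_num

end RealReductiveLinear.Cartan

theorem Matrix.exp_sub_eq_one {A B : Matrix (Fin n) (Fin n) ℂ} (h : Commute A B)
    (hexp : NormedSpace.exp A = NormedSpace.exp B) : NormedSpace.exp (A - B) = 1 := by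
  rw [sub_eq_add_neg, Matrix.exp_add_of_commute _ _ h.neg_right, hexp,
    ← Matrix.exp_add_of_commute _ _ (Commute.refl B).neg_right, add_neg_cancel,
    NormedSpace.exp_zero]

/-! ### Exponentials of coroots in the cover. -/

namespace TwoFoldCover

open Complexification RealReductiveLinear.Cartan

variable {R : RealReductiveLinear G n} (C : TwoFoldCover G Gt) {H : R.Cartan}

theorem isMetaplectic_of_admissible (hsl : R.SimplyLaced) (hadm : C.Admissible R) {α : H.hDual}
    (hα : α ∈ H.realRoots ∨ α ∈ H.noncompactRoots) : C.IsMetaplectic H α := by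
  have hroot : α ∈ H.roots := hα.elim (fun h => h.1) fun h => h.1.1
  exact hadm H α ⟨hroot, fun β hβ h => (hsl H α hroot β hβ h).ge⟩ hα

theorem isExpH_of_expT {Z : H.h} {x : Gt} (T : H.h₀) (hT : H.ofReal T = Complex.I • Z)
    (hx : C.expT R ((2 * Real.pi) • T.1) = x) :
    C.IsExpH H ((2 * Real.pi * Complex.I : ℂ) • Z) x := by
  refine ⟨(2 * Real.pi) • T, ?_, (C.isExp_iff R).2 hx⟩
  rw [RealReductiveLinear.Cartan.ofReal, toComplexification_smul,
    ← RealReductiveLinear.Cartan.ofReal, hT, smul_smul]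
  push_cast
  rfl

theorem expT_of_compact {α : H.hDual} (hα : α ∈ H.compactRoots) {T : H.h₀}
    (hT : H.ofReal T = Complex.I • H.coroot α) : C.expT R ((2 * Real.pi) • T.1) = 1 := by
  obtain ⟨E, hE, h0, t⟩ := exists_isSl2Triple hα.1.1
  rw [← R.conj_θg, hα.2 E hE] at t
  obtain ⟨J, J', h1, h2, h3⟩ := RealReductiveLinear.exists_su2_of_triple t (T := T.1)
    (by rw [← incl_ofReal, hT, map_smul])
  exact C.expT_eq_one_of_su2 R h1 h2 h3

theorem expT_of_noncompact {α : H.hDual} (hα : α ∈ H.noncompactRoots)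
    (hmet : C.IsMetaplectic H α) {T : H.h₀} (hT : H.ofReal T = Complex.I • H.coroot α) :
    C.expT R ((2 * Real.pi) • T.1) = C.neg := by
  obtain ⟨h, e, f, t, hef, hspan⟩ := exists_triple_of_noncompact hα hT
  rw [← hef]
  exact C.expT_two_pi_eq_neg_of_isMetaplectic R t hmet hspan

theorem expT_of_real {α : H.hDual} (hα : α ∈ H.realRoots) (hmet : C.IsMetaplectic H α) {E : R.g₀}
    (hE : toComplexification E ∈ H.rootSpace α)
    (hc : toComplexification ⁅E, -R.θ E⁆ = H.incl (H.coroot α)) :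
    C.expT R ((2 * Real.pi) • (E + R.θ E)) = C.neg := by
  obtain ⟨t, hspan⟩ := isSl2Triple_of_real hα hE hc
  have := C.expT_two_pi_eq_neg_of_isMetaplectic R t hmet hspan
  rwa [sub_neg_eq_add] at this

theorem exists_ofReal_eq_I_smul_add {α : H.hDual} (hα : α ∈ H.roots) :
    ∃ T : H.h₀, H.ofReal T = Complex.I • (H.coroot α + H.θh (H.coroot α)) :=
  exists_eq_of_conj_eq (by
    rw [conj_smul, map_add, conj_θh, conj_coroot hα, map_neg, θh_θh, Complex.conj_I, ← neg_add,
      smul_neg, neg_smul, neg_neg, add_comm])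

theorem exp_pi_smul_of_real {α : H.hDual} (hα : α ∈ H.realRoots) {E : R.g₀}
    (hE : toComplexification E ∈ H.rootSpace α)
    (hc : toComplexification ⁅E, -R.θ E⁆ = H.incl (H.coroot α)) :
    NormedSpace.exp (realToComplexMatrix n (Real.pi • (E + R.θ E) : R.g₀)) =
      NormedSpace.exp ((Real.pi * Complex.I : ℂ) • complexMatrix R.g₀ (H.incl (H.coroot α))) := by
  have hF : toComplexification (-R.θ E) ∈ H.rootSpace (-α) := by
    rw [toComplexification_neg, ← R.θg_toComplexification, ← hα.2]
    exact neg_mem (θg_mem_rootSpace hE)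
  rw [RealReductiveLinear.exp_pi_I_smul_of_triple (isSl2Triple_of_lie hE hF
    (by rw [← hc, toComplexification_lie]) (apply_coroot hα.1)), ← map_sub,
    ← toComplexification_sub, sub_neg_eq_add, ← map_smul, ← toComplexification_smul,
    complexMatrix_toComplexification]

theorem expT_of_complex {α : H.hDual} (hα : α ∈ H.complexRoots)
    (h0 : α (H.θh (H.coroot α)) = 1) (hmet : C.IsMetaplectic H (α - α ∘ₗ H.θh)) {T : H.h₀}
    (hT : H.ofReal T = Complex.I • (H.coroot α + H.θh (H.coroot α))) :
    C.expT R ((2 * Real.pi) • T.1) = C.neg := by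
  obtain ⟨hβ, hcor⟩ := sub_comp_θh_mem_realRoots hα h0
  set β := α - α ∘ₗ H.θh with hβdef
  obtain ⟨E, hE, hc⟩ := exists_real_rootVector hβ
  set Z := E + R.θ E with hZ
  have hTg : toComplexification T.1 = H.incl (H.ofReal T) := (incl_ofReal H T).symm
  have hβT : β (H.ofReal T) = 0 := by
    rw [hT, map_smul, hβdef]
    simp only [LinearMap.sub_apply, LinearMap.comp_apply, map_add, θh_θh, smul_eq_mul]
    ring
  have hθE : toComplexification (R.θ E) ∈ H.rootSpace (-β) := by
    rw [← R.θg_toComplexification, ← hβ.2]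
    exact θg_mem_rootSpace hE
  have hTZ : ⁅T.1, Z⁆ = 0 := by
    apply toComplexification_injective
    rw [toComplexification_lie, hZ, toComplexification_add, hTg, lie_add, lie_incl hE,
      lie_incl hθE, LinearMap.neg_apply, hβT, neg_zero, zero_smul, zero_smul, add_zero,
      toComplexification_zero]
  have hη : C.expT R (Real.pi • T.1 - Real.pi • Z) = 1 ∨
      C.expT R (Real.pi • T.1 - Real.pi • Z) = C.neg := by
    apply C.expT_eq_one_or_neg R
    set M := complexMatrix R.g₀
    have hA : realToComplexMatrix n (Real.pi • T.1 : R.g₀) =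
        (Real.pi * Complex.I : ℂ) • M (H.incl (H.coroot α + H.θh (H.coroot α))) := by
      rw [← complexMatrix_toComplexification, toComplexification_smul, hTg, hT, map_smul, map_smul,
        map_smul, smul_smul]
    have hcomm : Commute (realToComplexMatrix n (Real.pi • T.1 : R.g₀))
        (realToComplexMatrix n (Real.pi • Z : R.g₀)) := by
      rw [commute_iff_eq, ← sub_eq_zero, ← complexMatrix_toComplexification,
        ← complexMatrix_toComplexification, ← complexMatrix_lie, ← toComplexification_lie,
        smul_lie, lie_smul, hTZ, smul_zero, smul_zero, toComplexification_zero, map_zero]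
    have hB := exp_pi_smul_of_real hβ hE hc
    obtain ⟨F, -, -, tθ⟩ := exists_isSl2Triple (comp_θh_mem_roots hα.1)
    have h1 := RealReductiveLinear.exp_two_pi_I_smul_of_triple tθ
    rw [coroot_comp_θh hα.1] at h1
    -- `α^∨ + θα^∨ = 2θα^∨ + β^∨`, and the first summand disappears because `exp(2πi θα^∨) = 1` in
    -- matrices. So `πT` and `πZ` have the same exponential in `G`.
    have hsum : (Real.pi * Complex.I : ℂ) • M (H.incl (H.coroot α + H.θh (H.coroot α))) =
        (2 * Real.pi * Complex.I : ℂ) • M (H.incl (H.θh (H.coroot α))) +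
        (Real.pi * Complex.I : ℂ) • M (H.incl (H.coroot β)) := by
      rw [hcor]
      simp only [map_add, map_sub]
      module
    have hcomm' : Commute ((2 * Real.pi * Complex.I : ℂ) • M (H.incl (H.θh (H.coroot α))))
        ((Real.pi * Complex.I : ℂ) • M (H.incl (H.coroot β))) := by
      refine Commute.smul_left (Commute.smul_right ?_ _) _
      rw [commute_iff_eq, ← sub_eq_zero, ← complexMatrix_lie, lie_incl_incl, map_zero]
    have hexpA : NormedSpace.exp (realToComplexMatrix n (Real.pi • T.1 : R.g₀)) =
        NormedSpace.exp (realToComplexMatrix n (Real.pi • Z : R.g₀)) := by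
      rw [hA, hsum, Matrix.exp_add_of_commute _ _ hcomm', h1, one_mul, hB]
    rw [show ((Real.pi • T.1 - Real.pi • Z : R.g₀) : Matrix (Fin n) (Fin n) ℝ) =
      (Real.pi • T.1 : R.g₀).1 - (Real.pi • Z : R.g₀).1 from rfl, map_sub]
    exact Matrix.exp_sub_eq_one hcomm hexpA
  -- The undetermined sign disappears on squaring, leaving the value `exp(2πZ)` of the real root
  -- `β`.
  have hη2 : C.expT R ((2 : ℝ) • (Real.pi • T.1 - Real.pi • Z)) = 1 := by
    have := C.expT_nsmul R (Real.pi • T.1 - Real.pi • Z) 2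
    rw [Nat.cast_ofNat] at this
    rw [this, pow_two]
    rcases hη with h | h <;> rw [h]
    · exact one_mul 1
    · exact C.neg_mul_neg
  have hsplit : (2 * Real.pi) • T.1 = (2 : ℝ) • (Real.pi • T.1 - Real.pi • Z) +
      (2 * Real.pi) • Z := by module
  rw [hsplit, C.expT_add R, hη2, one_mul]
  · exact C.expT_of_real hβ hmet hE hc
  · simp [hTZ, sub_lie, smul_lie]

/-- The exponentials of the coroots of the imaginary roots. -/
theorem isExpH_coroot_imag (hsl : R.SimplyLaced) (hadm : C.Admissible R) {α : H.hDual}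
    (hα : α ∈ H.imagRoots) :
    (α ∈ H.compactRoots → C.IsExpH H ((2 * Real.pi * Complex.I : ℂ) • H.coroot α) 1) ∧
    (α ∈ H.noncompactRoots → C.IsExpH H ((2 * Real.pi * Complex.I : ℂ) • H.coroot α) C.neg) := by
  obtain ⟨T, hT⟩ := exists_ofReal_eq_I_smul_coroot hα
  exact ⟨fun h => C.isExpH_of_expT T hT (C.expT_of_compact h hT), fun h => C.isExpH_of_expT T hT
    (C.expT_of_noncompact h (C.isMetaplectic_of_admissible hsl hadm (Or.inr h)) hT)⟩

/-- The exponentials attached to complex roots. -/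
theorem isExpH_coroot_complex (hsl : R.SimplyLaced) (hadm : C.Admissible R) {α : H.hDual}
    (hα : α ∈ H.complexRoots) :
    (α (H.θh (H.coroot α)) = 0 →
      C.IsExpH H ((2 * Real.pi * Complex.I : ℂ) • (H.coroot α + H.θh (H.coroot α))) 1) ∧
    (α (H.θh (H.coroot α)) ≠ 0 →
      C.IsExpH H ((2 * Real.pi * Complex.I : ℂ) • (H.coroot α + H.θh (H.coroot α))) C.neg) := by
  obtain ⟨T, hT⟩ := exists_ofReal_eq_I_smul_add hα.1
  refine ⟨fun h0 => C.isExpH_of_expT T hT ?_, fun h0 => C.isExpH_of_expT T hT ?_⟩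
  · obtain ⟨U, t⟩ := exists_triple_of_complex hsl hα h0
    obtain ⟨J, J', h1, h2, h3⟩ := RealReductiveLinear.exists_su2_of_triple t (T := T.1)
      (by rw [← incl_ofReal, hT, map_smul])
    exact C.expT_eq_one_of_su2 R h1 h2 h3
  · rcases (apply_θh_coroot hα).resolve_left h0 with h | h
    · obtain ⟨h1, h2⟩ := add_comp_θh_mem_noncompactRoots hα h
      rw [← h2] at hT
      exact C.expT_of_noncompact h1 (C.isMetaplectic_of_admissible hsl hadm (Or.inr h1)) hT
    · exact C.expT_of_complex hα h (C.isMetaplectic_of_admissible hsl hadm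
        (Or.inl (sub_comp_θh_mem_realRoots hα h).1)) hT

end TwoFoldCover

/-! ### Integrality of the ρ-shifts. -/

namespace RealReductiveLinear.Cartan

open Complexification

variable {R : RealReductiveLinear G n} {H : R.Cartan}

/-- The root system is reduced. -/
theorem two_smul_notMem_roots {β : H.hDual} (hβ : β ∈ H.roots) : (2 : ℂ) • β ∉ H.roots := by
  intro h
  obtain ⟨E, hE, h0, t⟩ := exists_isSl2Triple hβ
  obtain ⟨W, hW, hW0⟩ := exists_mem_rootSpace h
  have := FiniteDimensional.finiteDimensional_submodule R.g₀.toSubmodule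
  have hF : -R.θg (conj E) ∈ H.rootSpace (-β) := neg_mem (conj_θg_mem_rootSpace hE)
  have hne := t.lie_f_ne_zero (k := 4) (m := W) (by
    rw [lie_incl hW, LinearMap.smul_apply, apply_coroot hβ]; norm_num) hW0 (by norm_num)
  have hmem := lie_mem_rootSpace hF hW
  rw [show -β + (2 : ℂ) • β = β by module] at hmem
  obtain ⟨a, ha⟩ := exists_eq_smul_of_mem hβ hE h0 hmem
  -- Lowering a vector of weight 4 gives a multiple of `E`. Invariance of the form shows that it
  -- pairs to zero with the vector opposite to `E`, so it vanishes, contradicting injectivity of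
  -- lowering on positive weights.
  have h1 := R.Bg_lie (-R.θg (conj E)) W (-R.θg (conj E))
  rw [lie_self, map_zero, neg_zero, ha, map_smul, LinearMap.smul_apply, map_neg, Bg_θg_conj,
    neg_neg, smul_eq_mul, mul_eq_zero] at h1
  have h2 : (R.normSq E : ℂ) ≠ 0 := by exact_mod_cast (R.normSq_pos h0).ne'
  rw [h1.resolve_right h2, zero_smul] at ha
  exact hne ha

/-- The hypothesis amounts to `k α = 2β`. Pairing with `β^∨` shows that `k` divides 4, so an odd `k`
is `±1` and `2β` would be a root. -/
theorem even_of_reflection_eq_neg {α β : H.hDual} (hα : α ∈ H.roots) (hβ : β ∈ H.roots) {k : ℤ}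
    (hk : β (H.coroot α) = k) (h : -(β - β (H.coroot α) • α) = β) : Even k := by
  have h1 : (k : ℂ) • α = (2 : ℂ) • β := by
    rw [hk] at h
    rw [two_smul]
    nth_rewrite 2 [← h]
    module
  obtain ⟨l, hl⟩ := exists_int_apply_coroot hβ hα
  have h2 := LinearMap.congr_fun h1 (H.coroot β)
  rw [LinearMap.smul_apply, LinearMap.smul_apply, hl, apply_coroot hβ, smul_eq_mul,
    smul_eq_mul] at h2
  have hkl : k * l = 4 := by
    have : ((k * l : ℤ) : ℂ) = (4 : ℤ) := by push_cast; rw [h2]; norm_num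
    exact_mod_cast this
  have hdvd : k ∣ 4 := ⟨l, hkl.symm⟩
  rw [← Int.not_odd_iff_even]
  intro hodd
  have hle := Int.le_of_dvd (by norm_num) hdvd
  have hge : -4 ≤ k := by
    have := Int.le_of_dvd (by norm_num) ((neg_dvd).2 hdvd)
    omega
  have hcases : k = 1 ∨ k = -1 := by
    obtain ⟨j, rfl⟩ := hodd
    have : j = 0 ∨ j = 1 ∨ j = -1 ∨ j = -2 := by omega
    rcases this with rfl | rfl | rfl | rfl <;> omega
  rcases hcases with rfl | rfl
  · apply two_smul_notMem_roots hβ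
    rw [← h1]
    simpa using hα
  · apply two_smul_notMem_roots hβ
    rw [← h1]
    simpa using neg_mem_roots hα

theorem neg_mem_imagRoots {α : H.hDual} (hα : α ∈ H.imagRoots) : -α ∈ H.imagRoots :=
  ⟨neg_mem_roots hα.1, by rw [LinearMap.neg_comp, hα.2]⟩

theorem reflection_mem_imagRoots {α β : H.hDual} (hα : α ∈ H.imagRoots) (hβ : β ∈ H.imagRoots) :
    β - β (H.coroot α) • α ∈ H.imagRoots :=
  ⟨reflection_mem_roots hα.1 hβ.1, by rw [LinearMap.sub_comp, LinearMap.smul_comp, hα.2, hβ.2]⟩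

/-- `2ρ_i` has even pairing with `α^∨`. Reality and regularity of `μ` make exactly one of `±β`
positive, so reflection in `α`, corrected by a sign, permutes the positive imaginary roots; the
parity of the sum is then decided by the fixed points. -/
theorem exists_int_rhoImag {μ : H.hDual} (hreal : ∀ β ∈ H.imagRoots, (H.pairing μ β).im = 0)
    (hreg : ∀ β ∈ H.roots, H.pairing μ β ≠ 0) {α : H.hDual} (hα : α ∈ H.imagRoots) :
    ∃ N : ℤ, H.rhoImag μ (H.coroot α) = N := by
  classical
  have hfin : {β | β ∈ H.imagRoots ∧ 0 < (H.pairing μ β).re}.Finite :=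
    H.finite_roots.subset fun β hβ => hβ.1.1
  choose! k hk using fun β (hβ : β ∈ H.imagRoots) => exists_int_apply_coroot hα.1 hβ.1
  have hsum : ∑ᶠ (β) (_ : β ∈ H.imagRoots ∧ 0 < (H.pairing μ β).re), β =
      ∑ β ∈ hfin.toFinset, β := finsum_mem_eq_finite_toFinset_sum (fun β => β) hfin
  have hmem {β : H.hDual} : β ∈ hfin.toFinset ↔ β ∈ H.imagRoots ∧ 0 < (H.pairing μ β).re := by
    rw [Set.Finite.mem_toFinset]; rfl
  have hor {β : H.hDual} (hβ : β ∈ H.imagRoots) (h : β ∉ hfin.toFinset) :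
      -β ∈ hfin.toFinset := by
    rw [hmem] at h ⊢
    refine ⟨neg_mem_imagRoots hβ, ?_⟩
    have h1 : (H.pairing μ β).re ≠ 0 := fun h0 =>
      hreg β hβ.1 (Complex.ext h0 (hreal β hβ))
    have h2 : ¬ 0 < (H.pairing μ β).re := fun h2 => h ⟨hβ, h2⟩
    rw [pairing, coroot_neg hβ.1, map_neg, Complex.neg_re, neg_pos]
    exact lt_of_le_of_ne (not_lt.1 h2) h1
  have hnot {β : H.hDual} (hβ : β ∈ hfin.toFinset) : -β ∉ hfin.toFinset := by
    rw [hmem] at hβ ⊢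
    rintro ⟨-, h2⟩
    rw [pairing, coroot_neg hβ.1.1, map_neg, Complex.neg_re, neg_pos] at h2
    exact lt_asymm h2 hβ.2
  have hinv (β : H.hDual) : (β - β (H.coroot α) • α) -
      (β - β (H.coroot α) • α) (H.coroot α) • α = β := by
    simp only [LinearMap.sub_apply, LinearMap.smul_apply, apply_coroot hα.1, smul_eq_mul]
    module
  have hinv' (β : H.hDual) : -(β - β (H.coroot α) • α) -
      (-(β - β (H.coroot α) • α)) (H.coroot α) • α = -β := by
    simp only [LinearMap.neg_apply, LinearMap.sub_apply, LinearMap.smul_apply,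
      apply_coroot hα.1, smul_eq_mul]
    module
  have hks {β : H.hDual} (hβ : β ∈ H.imagRoots) : k (β - β (H.coroot α) • α) = -k β := by
    have h1 := hk _ (reflection_mem_imagRoots hα hβ)
    rw [LinearMap.sub_apply, LinearMap.smul_apply, apply_coroot hα.1, hk β hβ, smul_eq_mul] at h1
    have : ((k (β - β (H.coroot α) • α) : ℤ) : ℂ) = ((-k β : ℤ) : ℂ) := by
      rw [hk β hβ, ← h1]; push_cast; ring
    exact_mod_cast this
  have hkneg {β : H.hDual} (hβ : β ∈ H.imagRoots) : k (-β) = -k β := by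
    have h1 := hk _ (neg_mem_imagRoots hβ)
    rw [LinearMap.neg_apply, hk β hβ] at h1
    exact_mod_cast h1.symm
  have heven : Even (∑ β ∈ hfin.toFinset, k β) := by
    rw [← ZMod.intCast_eq_zero_iff_even, Int.cast_sum]
    have h2 (x : ZMod 2) : x + x = 0 := CharTwo.add_self_eq_zero x
    -- The involution changes `k β` at most by a sign, so paired terms cancel modulo 2. A fixed root
    -- either is orthogonal to `α` or is negated by the reflection, with `k β` even in both cases.
    refine Finset.sum_involution (fun β _ => if β - β (H.coroot α) • α ∈ hfin.toFinset then
      β - β (H.coroot α) • α else -(β - β (H.coroot α) • α)) ?_ ?_ ?_ ?_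
    · intro β hβ
      have hβi := (hmem.1 hβ).1
      split_ifs with h
      · rw [hks hβi, Int.cast_neg, add_neg_cancel]
      · rw [hkneg (reflection_mem_imagRoots hα hβi), hks hβi, neg_neg, h2]
    · intro β hβ hne
      have hβi := (hmem.1 hβ).1
      contrapose! hne
      split_ifs at hne with h
      · have h3 := hks hβi
        rw [hne] at h3
        have : k β = 0 := by omega
        rw [this, Int.cast_zero]
      · exact (ZMod.intCast_eq_zero_iff_even).2
          (even_of_reflection_eq_neg hα.1 hβi.1 (hk β hβi) hne)
    · intro β hβ
      have hβi := (hmem.1 hβ).1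
      split_ifs with h
      · exact h
      · exact hor (reflection_mem_imagRoots hα hβi) h
    · intro β hβ
      split_ifs with h h3 h3
      · exact hinv β
      · rw [hinv] at h3
        exact absurd hβ h3
      · rw [hinv'] at h3
        exact absurd h3 (hnot hβ)
      · rw [hinv', neg_neg]
  obtain ⟨N, hN⟩ := heven
  refine ⟨N, ?_⟩
  rw [rhoImag, hsum, LinearMap.smul_apply, LinearMap.sum_apply,
    Finset.sum_congr rfl fun β hβ => hk β (hmem.1 hβ).1, ← Int.cast_sum, hN, smul_eq_mul]
  push_cast
  ring

theorem exists_int_rhoCompact (μ : H.hDual) {α : H.hDual} (hα : α ∈ H.roots) :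
    ∃ N : ℤ, ((2 : ℂ) • H.rhoCompact μ) (H.coroot α) = N := by
  have hfin : {β | β ∈ H.compactRoots ∧ 0 < (H.pairing μ β).re}.Finite :=
    H.finite_roots.subset fun β hβ => hβ.1.1.1
  choose! k hk using fun β (hβ : β ∈ H.roots) => exists_int_apply_coroot hα hβ
  have hsum : ∑ᶠ (β) (_ : β ∈ H.compactRoots ∧ 0 < (H.pairing μ β).re), β =
      ∑ β ∈ hfin.toFinset, β := finsum_mem_eq_finite_toFinset_sum (fun β => β) hfin
  refine ⟨∑ β ∈ hfin.toFinset, k β, ?_⟩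
  rw [rhoCompact, hsum, smul_smul, LinearMap.smul_apply, LinearMap.sum_apply,
    Finset.sum_congr rfl fun β hβ => hk β ((Set.Finite.mem_toFinset _).1 hβ).1.1.1]
  push_cast
  rw [smul_eq_mul]
  ring

end RealReductiveLinear.Cartan

/-! ### The Cartan subgroup of the cover and the elements `m_α`. -/

namespace TwoFoldCover

open Complexification RealReductiveLinear.Cartan

variable {R : RealReductiveLinear G n} (C : TwoFoldCover G Gt) {H : R.Cartan}

theorem mem_cartan {x : Gt} : x ∈ C.cartan H ↔
    ∀ X ∈ H.h₀, Commute (C.toGL R x).val (X : Matrix (Fin n) (Fin n) ℝ) := Iff.rfl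

theorem commute_coe (X Y : H.h₀) :
    Commute ((X : R.g₀) : Matrix (Fin n) (Fin n) ℝ) ((Y : R.g₀) : Matrix (Fin n) (Fin n) ℝ) := by
  rw [commute_iff_eq, ← sub_eq_zero, ← coe_lie, H.lie_eq_zero]
  rfl

theorem expT_mem_cartan (X : H.h₀) : C.expT R X.1 ∈ C.cartan H := by
  rw [mem_cartan]
  intro Y hY
  rw [C.toGL_expT]
  exact (commute_coe X ⟨Y, hY⟩).exp_left

/-- In complex matrices `m_α` is `exp(πi α^∨)`, which commutes with the Cartan subalgebra. -/
theorem IsMElement.mem_cartan {α : H.hDual} (hα : α ∈ H.realRoots) {m : Gt}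
    (hm : C.IsMElement H α m) : m ∈ C.cartan H := by
  obtain ⟨E, hE, hc, hexp⟩ := hm
  rw [C.isExp_iff R] at hexp
  rw [C.mem_cartan]
  intro Y hY
  rw [← hexp, C.toGL_expT]
  have h1 : Commute (complexMatrix R.g₀ (H.incl (H.coroot α))) (realToComplexMatrix n Y) := by
    rw [commute_iff_eq, ← sub_eq_zero, ← complexMatrix_toComplexification, ← complexMatrix_lie,
      show toComplexification Y = H.incl (H.ofReal ⟨Y, hY⟩) from (incl_ofReal H ⟨Y, hY⟩).symm,
      lie_incl_incl, map_zero]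
  have h2 := (h1.smul_left (Real.pi * Complex.I : ℂ)).exp_left
  rw [← exp_pi_smul_of_real hα hE hc, ← realToComplexMatrix_exp] at h2
  apply realToComplexMatrix_injective
  rw [realToComplexMatrix_mul, realToComplexMatrix_mul]
  exact h2

theorem IsMElement.mul_self {α : H.hDual} (hα : α ∈ H.realRoots) (hmet : C.IsMetaplectic H α)
    {m : Gt} (hm : C.IsMElement H α m) : m * m = C.neg := by
  obtain ⟨E, hE, hc, hexp⟩ := hm
  rw [C.isExp_iff R] at hexp
  rw [← C.expT_of_real hα hmet hE hc, ← hexp, ← C.expT_add_smul, two_mul]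

theorem exists_isMElement {α : H.hDual} (hα : α ∈ H.realRoots) : ∃ m, C.IsMElement H α m := by
  obtain ⟨E, hE, hc⟩ := exists_real_rootVector hα
  exact ⟨_, E, hE, hc, (C.isExp_iff R).2 rfl⟩

end TwoFoldCover

/-! ### Genuine regular characters. -/

namespace RegularCharacter

open Complexification RealReductiveLinear.Cartan TwoFoldCover

variable {R : RealReductiveLinear G n} {C : TwoFoldCover G Gt} {H : R.Cartan}
  {γ : RegularCharacter C H}

theorem Genuine.Γ_neg (hγ : γ.Genuine) (z : C.cartan H) (hz : (z : Gt) = C.neg)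
    (v : Fin γ.dim → ℂ) : γ.Γ z v = -v := by
  obtain ⟨z', hz', hne⟩ := hγ
  have hzz : z' = z := by
    apply Subtype.ext
    rw [hz]
    refine ((C.ker_p _).1 hz').resolve_left fun h => hne ?_
    rw [show z' = 1 from Subtype.ext h, map_one]
  rw [hzz] at hne
  have hsq (v) : γ.Γ z (γ.Γ z v) = v := by
    have h1 : z * z = 1 := Subtype.ext (by
      rw [Subgroup.coe_mul, hz, C.neg_mul_neg]; rfl)
    rw [← Module.End.mul_apply, ← map_mul, h1, map_one, Module.End.one_apply]
  have hcomm (x : C.cartan H) (v) : γ.Γ z (γ.Γ x v) = γ.Γ x (γ.Γ z v) := by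
    have h1 : z * x = x * z := Subtype.ext (by
      rw [Subgroup.coe_mul, Subgroup.coe_mul, hz, C.neg_central])
    rw [← Module.End.mul_apply, ← map_mul, h1, map_mul, Module.End.mul_apply]
  -- Schur's lemma for a central involution: its -1-eigenspace is invariant, and it is nonzero
  -- because the involution does not act as the identity.
  let S : Subrepresentation γ.Γ :=
    { toSubmodule := Module.End.eigenspace (γ.Γ z) (-1)
      apply_mem_toSubmodule := fun x v hv => by
        rw [Module.End.mem_eigenspace_iff] at hv ⊢
        rw [hcomm, hv, map_smul] }
  have := γ.Γ_irreducible
  rcases eq_bot_or_eq_top S with h | h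
  · exfalso
    apply hne
    refine LinearMap.ext fun w => ?_
    have hw : w - γ.Γ z w ∈ S := by
      show w - γ.Γ z w ∈ Module.End.eigenspace (γ.Γ z) (-1)
      rw [Module.End.mem_eigenspace_iff, map_sub, hsq, neg_one_smul, neg_sub]
    rw [h] at hw
    have h0 : w - γ.Γ z w = 0 := hw
    rw [Module.End.one_apply, ← sub_eq_zero.1 h0]
  · have hv : v ∈ S := by rw [h]; trivial
    have h2 : γ.Γ z v = (-1 : ℂ) • v := Module.End.mem_eigenspace_iff.1
      (show v ∈ Module.End.eigenspace (γ.Γ z) (-1) from hv)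
    rw [h2, neg_one_smul]

theorem nontrivial_space (γ : RegularCharacter C H) : Nontrivial (Fin γ.dim → ℂ) := by
  have := γ.Γ_irreducible
  by_contra h
  rw [not_nontrivial_iff_subsingleton] at h
  obtain ⟨S, T, hST⟩ := exists_pair_ne (Subrepresentation γ.Γ)
  apply hST
  apply SetLike.ext
  intro v
  rw [Subsingleton.elim v 0]
  exact ⟨fun _ => T.toSubmodule.zero_mem, fun _ => S.toSubmodule.zero_mem⟩

theorem Γ_expT (γ : RegularCharacter C H) (X : H.h₀) (v : Fin γ.dim → ℂ) :
    γ.Γ ⟨C.expT R X.1, C.expT_mem_cartan X⟩ v =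
      Complex.exp ((γ.lam + H.rhoImag γ.lam - (2 : ℂ) • H.rhoCompact γ.lam) (H.ofReal X)) • v := by
  let φ : ℝ → C.cartan H := fun t => ⟨C.expT R (t • X.1), C.expT_mem_cartan (t • X)⟩
  have hφ : IsOneParam (C.cartanToGL H) (X : R.g₀) φ :=
    ⟨(C.continuous_expT_smul R X.1).subtype_mk _,
      fun s t => Subtype.ext (C.expT_add_smul R X.1 s t), (C.isOneParam_expT R X.1).2.2⟩
  have h1 := oneParam_apply_eq_exp_smul (Γ := fun t => γ.Γ (φ t)) (by
    rw [show φ 0 = 1 from hφ.zero, map_one]) (fun s t => by rw [hφ.2.1, map_mul])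
    (γ.dΓ X φ hφ) 1 v
  rw [Complex.ofReal_one, one_mul] at h1
  rw [← h1]
  congr 2
  apply Subtype.ext
  show C.expT R X.1 = C.expT R ((1 : ℝ) • X.1)
  rw [one_smul]

/-- The value of `exp(2πi λ)` at the coroot of an imaginary root. -/
theorem exp_pairing_imag (γ : RegularCharacter C H) {α : H.hDual} (hα : α ∈ H.imagRoots)
    {T : H.h₀} (hT : H.ofReal T = Complex.I • H.coroot α) (v : Fin γ.dim → ℂ) :
    γ.Γ ⟨C.expT R ((2 * Real.pi) • T).1, C.expT_mem_cartan _⟩ v =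
      Complex.exp (H.pairing γ.lam α * (2 * Real.pi * Complex.I)) • v := by
  rw [Γ_expT]
  congr 1
  -- The shift from `λ` to the differential of `Γ` is integral on the coroot, so it does not affect
  -- the exponential.
  obtain ⟨N, hN⟩ := exists_int_rhoImag γ.lam_real γ.lam_regular hα
  obtain ⟨M, hM⟩ := exists_int_rhoCompact γ.lam hα.1
  have h1 : H.ofReal ((2 * Real.pi) • T) = (2 * Real.pi * Complex.I : ℂ) • H.coroot α := by
    rw [RealReductiveLinear.Cartan.ofReal, toComplexification_smul,
      ← RealReductiveLinear.Cartan.ofReal, hT, smul_smul]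
    push_cast
    rfl
  rw [h1, map_smul, LinearMap.sub_apply, LinearMap.add_apply, hN, hM, smul_eq_mul,
    show (2 * Real.pi * Complex.I : ℂ) * (γ.lam (H.coroot α) + N - M) =
      H.pairing γ.lam α * (2 * Real.pi * Complex.I) + (N - M : ℤ) * (2 * Real.pi * Complex.I) by
      rw [pairing]; push_cast; ring, Complex.exp_add, Complex.exp_int_mul_two_pi_mul_I, mul_one]

theorem exists_int_of_exp_eq_one {z : ℂ} (h : Complex.exp (z * (2 * Real.pi * Complex.I)) = 1) :
    ∃ k : ℤ, z = k := by
  obtain ⟨k, hk⟩ := Complex.exp_eq_one_iff.1 h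
  exact ⟨k, mul_right_cancel₀ Complex.two_pi_I_ne_zero hk⟩

theorem exists_int_of_compact (γ : RegularCharacter C H) {α : H.hDual} (hα : α ∈ H.compactRoots) :
    ∃ k : ℤ, H.pairing γ.lam α = k := by
  have := γ.nontrivial_space
  obtain ⟨v, hv⟩ := exists_ne (0 : Fin γ.dim → ℂ)
  obtain ⟨T, hT⟩ := exists_ofReal_eq_I_smul_coroot hα.1
  have h1 := γ.exp_pairing_imag hα.1 hT v
  rw [show (⟨C.expT R ((2 * Real.pi) • T).1, C.expT_mem_cartan _⟩ : C.cartan H) = 1 from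
    Subtype.ext (C.expT_of_compact hα hT), map_one, Module.End.one_apply] at h1
  refine exists_int_of_exp_eq_one (smul_left_injective ℂ hv ?_)
  simp only
  rw [← h1, one_smul]

theorem Genuine.exp_eq_neg_one (hγ : γ.Genuine) {α : H.hDual} (hα : α ∈ H.noncompactRoots)
    (hmet : C.IsMetaplectic H α) :
    Complex.exp (H.pairing γ.lam α * (2 * Real.pi * Complex.I)) = -1 := by
  have := γ.nontrivial_space
  obtain ⟨v, hv⟩ := exists_ne (0 : Fin γ.dim → ℂ)
  obtain ⟨T, hT⟩ := exists_ofReal_eq_I_smul_coroot hα.1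
  have h1 := γ.exp_pairing_imag hα.1 hT v
  rw [hγ.Γ_neg _ (C.expT_of_noncompact hα hmet hT)] at h1
  refine smul_left_injective ℂ hv ?_
  simp only
  rw [← h1, neg_one_smul]

theorem Genuine.compact_iff (hsl : R.SimplyLaced) (hadm : C.Admissible R) (hγ : γ.Genuine)
    {α : H.hDual} (hα : α ∈ H.imagRoots) :
    α ∈ H.compactRoots ↔ α ∈ H.integralRoots γ.lam := by
  refine ⟨fun h => ⟨hα.1, γ.exists_int_of_compact h⟩, fun ⟨_, k, hk⟩ => ?_⟩
  refine (mem_compactRoots_or hα).resolve_right fun h => ?_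
  have h1 := hγ.exp_eq_neg_one h (C.isMetaplectic_of_admissible hsl hadm (Or.inr h))
  rw [hk, Complex.exp_int_mul_two_pi_mul_I] at h1
  norm_num at h1

theorem Genuine.imagRoots_subset (hsl : R.SimplyLaced) (hadm : C.Admissible R) (hγ : γ.Genuine) :
    H.imagRoots ⊆ C.halfIntegralRoots H γ.lam := by
  intro α hα
  refine ⟨hα.1, ?_⟩
  rcases mem_compactRoots_or hα with h | h
  · obtain ⟨k, hk⟩ := γ.exists_int_of_compact h
    rw [pairing] at hk
    rw [mult]
    split_ifs
    · exact ⟨2 * k, by rw [map_smul, hk, smul_eq_mul]; push_cast; rfl⟩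
    · exact ⟨k, by rw [one_smul, hk]⟩
  · have hmet := C.isMetaplectic_of_admissible hsl hadm (Or.inr h)
    have h1 := hγ.exp_eq_neg_one h hmet
    rw [mult, if_pos hmet, map_smul, smul_eq_mul]
    apply exists_int_of_exp_eq_one
    rw [show (2 : ℂ) * γ.lam (H.coroot α) * (2 * Real.pi * Complex.I) =
      H.pairing γ.lam α * (2 * Real.pi * Complex.I) +
        H.pairing γ.lam α * (2 * Real.pi * Complex.I) by rw [pairing]; ring, Complex.exp_add, h1]
    norm_num

theorem Genuine.imagPlus_eq (hsl : R.SimplyLaced) (hadm : C.Admissible R) (hγ : γ.Genuine) :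
    γ.imagPlus = H.imagRoots ∩ H.integralRoots γ.lam := by
  ext α
  constructor
  · rintro ⟨⟨h1, -⟩, h2⟩
    exact ⟨h1, (hγ.compact_iff hsl hadm h1).1 h2⟩
  · rintro ⟨h1, h2⟩
    exact ⟨⟨h1, hγ.imagRoots_subset hsl hadm h1⟩, (hγ.compact_iff hsl hadm h1).2 h2⟩

/-- `m² = -1` in the cover, and a genuine representation sends this to the scalar -1. -/
theorem Genuine.eigenvalue_mul_self (hsl : R.SimplyLaced) (hadm : C.Admissible R)
    (hγ : γ.Genuine) {α : H.hDual} (hα : α ∈ H.realRoots)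
    {m : C.cartan H} (hm : C.IsMElement H α m) {c : ℂ}
    (hc : Module.End.HasEigenvalue (γ.Γ m) c) : c * c = -1 := by
  obtain ⟨v, hv⟩ := hc.exists_hasEigenvector
  have h1 := hγ.Γ_neg (m * m) (IsMElement.mul_self C hα
    (C.isMetaplectic_of_admissible hsl hadm (Or.inl hα)) hm) v
  rw [map_mul, Module.End.mul_apply, hv.apply_eq_smul, map_smul, hv.apply_eq_smul, smul_smul,
    ← neg_one_smul ℂ v] at h1
  exact smul_left_injective ℂ hv.2 h1

theorem Genuine.realPlus_eq (hsl : R.SimplyLaced) (hadm : C.Admissible R) (hγ : γ.Genuine)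
    (ε : H.hDual → ℤˣ) :
    γ.realPlus ε = H.realRoots ∩ H.integralRoots γ.lam := by
  ext α
  have hε : (((ε α : ℤˣ) : ℤ) : ℂ) * ((ε α : ℤˣ) : ℤ) = 1 := by
    exact_mod_cast Int.units_coe_mul_self (ε α)
  set e : ℂ := (((ε α : ℤˣ) : ℤ) : ℂ) with he
  constructor
  · rintro ⟨⟨hα, -, k, hk⟩, hpar⟩
    refine ⟨hα, hα.1, ?_⟩
    by_contra hnint
    apply hpar
    have hmet := C.isMetaplectic_of_admissible hsl hadm (Or.inl hα)
    rw [mult, if_pos hmet, map_smul, smul_eq_mul, ← pairing] at hk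
    set w := Complex.exp (Real.pi * Complex.I * H.pairing γ.lam α) with hw
    have hw1 : Complex.exp (-(Real.pi * Complex.I * H.pairing γ.lam α)) * w = 1 := by
      rw [hw, ← Complex.exp_add, neg_add_cancel, Complex.exp_zero]
    have hodd : Odd k := by
      rw [← Int.not_even_iff_odd]
      rintro ⟨j, rfl⟩
      refine hnint ⟨j, ?_⟩
      push_cast at hk
      linear_combination hk / 2
    have hww : w * w = -1 := by
      obtain ⟨j, rfl⟩ := hodd
      rw [hw, ← Complex.exp_add, show Real.pi * Complex.I * H.pairing γ.lam α +
        Real.pi * Complex.I * H.pairing γ.lam α = j * (2 * Real.pi * Complex.I) +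
          Real.pi * Complex.I by push_cast at hk; linear_combination Real.pi * Complex.I * hk,
        Complex.exp_add, Complex.exp_int_mul_two_pi_mul_I, Complex.exp_pi_mul_I, one_mul]
    -- Off the integers the two exponentials are opposite square roots of -1, so the two permitted
    -- eigenvalues exhaust `±i` for either sign `e`.
    have hw2 : Complex.exp (-(Real.pi * Complex.I * H.pairing γ.lam α)) = -w := by
      linear_combination (-w) * hw1 +
        Complex.exp (-(Real.pi * Complex.I * H.pairing γ.lam α)) * hww
    obtain ⟨m, hm⟩ := C.exists_isMElement hα
    refine ⟨⟨m, IsMElement.mem_cartan C hα hm⟩, hm, fun c hc => ?_⟩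
    have hcc := hγ.eigenvalue_mul_self hsl hadm hα hm hc
    rw [← he, hw2]
    have h1 : c * c = (-e * w) * (-e * w) := by
      linear_combination hcc - e * e * hww + hε
    rcases mul_self_eq_mul_self_iff.1 h1 with h | h
    · exact Or.inl h
    · right
      rw [h]
      ring
  · rintro ⟨hα, -, k, hk⟩
    refine ⟨⟨hα, hα.1, ?_⟩, ?_⟩
    · have hmet := C.isMetaplectic_of_admissible hsl hadm (Or.inl hα)
      rw [mult, if_pos hmet]
      rw [pairing] at hk
      exact ⟨2 * k, by rw [map_smul, hk, smul_eq_mul]; push_cast; rfl⟩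
    · rintro ⟨m, hm, hpar⟩
      have := γ.nontrivial_space
      obtain ⟨c, hc⟩ := Module.End.exists_eigenvalue (γ.Γ m)
      have hcc := hγ.eigenvalue_mul_self hsl hadm hα hm hc
      have hexp (j : ℤ) : Complex.exp (Real.pi * Complex.I * j) *
          Complex.exp (Real.pi * Complex.I * j) = 1 := by
        rw [← Complex.exp_add, ← Complex.exp_int_mul_two_pi_mul_I j]
        congr 1
        ring
      -- For integral pairing the permitted values are `±1`, which is incompatible with `c * c =
      -- -1`.
      have h1 : c * c = 1 := by
        rcases hpar c hc with h | h
        · rw [hk] at h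
          rw [h]
          linear_combination (hexp k) * e * e + hε
        · have h2 := hexp (-k)
          rw [Int.cast_neg, mul_neg] at h2
          rw [hk] at h
          rw [h]
          linear_combination h2 * e * e + hε
      rw [h1] at hcc
      norm_num at hcc

end RegularCharacter

end

theorem propositionp {G Gt : Type*} [Group G] [TopologicalSpace G] [IsTopologicalGroup G]
    [Group Gt] [TopologicalSpace Gt] [IsTopologicalGroup Gt] [T2Space Gt] {n : ℕ}
    (R : RealReductiveLinear G n) (C : TwoFoldCover G Gt)
    (hsl : R.SimplyLaced) (hadm : C.Admissible R) (H : R.Cartan) :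
    -- gradings attached to a genuine regular character
    (∀ γ : RegularCharacter C H, γ.Genuine →
      γ.realPlus H.paritySign = H.realRoots ∩ H.integralRoots γ.lam ∧
      (∀ ε : H.hDual → ℤˣ, γ.realPlus ε = H.realRoots ∩ H.integralRoots γ.lam) ∧
      γ.imagPlus = H.imagRoots ∩ H.integralRoots γ.lam ∧
      H.imagRoots ⊆ C.halfIntegralRoots H γ.lam ∧
      (∀ α ∈ H.imagRoots, α ∈ H.compactRoots ↔ α ∈ H.integralRoots γ.lam)) ∧
    -- exponentials of coroots of imaginary roots
    (∀ α ∈ H.imagRoots,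
      (α ∈ H.compactRoots →
        C.IsExpH H ((2 * Real.pi * Complex.I : ℂ) • H.coroot α) 1) ∧
      (α ∈ H.noncompactRoots →
        C.IsExpH H ((2 * Real.pi * Complex.I : ℂ) • H.coroot α) C.neg)) ∧
    -- exponentials attached to complex roots
    (∀ α ∈ H.complexRoots,
      (α (H.θh (H.coroot α)) = 0 →
        C.IsExpH H ((2 * Real.pi * Complex.I : ℂ) • (H.coroot α + H.θh (H.coroot α))) 1) ∧
      (α (H.θh (H.coroot α)) ≠ 0 →
        C.IsExpH H ((2 * Real.pi * Complex.I : ℂ) • (H.coroot α + H.θh (H.coroot α))) C.neg)) := by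
  refine ⟨fun γ hγ => ⟨hγ.realPlus_eq hsl hadm _, hγ.realPlus_eq hsl hadm,
    hγ.imagPlus_eq hsl hadm, hγ.imagRoots_subset hsl hadm,
    fun α hα => hγ.compact_iff hsl hadm hα⟩,
    fun α hα => C.isExpH_coroot_imag hsl hadm hα,
    fun α hα => C.isExpH_coroot_complex hsl hadm hα⟩
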